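/- Let $K, L$ be non-negative integers. We say that positive integers $a_1,\dots,a_K,b_1,\dots,b_L$ with $\sum_i a_i=\sum_j b_j$ and $a_i\ne b_j$ for all $i,j$ give an integral factorial ratio if $$\frac{(a_1n)!\,(a_2n)!\cdots(a_Kn)!}{(b_1n)!\,(b_2n)!\cdots(b_Ln)!}$$ is an integer for every natural number $n$; the tuple is primitive if $\gcd(a_1,\dots,a_K,b_1,\dots,b_L)=1$. Let $D\ge 1$ be an integer and put $L=K+D$. Then the following hold. (1) There are no integral factorial ratios with $K$ terms in the numerator and $L$ terms in the denominator unless $$K+L\le (1+o(1))\,\frac{18e^{2\gamma}}{\pi^2}\,D^2(\log\log(D+2))^2,$$ where $\gamma$ is Euler's constant. That is, there is a function $\varepsilon$ of $D$ alone with $\varepsilon(D)\to0$ as $D\to\infty$ such that, for every $D\ge1$, every integral factorial ratio with $L=K+D$ satisfies this inequality with $\varepsilon(D)$ in place of $o(1)$. (2) For each $D\ge 1$ and $K$, the points $(a_1,\dots,a_K,b_1,\dots,b_L)\in\mathbb{R}^{K+L}$ corresponding to integral factorial ratios lie on finitely many vector subspaces of $\mathbb{R}^{K+L}$ of dimension at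 most $3D^2-1$. (3) In the special case $D=2$, there are no integral factorial ratios with $K+L\ge 82$, and there are at most finitely many primitive integral factorial ratios with $K+L\ge 76$. -/

import Mathlib

/-- The tuples `a = (a₁, …, a_K)` and `b = (b₁, …, b_L)` of positive integers give rise to an
integral factorial ratio: they have equal sums, no entry of `a` equals an entry of `b` (nothing
cancels), and `(a₁ n)! ⋯ (a_K n)! / ((b₁ n)! ⋯ (b_L n)!)` is an integer for every natural `n`. -/
structure IsIntegralFactorialRatio {K L : ℕ} (a : Fin K → ℕ) (b : Fin L → ℕ) : Prop where
  num_pos : ∀ i, 0 < a i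
  den_pos : ∀ j, 0 < b j
  sum_eq : ∑ i, a i = ∑ j, b j
  no_common : ∀ i j, a i ≠ b j
  integral : ∀ n : ℕ, (∏ j, (b j * n).factorial) ∣ (∏ i, (a i * n).factorial)

/-- The greatest common divisor of all the entries of `a` and `b` is `1`. -/
def IsPrimitiveTuple {K L : ℕ} (a : Fin K → ℕ) (b : Fin L → ℕ) : Prop :=
  Nat.gcd (Finset.univ.gcd a) (Finset.univ.gcd b) = 1

/-- The point `(a₁, …, a_K, b₁, …, b_L)` of `ℝ^(K+L)`. -/
def tuplePoint {K L : ℕ} (a : Fin K → ℕ) (b : Fin L → ℕ) : Fin (K + L) → ℝ :=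
  Fin.append (fun i => (a i : ℝ)) (fun j => (b j : ℝ))

/-!
For an integral factorial ratio consider the step function `∑ ⌊aᵢ t⌋ - ∑ ⌊bⱼ t⌋` on `(0, 1)`.
Comparing the exponents of a large prime in numerator and denominator shows that it is nonnegative
(`IsIntegralFactorialRatio.sum_floor_le`), and the symmetry `t ↦ 1 - t` shows that it is at most
`D`. Hence the signed sum of the sawtooth functions `1/2 - {x t}`, over the `n = K + L` entries `x`
of the tuple, is bounded by `D / 2`, and its `L²` norm, scaled by `√12`, satisfies `‖·‖² ≤ 3 D²`
(`IsIntegralFactorialRatio.norm_sq_le`). The scaled sawtooth functions have the Gram matrix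
`gcd(a, b)² / (a b)` (`isGcdGram_sawtoothVec`), and the theorem follows from lower bounds for
`‖∑ wᵢ φ(xᵢ)‖²`, for vectors `φ` with this Gram matrix and signs `wᵢ` without cancellation.

These lower bounds are proved one prime at a time. Sort the integers by their `p`-adic valuation.
The norm is then that of a first order autoregression with coefficient `1 / p`, whose inputs are
the vectors of the single classes with the powers of `p` removed (`IsGcdGram.exists_chain`).
Keeping track of `q - θ ‖u‖²`, where `q` is the squared norm so far, `u` the state of the recursion
and `θ` a parameter that may change from step to step, bounds the norm by the norms of the classes,
which involve fewer primes (`chain_step`). This is used in two ways.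

* For `n ≤ 82` the resulting recursion in the sizes of the classes is solved numerically for the
  primes `2, 3, 5, 7`, and one more table shows that primes `p ≥ 11` do not make the bound worse
  (`IsGcdGram.normBound_le`). The bound exceeds `12 = 3 · 2²` for `n = 82`, which excludes `D = 2`
  with `n ≥ 82`.
* For large `n` the choice `θ = 1 / p` loses a factor `(p - 1) / (p + 1)`. For primes `p ≥ y` the
  largest class can be given a weight `1 - O(1 / (ε p²))` and the other ones `1 - 2 ε`. As these
  contain at most half of the elements, the second loss occurs at most `log₂ n` times
  (`IsGcdGram.card_mul_prod_le_norm_sq`). With `y` about `log n`, up to powers of `log log n`, the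
  product over `p < y` is evaluated by Mertens' theorem and `ζ(2) = π² / 6`
  (`exists_le_sq_mul_prod_primesBelow`); this gives
  `n ≤ (1 + o(1)) (18 e^(2γ) / π²) D² (log log n)²`, and `log log n` is then replaced by
  `log log D`.

For the subspaces, join two entries if their ratio has small height. Entries in distinct components
are nearly orthogonal, so the squared norm is nearly the sum of those of the components, each of
which is at least `1`: there are at most `3 D²` components, and up to finitely many choices of the
ratios inside the components the point is determined by one entry from each. If there are exactly
`3 D²` components, then some component has signed sum different from `0`, because components of
signed sum `0` have at least three entries and a squared norm of at least `1.3`; the condition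
`∑ aᵢ = ∑ bⱼ` then saves one dimension. For `D = 2` and `n ≥ 76` the tables show that there is only
one component, so the tuple is determined up to scaling by finitely many ratios.
-/

/-! ### Gcd Gram matrices and one prime at a time -/

/-- A family of vectors whose Gram matrix is the gcd matrix `gcd(a,b)² / (ab)`. -/
def IsGcdGram {E : Type*} [NormedAddCommGroup E] [InnerProductSpace ℝ E] (φ : ℕ → E) : Prop :=
  ∀ a b : ℕ, a ≠ 0 → b ≠ 0 → inner ℝ (φ a) (φ b) = (Nat.gcd a b : ℝ) ^ 2 / (a * b)

section Chain

variable {E : Type*} [NormedAddCommGroup E] [InnerProductSpace ℝ E] {φ : ℕ → E}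

lemma IsGcdGram.inner_eq_of_factorization_le (hφ : IsGcdGram φ) {p a b : ℕ} (hp : p.Prime)
    (ha : a ≠ 0) (hb : b ≠ 0) (hab : a.factorization p ≤ b.factorization p) :
    inner ℝ (φ a) (φ b) = (1 / p : ℝ) ^ (b.factorization p - a.factorization p) *
      inner ℝ (φ (ordCompl[p] a)) (φ (ordCompl[p] b)) := by
  obtain ⟨i, hi⟩ : ∃ i, i = a.factorization p := ⟨_, rfl⟩
  obtain ⟨d, hd⟩ : ∃ d, i + d = b.factorization p := ⟨_, by rw [hi]; exact Nat.add_sub_cancel' hab⟩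
  have ha' := Nat.ordProj_mul_ordCompl_eq_self a p
  have hb' := Nat.ordProj_mul_ordCompl_eq_self b p
  have hca : ordCompl[p] a ≠ 0 := (Nat.ordCompl_pos p ha).ne'
  have hcb : ordCompl[p] b ≠ 0 := (Nat.ordCompl_pos p hb).ne'
  have hpa : Nat.Coprime p (ordCompl[p] a) := Nat.coprime_ordCompl hp ha
  rw [hφ a b ha hb, hφ _ _ hca hcb]
  rw [← hi] at ha' hca hpa ⊢
  rw [← hd] at hb' hcb ⊢
  generalize a / p ^ i = a' at *
  generalize b / p ^ (i + d) = b' at *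
  have hg : Nat.gcd a b = p ^ i * Nat.gcd a' b' := by
    rw [← ha', ← hb', pow_add, mul_assoc, Nat.gcd_mul_left]
    congr 1
    exact (Nat.Coprime.pow_left d hpa).gcd_mul_left_cancel_right b'
  have hp0 : (p : ℝ) ≠ 0 := by exact_mod_cast hp.ne_zero
  have h1 : (a' : ℝ) ≠ 0 := by exact_mod_cast hca
  have h2 : (b' : ℝ) ≠ 0 := by exact_mod_cast hcb
  rw [hg, ← ha', ← hb']
  push_cast
  rw [Nat.add_sub_cancel_left]
  simp only [pow_add, one_div, inv_pow]
  field_simp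

/-- Sorting a finite family of integers by their `p`-adic valuation turns the norm of the
corresponding combination of gcd vectors into a first order autoregression: with `v k` the
contribution of the valuation `k` (after removing the powers of `p`) and
`u (k + 1) = v k + u k / p`, the squared norm of the part of valuation `≤ k` grows by
`‖u (k + 1)‖² - ‖u k‖² / p²`. The sequence `U` records the norms `‖u k‖`. -/
lemma IsGcdGram.exists_chain (hφ : IsGcdGram φ) {ι : Type*} {p : ℕ} (hp : p.Prime) (s : Finset ι)
    (w : ι → ℝ) (x : ι → ℕ) (hx : ∀ i ∈ s, x i ≠ 0) :
    ∃ U q : ℕ → ℝ, U 0 = 0 ∧ q 0 = 0 ∧ (∀ k, 0 ≤ U k) ∧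
      (∀ k, q (k + 1) = q k + U (k + 1) ^ 2 - (U k / p) ^ 2) ∧
      (∀ k, ‖∑ i ∈ s with (x i).factorization p = k, w i • φ (ordCompl[p] (x i))‖
        ≤ U (k + 1) + U k / p) ∧
      (∀ k, U (k + 1) ≤
        ‖∑ i ∈ s with (x i).factorization p = k, w i • φ (ordCompl[p] (x i))‖ + U k / p) ∧
      (∀ k, q k = ‖∑ i ∈ s with (x i).factorization p < k, w i • φ (x i)‖ ^ 2) := by
  classical
  set v : ℕ → E := fun k => ∑ i ∈ s with (x i).factorization p = k, w i • φ (ordCompl[p] (x i))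
    with hv
  set u : ℕ → E := fun k => ∑ i ∈ s with (x i).factorization p < k,
    (w i * (1 / p : ℝ) ^ (k - 1 - (x i).factorization p)) • φ (ordCompl[p] (x i)) with hu
  set V : ℕ → E := fun k => ∑ i ∈ s with (x i).factorization p < k, w i • φ (x i) with hV
  set c : ℕ → E := fun k => ∑ i ∈ s with (x i).factorization p = k, w i • φ (x i) with hc
  have hp0 : (0 : ℝ) < p := by exact_mod_cast hp.pos
  have hsplit : ∀ k, (s.filter fun i => (x i).factorization p < k + 1) =
      (s.filter fun i => (x i).factorization p < k) ∪
        (s.filter fun i => (x i).factorization p = k) := by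
    intro k; ext i; simp only [Finset.mem_filter, Finset.mem_union]; grind
  have hdisj : ∀ k, Disjoint (s.filter fun i => (x i).factorization p < k)
        (s.filter fun i => (x i).factorization p = k) := by
    intro k; rw [Finset.disjoint_filter]; intro i _ h; omega
  have hu1 : ∀ k, u (k + 1) = (1 / p : ℝ) • u k + v k := by
    intro k
    simp only [hu, hv]
    rw [hsplit, Finset.sum_union (hdisj k), Finset.smul_sum]
    congr 1
    · refine Finset.sum_congr rfl fun i hi => ?_
      have := (Finset.mem_filter.1 hi).2
      rw [smul_smul]
      congr 1
      rw [show k + 1 - 1 - (x i).factorization p = (k - 1 - (x i).factorization p) + 1 by omega,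
        pow_succ]
      ring
    · refine Finset.sum_congr rfl fun i hi => ?_
      have := (Finset.mem_filter.1 hi).2
      rw [this]; simp
  have hV1 : ∀ k, V (k + 1) = V k + c k := by
    intro k
    simp only [hV, hc]
    rw [hsplit, Finset.sum_union (hdisj k)]
  have hcc : ∀ k, inner ℝ (c k) (c k) = inner ℝ (v k) (v k) := by
    intro k
    simp only [hc, hv]
    simp only [sum_inner]
    simp only [inner_sum]
    refine Finset.sum_congr rfl fun i hi => Finset.sum_congr rfl fun j hj => ?_
    have h1 := Finset.mem_filter.1 hi
    have h2 := Finset.mem_filter.1 hj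
    simp only [real_inner_smul_left, real_inner_smul_right]
    rw [hφ.inner_eq_of_factorization_le hp (hx i h1.1) (hx j h2.1) (by omega), h1.2, h2.2]
    simp
  have hVc : ∀ k, inner ℝ (V k) (c k) = (1 / p : ℝ) * inner ℝ (u k) (v k) := by
    intro k
    simp only [hV, hc, hu, hv]
    simp only [sum_inner, Finset.mul_sum]
    simp only [inner_sum, Finset.mul_sum]
    refine Finset.sum_congr rfl fun i hi => Finset.sum_congr rfl fun j hj => ?_
    have h1 := Finset.mem_filter.1 hi
    have h2 := Finset.mem_filter.1 hj
    simp only [real_inner_smul_left, real_inner_smul_right]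
    rw [hφ.inner_eq_of_factorization_le hp (hx i h1.1) (hx j h2.1) (by omega), h2.2,
      show k - (x i).factorization p = (k - 1 - (x i).factorization p) + 1 by omega, pow_succ]
    ring
  refine ⟨fun k => ‖u k‖, fun k => ‖V k‖ ^ 2, ?_, ?_, fun k => norm_nonneg _, ?_, ?_, ?_, ?_⟩
  · simp [hu]
  · simp [hV]
  · intro k
    have e1 : ‖V (k + 1)‖ ^ 2 = ‖V k‖ ^ 2 + 2 * inner ℝ (V k) (c k) + ‖c k‖ ^ 2 := by
      rw [hV1, norm_add_sq_real]
    have e2 : ‖u (k + 1)‖ ^ 2 = (‖u k‖ / p) ^ 2 + 2 * ((1 / p : ℝ) * inner ℝ (u k) (v k)) +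
        ‖v k‖ ^ 2 := by
      rw [hu1, norm_add_sq_real, norm_smul, inner_smul_left]
      simp
      ring
    have e3 : ‖c k‖ ^ 2 = ‖v k‖ ^ 2 := by
      rw [← real_inner_self_eq_norm_sq, ← real_inner_self_eq_norm_sq, hcc]
    simp only
    rw [e1, e2, hVc, e3]; ring
  · intro k
    have : v k = u (k + 1) - (1 / p : ℝ) • u k := by rw [hu1]; abel
    change ‖v k‖ ≤ _
    rw [this]
    refine (norm_sub_le _ _).trans (le_of_eq ?_)
    rw [norm_smul]; simp; ring
  · intro k
    change ‖u (k + 1)‖ ≤ ‖v k‖ + _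
    rw [hu1, add_comm]
    refine (norm_add_le _ _).trans (le_of_eq ?_)
    rw [norm_smul]; simp; ring
  · intro k; rfl

/-- A finite family of integers `x i` with signs `w i` in which equal integers have equal signs,
so that nothing cancels. -/
def IsSignedFamily {ι : Type*} (s : Finset ι) (w : ι → ℝ) (x : ι → ℕ) : Prop :=
  (∀ i ∈ s, w i ^ 2 = 1) ∧ ∀ i ∈ s, ∀ j ∈ s, x i = x j → w i = w j

lemma IsSignedFamily.mono {ι : Type*} {s t : Finset ι} {w : ι → ℝ} {x : ι → ℕ}
    (h : IsSignedFamily s w x) (hts : t ⊆ s) : IsSignedFamily t w x :=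
  ⟨fun i hi => h.1 i (hts hi), fun i hi j hj => h.2 i (hts hi) j (hts hj)⟩

lemma IsSignedFamily.ordCompl {ι : Type*} {s : Finset ι} {w : ι → ℝ} {x : ι → ℕ}
    (h : IsSignedFamily s w x) (p k : ℕ) :
    IsSignedFamily (s.filter fun i => (x i).factorization p = k) w
      (fun i => ordCompl[p] (x i)) := by
  refine ⟨fun i hi => h.1 i (Finset.mem_of_mem_filter i hi), fun i hi j hj hij => ?_⟩
  rw [Finset.mem_filter] at hi hj
  refine h.2 i hi.1 j hj.1 ?_
  have hij' : ordCompl[p] (x i) = ordCompl[p] (x j) := hij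
  rw [← Nat.ordProj_mul_ordCompl_eq_self (x i) p, hij', hi.2, ← hj.2,
    Nat.ordProj_mul_ordCompl_eq_self (x j) p]

lemma ordCompl_mem_smoothNumbers {p n : ℕ} (hp : p.Prime)
    (hn : n ∈ Nat.smoothNumbers (p + 1)) : ordCompl[p] n ∈ Nat.smoothNumbers p := by
  have hn0 := Nat.ne_zero_of_mem_smoothNumbers hn
  rw [Nat.mem_smoothNumbers'] at hn ⊢
  intro r hr hrn
  have h1 : r < p + 1 := hn r hr (hrn.trans (Nat.ordCompl_dvd n p))
  have h2 : r ≠ p := by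
    rintro rfl
    exact Nat.not_dvd_ordCompl hp hn0 hrn
  omega

/-- The least value of `α x² + β y²` subject to `x + y = 1`, where `α = 1 - θ` and
`β = θ' P² - 1`. -/
noncomputable def chainCoeff (P θ' θ : ℝ) : ℝ :=
  (1 - θ) * (θ' * P ^ 2 - 1) / ((1 - θ) + (θ' * P ^ 2 - 1))

/-- One step of the autoregression: if a class of norm `r` is added to a state of norm `U` with
squared norm `q` so far, then `q - θ U²` grows by at least a multiple of `r²`, where `θ'` is the
parameter before the step and `θ` the one after it. A prime `p` may be replaced by a smaller `P`. -/
lemma chain_step {P p θ θ' U U' q q' r : ℝ} (hP : 0 < P) (hPp : P ≤ p) (hU : 0 ≤ U)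
    (hr : 0 ≤ r) (hθ : θ < 1) (hθ' : 1 < θ' * P ^ 2)
    (hq : q' = q + U' ^ 2 - (U / p) ^ 2) (hrU : r ≤ U' + U / p) :
    q - θ' * U ^ 2 + chainCoeff P θ' θ * r ^ 2 ≤ q' - θ * U' ^ 2 := by
  have hy : U / p ≤ U / P := div_le_div_of_nonneg_left hU hP hPp
  have hy0 : 0 ≤ U / p := div_nonneg hU (hP.le.trans hPp)
  have e : U ^ 2 = P ^ 2 * (U / P) ^ 2 := by field_simp
  rw [e]
  generalize U / p = z at *
  generalize U / P = y at *
  rw [chainCoeff]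
  set α := 1 - θ with hα
  set β := θ' * P ^ 2 - 1 with hβ
  have hα0 : 0 < α := by linarith
  have hβ0 : 0 < β := by linarith
  have key : α * β / (α + β) * r ^ 2 ≤ α * U' ^ 2 + β * y ^ 2 := by
    have h1 : r ^ 2 ≤ (U' + y) ^ 2 := by gcongr; linarith
    have h2 : α * β / (α + β) * (U' + y) ^ 2 ≤ α * U' ^ 2 + β * y ^ 2 := by
      rw [div_mul_eq_mul_div, div_le_iff₀ (by positivity)]
      nlinarith [sq_nonneg (α * U' - β * y)]
    exact (mul_le_mul_of_nonneg_left h1 (by positivity)).trans h2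
  have hz : z ^ 2 ≤ y ^ 2 := by gcongr
  rw [hq, show θ = 1 - α by ring, show θ' * (P ^ 2 * y ^ 2) = (β + 1) * y ^ 2 by rw [hβ]; ring]
  linarith

/-- Propagation of lower bounds through a prime `p`. Suppose every signed family of integers
with all prime factors below `p` has squared norm at least `g n`, where `n` is its size. If the
table `T` of lower bounds for `q - θ t * U²` is consistent with adding one more class of the
`p`-adic valuation, then its column for `θ 0 = 0` bounds the squared norm of families whose
prime factors are at most `p`. -/
lemma IsGcdGram.le_norm_sq_of_table (hφ : IsGcdGram φ) {ι : Type*} {p : ℕ} (hp : p.Prime)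
    {P : ℝ} (hP : 0 < P) (hPp : P ≤ p) {g θ : ℕ → ℝ} {r : ℕ} {T : ℕ → ℕ → ℝ}
    (hg : ∀ (s : Finset ι) (w : ι → ℝ) (x : ι → ℕ), IsSignedFamily s w x →
      (∀ i ∈ s, x i ∈ Nat.smoothNumbers p) → s.Nonempty → g s.card ≤ ‖∑ i ∈ s, w i • φ (x i)‖ ^ 2)
    (hr : 0 < r) (hθ0 : θ 0 = 0) (hθ : ∀ t < r, 0 ≤ θ t ∧ θ t < 1)
    (hT1 : ∀ n, 0 < n → ∀ t < r, T t n ≤ (1 - θ t) * g n)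
    (hT2 : ∀ a m, 0 < a → 0 < m → ∀ t < r, ∃ t' < r, 1 < θ t' * P ^ 2 ∧
      T t (a + m) ≤ T t' a + chainCoeff P (θ t') (θ t) * g m)
    (s : Finset ι) (w : ι → ℝ) (x : ι → ℕ) (hs : IsSignedFamily s w x)
    (hx : ∀ i ∈ s, x i ∈ Nat.smoothNumbers (p + 1)) (hne : s.Nonempty) :
    T 0 s.card ≤ ‖∑ i ∈ s, w i • φ (x i)‖ ^ 2 := by
  classical
  have hx0 : ∀ i ∈ s, x i ≠ 0 := fun i hi => Nat.ne_zero_of_mem_smoothNumbers (hx i hi)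
  obtain ⟨U, q, hU0, hq0, hUn, hq, hv1, hv2, hqV⟩ := hφ.exists_chain hp s w x hx0
  set N : ℕ → ℕ := fun k => (s.filter fun i => (x i).factorization p < k).card with hN
  set M : ℕ → ℕ := fun k => (s.filter fun i => (x i).factorization p = k).card with hM
  have hNM : ∀ k, N (k + 1) = N k + M k := by
    intro k
    simp only [hN, hM]
    rw [← Finset.card_union_of_disjoint (by rw [Finset.disjoint_filter]; intro i _ h; omega)]
    congr 1
    ext i; simp only [Finset.mem_filter, Finset.mem_union]; grind
  have inv : ∀ k, (N k = 0 → U k = 0 ∧ q k = 0) ∧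
      (0 < N k → ∀ t < r, T t (N k) ≤ q k - θ t * U k ^ 2) := by
    intro k
    induction k with
    | zero => simp [hU0, hq0, hN]
    | succ k ih =>
      rcases Nat.eq_zero_or_pos (M k) with h0 | h0
      · -- an empty class changes neither `q` nor the size
        have hemp : (s.filter fun i => (x i).factorization p = k) = ∅ := Finset.card_eq_zero.1 h0
        have hUle := hv2 k
        rw [hemp] at hUle
        simp only [Finset.sum_empty, norm_zero, zero_add] at hUle
        have hqeq : q (k + 1) = q k := by
          rw [hqV, hqV]
          congr 3
          ext i
          simp only [Finset.mem_filter]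
          have : i ∈ s → (x i).factorization p ≠ k := fun hi h => by
            have : i ∈ (s.filter fun i => (x i).factorization p = k) :=
              Finset.mem_filter.2 ⟨hi, h⟩
            rw [hemp] at this; simp at this
          grind
        have hUk : U (k + 1) ≤ U k := hUle.trans (div_le_self (hUn k)
          (by exact_mod_cast hp.one_lt.le))
        rw [hNM, h0, add_zero, hqeq]
        refine ⟨fun h => ⟨le_antisymm (hUk.trans (ih.1 h).1.le) (hUn _), (ih.1 h).2⟩, ?_⟩
        intro h t ht
        have := ih.2 h t ht
        have h2 : U (k + 1) ^ 2 ≤ U k ^ 2 := by gcongr; exact hUn _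
        nlinarith [(hθ t ht).1]
      · have hgM := hg _ w _ (hs.ordCompl p k) (fun i hi =>
          ordCompl_mem_smoothNumbers hp (hx i (Finset.mem_of_mem_filter i hi)))
          (Finset.card_pos.1 h0)
        change g (M k) ≤ _ at hgM
        rw [hNM]
        refine ⟨fun h => by omega, fun _ t ht => ?_⟩
        rcases Nat.eq_zero_or_pos (N k) with h1 | h1
        · obtain ⟨hUk, hqk⟩ := ih.1 h1
          have h3 := hv1 k
          have h4 := hq k
          rw [hUk] at h3 h4
          rw [hqk] at h4
          simp only [zero_div, add_zero] at h3 h4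
          have h5 := (hgM.trans (pow_le_pow_left₀ (norm_nonneg _) h3 2))
          rw [h1, zero_add, h4]
          refine (hT1 _ h0 t ht).trans ?_
          nlinarith [(hθ t ht).2]
        · obtain ⟨t', ht', hP', hT⟩ := hT2 _ _ h1 h0 t ht
          refine hT.trans ?_
          refine le_trans ?_ (chain_step hP hPp (hUn k) (norm_nonneg _) (hθ t ht).2 hP' (hq k)
            (hv1 k))
          have hc : 0 ≤ chainCoeff P (θ t') (θ t) := by
            have := (hθ t ht).2
            unfold chainCoeff
            apply div_nonneg <;> nlinarith
          exact add_le_add (ih.2 h1 t' ht') (mul_le_mul_of_nonneg_left hgM hc)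
  have hfin : ∃ k, ∀ i ∈ s, (x i).factorization p < k :=
    ⟨s.sup (fun i => (x i).factorization p) + 1, fun i hi =>
      Nat.lt_succ_of_le (Finset.le_sup (f := fun i => (x i).factorization p) hi)⟩
  obtain ⟨k, hk⟩ := hfin
  have hfil : (s.filter fun i => (x i).factorization p < k) = s := Finset.filter_true_of_mem hk
  have hNk : N k = s.card := by simp only [hN]; rw [hfil]
  have h := (inv k).2 (by rw [hNk]; exact hne.card_pos) 0 hr
  rw [hNk, hθ0, hqV, hfil] at h
  simpa using h

end Chain

/-! ### Tables of lower bounds for at most 82 integers -/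

/-- The `n`-th block of six decimal digits of a numeral, from the right. Numerals serve as
compressed columns of tables of lower bounds, in units of `10⁻⁴`. -/
def tableEntry (col n : ℕ) : ℕ := col / 10 ^ (6 * n) % 10 ^ 6

/-- Lower bounds for `q - θ U²` (see `IsGcdGram.exists_chain`) at the prime `2`, in terms of
the number of integers. There is one column for each of the values 0, 50, 67 of `100 θ`; the
column for `θ = 0` bounds the squared norm itself. -/
def twoTable : List ℕ := [
  276640273307269974266641263308259975257058253725250392247059243726240393237060233727230394227061223728220395217062213729210396207063203730200397197064193731190398187065183732180399177066173733170400167067163734160401157068153735150402147069143736140403137070133737130404127071123738120405117072113739110406107073103740100407097074093741090408087075083742080409077076073743070410067077063744060411057078053745050412047079043746040413037080033747030414027081023748020415017082013749010000010000000000,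
  274973271640268307264974261641258308254975251642248309244976241643238310234977231644228311224978221645218312214979211646208313204980201647198314194981191648188315184982181649178316174983171650168317164984161651158318154985151652148319144986141653138320134987131654128321124988121655118322114989111656108323104990101657098324094991091658088325084992081659078326074993071660068327064994061661058328054995051662048329044996041663038330034997031664028331024998021665018332014999011666008333005000000000,
  251538251538251538251538251538251538251538250790247457244124240791237458234125230792227459224126220793217460214127210794207461204128200795197462194129190796187463184130180797177464174131170798167465164132160799157466154133150800147467144134140801137468134135130802127469124136120803117470114137110804107471104138100805097472094139090806087473084140080807077474074141070808067475064142060809057476054143050810047477044144040811037478034145030812027479024146020813017480014147010814007481003300000000]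

/-- Lower bounds for `q - θ U²` (see `IsGcdGram.exists_chain`) at the prime `3`, in terms of
the number of integers. There is one column for each of the values 0, 24, 31, 34, 37, 48 of `100 θ`; the
column for `θ = 0` bounds the squared norm itself. -/
def threeTable : List ℕ := [
  153569151846150123148401146678144951143215141493139770138047136324134599132876131140129417127695125972124249122511120786119063117328115563113840112117110395108672106902105137103363101598099823098057096284094510092746090971089206087432085661083893082118080353078579076814075040073262071487069722067948066170064429062626060791058940057105055255053420051569049734047884046073044199042391040613038782036977035199033389031395029378027317025357023582021870020205018201015901013332013332010000010000000000,
  151644149922148199146476144753143031141308139581137845136123134400132677130954129229127506125770124047122325120602118879117141115416113693111958110193108470106747105025103302101532099767097993096228094453092687090914089140087376085601083836082062080291078523076748074983073209071444069670067892066117064352062578060800059059057256055421053570051735049885048050046199044364042514040703038829037021035243033412031607029829028019026070024008021947019909017999016089014234012234010449007600007600000000,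
  149188147446145717143994142271140548138826137103135380133641131919130196128473126750125028123305121578119842118120116397114674112951111226109503107767106044104322102599100876099138097413095690093968092245090522088800087077085307083542081768080003078228076462074689072915071151069376067611065837064066062298060523058758056984055219053445051670049905048131046390044667042895041121039386037680035823033998032094030190028286026382024478022574020716018942017167015429013747011786009486006900006900000000,
  146939145237143571141858140185138471136757135046133359131665129991128277126605124902123188121474119778118094116357114643112929111164109450107735105988104256102542100820099063097349095634093869092155090441088677086963085248083483081769080055078341076576074862073147071419069668067954066240064497062761061046059332057575055853054139052425050710048996047309045595043881042129040294038459036624034789032954031119029284027449025614023779021944020228018513016804015138013473011274009074006600006600000000,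
  143934142198140545138892137141135475133822132112130404128751127085125333123680122027120291118609116957115263113539111886110233108469106815105162103442101744100091098413096674095021093368091620089951088298086591084880083227081574079829078157076504074851073117071433069780068127066405064709063056061404059694057986056333054680052993051307049542047778046013044248042483040718038953037188035423033658031894030129028364026599024834023069021382019729018076016449014860012861010761008661006300006300000000,
  126575125077123578122080120768119270117772116273114775113276111778110279108781107282105784104285102787101288099790098292096793095295093796092298090799089301087802086304084805083307081809080310078812077313075815074316072818071319069821068322066824065325063827062329060830059332057833056335054836053338051839050341048842047344045845044347042849041350039852038353036855035356033858032359030861029362027864026365024897023480022063020646019229017548015815014082012348010615008882007149005200005200000000]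

/-- Lower bounds for `q - θ U²` (see `IsGcdGram.exists_chain`) at the prime `5`, in terms of
the number of integers. There is one column for each of the values 0, 12, 16, 20, 25, 34 of `100 θ`; the
column for `θ = 0` bounds the squared norm itself. -/
def fiveTable : List ℕ := [
  126032124752123479122199120926119637118357117038115759114428113138111806110455109115107723106365104994103606102259100861099487098126096737095340093940092575091268089938088551087174085840084500083157081816080483079138077775076463075104073721072326070943069549068166066771065384063987062619061203059760058302056856055399053973052497051073049673048231046809045355043706042138040570039150037730036361034720032945031298029807028369026971025287023385021330020205018201015901013332013332010000010000000000,
  122264120988119706118430117144115864114591113311112038110749109469108150106871105540104250102949101634100298098961097631096294094961093626092292090935089580088185086793085435084064082674081276079916078526077129075729074364073034071647070250068887067575066216064833063438062055060661059278057883056500055105053740052317050872049414047968046511045085043609042185040785039343037921036527035163033660032140030587029109027627025852024038022314020752019245017780016016013992011732011732008800008800000000,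
  119258118011116743115433114142112891111590110288109027107779106494105157103865102581101302099977098684097405096094094768093434092100090761089421088088086748085414084074082736081401080060078727077389076093074759073419072076070783069497068157066823065483064140062799061466060126058783057468056106054720053322051935050538049152047754046367044970043602042186040820039477038094036775035487034114032576031060029567028046026371024677022946021299019808018370016972015288013356011198011198008400008400000000,
  114831113582112327111083109837108592107346106099104853103599102353101108099863098617097361096114094868093614092338091092089847088602087357086077084801083519082243080960079683078401077119075844074561073285072002070722069444068161066885065603064327063044061759060476059200057918056632055374054070052744051406050079048742047415046077044751043413042104040750039443038193036858035359033912032490031025029581028159026711025116023502021853020285018865017496016164014560012720010665010665008000008000000000,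
  108806107629106445105271104096102921101747100571099396098212097037095863094689093514092329091153089978088795087591086417085242084068082893081686080483079273078070076860075656074447073237072034070824069621068411067204065998064788063585062375061172059962058750057540056336055127053914052727051498050247048985047734046472045221043959042708041441040065038676037300035913034554033149031793030459029086027732026399025041023546022033020487019017017686016402015153013650011925009999009999007500007500000000,
  97667096622095577094529093476092432091386090341089296088250087204086151085106084062083016081971080917079870078825077773076702075657074612073567072522071448070377069301068231067154066083065007063931062861061784060713059637058563057490056414055343054197053032051862050697049526048352047181046016044845043672042523041333040122038900037689036468035257034035032824031603030408029171027978026804025596024404023231022036020720019389018029016735015564014434013335012012010494008799008799006600006600000000]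

/-- Lower bounds for `q - θ U²` (see `IsGcdGram.exists_chain`) at the prime `7`, in terms of
the number of integers. There is one column for each of the values 0, 5, 7, 12, 21, 40 of `100 θ`; the
column for `θ = 0` bounds the squared norm itself. -/
def sevenTable : List ℕ := [
  120516119284118051116824115585114330113113111849110607109377108122106910105703104527103323102060100795099561098380097178095924094680093474092286091097089909088728087537086330085168083964082739081504080279079044077819076584075322073999072687071363070047068721067423066079064710063326061954060571059259057927056641055377053973052497051073049673048231046809045355043706042138040570039150037730036361034720032945031298029807028369026971025287023385021330020205018201015901013332013332010000010000000000,
  117296116131114974113782112626111394110161108934107695106440105223103959102717101487100232099020097813096637095433094170092905091671090490089288088034086790085584084373083159081947080742079526078294077109075880074630073369072119070859069609068349067095065832064596063316062037060780059488058142056772055386054013052629051274049872048519047189045819044468043087041520040031038541037192035843034542032984031297029733028316026950025622024022022215020263019194017290015105012665012665009500009500000000,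
  115104113963112829111661110528109349108206107007105792104563103370102132100953099764098571097333096116094910093680092443091203089994088836087658086429085210084028082841081652080464079283078092076885075723074519073294072059070834069599068374067139065910064673063394062097060807059507058235056918055576054220052876051521050194048822047497046195044854043532042180040646039188037730036409035088033815032289030638029107027720026383025083023516021748019836018790016926014787012398012398009300009300000000,
  109606108523107448106339105265104146103062101943100808099682098512097371096219095053093921092747091592090449089281088108086931085784084686083569082403081246080125078999077871076713075539074360073178071998070825069641068442067287066091064874063646062429061203059986058758057537056308055104053858052588051305050033048751047496046197044944043712042443041191039912038461037081035701034452033202031997030553028991027542026230024964023734022252020578018770017780016016013992011732011732008800008800000000,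
  99565098554097548096537095531094513093502092460091449090398089379088326087259086200085101084028082945081848080784079680078594077519076422075318074212073134072101071051069955068867067813066755065694064634063581062519061442060405059332058239057137056044054943053851052749051653050549049469048350047210046058044916043765042638041472040347039241038102036979035830034527033289032050030928029806028725027428026026024725023547022411021307019976018474016850015961014378012561010532010532007900007900000000,
  75619074851074087073319072555071782071014070222069455068656067882067083066273065469064633063819062996062163061355060516059692058875058042057204056364055545054760053962053130052304051504050700049894049089048289047482046665045877045062044232043395042565041729040899040062039230038392037571036721035856034981034113033239032383031498030643029803028938028085027213026223025282024342023490022638021816020832019767018778017884017021016182015172014031012798012123010920009540007999007999006000006000000000]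

/-- Lower bounds for `q - θ U²` (see `IsGcdGram.exists_chain`) at the prime `11` or a larger prime, in terms of
the number of integers. There is one column for each of the values 0, 4, 22 of `100 θ`; the
column for `θ = 0` bounds the squared norm itself. It is the one of `sevenTable`, so large primes do not
weaken the bound. -/
def elevenTable : List ℕ := [
  120516119284118051116824115585114330113113111849110607109377108122106910105703104527103323102060100795099561098380097178095924094680093474092286091097089909088728087537086330085168083964082739081504080279079044077819076584075322073999072687071363070047068721067423066079064710063326061954060571059259057927056641055377053973052497051073049673048231046809045355043706042138040570039150037730036361034720032945031298029807028369026971025287023385021330020205018201015901013332013332010000010000000000,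
  115695114512113328112151110961109756108588107375106182105001103797102633101474100345099190097977096763095578094444093290092087090892089735088594087453086312085178084035082876081761080605079429078243077067075882074706073520072309071039069779068508067245065972064726063435062121060792059475058148056888055609054375053161051814050397049030047686046301044936043540041957040452038947037584036220034906033331031627030046028614027234025892024275022449020476019396017472015264012798012798009600009600000000,
  94002093041092079091122090156089177088228087242086273085314084335083389082448081531080591079606078620077657076736075798074820073850072909071983071055070129069207068278067337066431065491064536063573062617061654060698059735058751057719056695055663054636053602052589051541050473049394048324047245046222045183044179043194042098040947039836038744037620036511035376034090032867031644030537029429028361027081025697024412023249022127021037019723018240016637015759014196012402010398010398007800007800000000]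

/-- Consistency of a table of lower bounds for the prime `P`, with `100 θ` listed in `θ`, built on
nondecreasing lower bounds `g` for the classes: the table is a solution of the inequalities required
by `IsGcdGram.le_norm_sq_of_table`, cleared of denominators. The first class has size `n + 1`; later
a class of size `m + 1` is added to `a + 1` integers. Sizes above `82` are treated as `82`. -/
def isChainTable (P : ℕ) (θ T : List ℕ) (g : ℕ → ℕ) : Bool :=
  ((List.range 81).all fun n => Nat.ble (g (n + 1)) (g (n + 2))) &&
  ((List.range 82).all fun n => (θ.zip T).all fun u =>
    Nat.ble (tableEntry u.2 (n + 1) * 100) ((100 - u.1) * g (n + 1))) &&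
  (List.range 82).all fun a => (List.range (max 1 (81 - a))).all fun m => (θ.zip T).all fun u =>
    (θ.zip T).any fun v => Nat.blt 100 (v.1 * P ^ 2) &&
      Nat.ble (tableEntry u.2 (min (a + m + 2) 82) * (100 * (v.1 * P ^ 2 - u.1)))
        (tableEntry v.2 (a + 1) * (100 * (v.1 * P ^ 2 - u.1)) +
          (100 - u.1) * (v.1 * P ^ 2 - 100) * g (m + 1))

lemma isChainTable_two : isChainTable 2 [0, 50, 67] twoTable
    (fun n => 10000 * min (n ^ 2) 90) = true := by
  decide +kernel

lemma isChainTable_three : isChainTable 3 [0, 24, 31, 34, 37, 48] threeTable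
    (tableEntry (twoTable.getD 0 0)) = true := by
  decide +kernel

lemma isChainTable_five : isChainTable 5 [0, 12, 16, 20, 25, 34] fiveTable
    (tableEntry (threeTable.getD 0 0)) = true := by
  decide +kernel

lemma isChainTable_seven : isChainTable 7 [0, 5, 7, 12, 21, 40] sevenTable
    (tableEntry (fiveTable.getD 0 0)) = true := by
  decide +kernel

lemma isChainTable_eleven : isChainTable 11 [0, 4, 22] elevenTable
    (tableEntry (sevenTable.getD 0 0)) = true := by
  decide +kernel

section Tables

variable {E : Type*} [NormedAddCommGroup E] [InnerProductSpace ℝ E] {φ : ℕ → E}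

/-- `g`, in units of `10⁻⁴`, bounds from below the squared norms of the nonempty signed families of
integers whose prime factors are less than `z`, in terms of the size (cut off at `82`). -/
def BoundsSmooth (φ : ℕ → E) (ι : Type*) (z : ℕ) (g : ℕ → ℕ) : Prop :=
  ∀ (s : Finset ι) (w : ι → ℝ) (x : ι → ℕ), IsSignedFamily s w x →
    (∀ i ∈ s, x i ∈ Nat.smoothNumbers z) → s.Nonempty →
      (g (min s.card 82) : ℝ) / 10000 ≤ ‖∑ i ∈ s, w i • φ (x i)‖ ^ 2

lemma IsGcdGram.norm_one (hφ : IsGcdGram φ) : ‖φ 1‖ ^ 2 = 1 := by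
  rw [← real_inner_self_eq_norm_sq, hφ 1 1 one_ne_zero one_ne_zero]; simp

lemma IsGcdGram.norm_sq_sum_of_forall_eq_one (hφ : IsGcdGram φ) {ι : Type*} {s : Finset ι}
    {w : ι → ℝ} {x : ι → ℕ} (hs : IsSignedFamily s w x) (hx1 : ∀ i ∈ s, x i = 1) :
    ‖∑ i ∈ s, w i • φ (x i)‖ ^ 2 = (s.card : ℝ) ^ 2 := by
  rcases s.eq_empty_or_nonempty with rfl | ⟨i₀, hi₀⟩
  · simp
  have hsum : ∑ i ∈ s, w i • φ (x i) = ((s.card : ℝ) * w i₀) • φ 1 := by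
    rw [Finset.sum_congr rfl (g := fun _ => w i₀ • φ 1)]
    · rw [Finset.sum_const, mul_smul, Nat.cast_smul_eq_nsmul]
    · intro i hi
      rw [hs.2 i hi i₀ hi₀ (by rw [hx1 i hi, hx1 i₀ hi₀]), hx1 i hi]
  rw [hsum, norm_smul, mul_pow, hφ.norm_one, mul_one, Real.norm_eq_abs, sq_abs, mul_pow,
    hs.1 i₀ hi₀, mul_one]

/-- Without prime factors all integers are equal to `1`. The bound `n ^ 2` is truncated, far above
the values that matter, so that all entries have at most six digits. -/
lemma IsGcdGram.boundsSmooth_two (hφ : IsGcdGram φ) (ι : Type*) :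
    BoundsSmooth φ ι 2 (fun n => 10000 * min (n ^ 2) 90) := by
  intro s w x hs hx _
  have hx1 : ∀ i ∈ s, x i = 1 := by
    intro i hi
    have := hx i hi
    rw [show (2 : ℕ) = 1 + 1 from rfl, Nat.smoothNumbers_succ (by norm_num),
      Nat.smoothNumbers_one] at this
    exact this
  rw [hφ.norm_sq_sum_of_forall_eq_one hs hx1]
  have h : min ((min s.card 82) ^ 2) 90 ≤ s.card ^ 2 :=
    (min_le_left _ _).trans (Nat.pow_le_pow_left (min_le_left _ _) 2)
  have h' : ((min ((min s.card 82) ^ 2) 90 : ℕ) : ℝ) ≤ (s.card : ℝ) ^ 2 := by exact_mod_cast h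
  rw [Nat.cast_mul]
  push_cast at h' ⊢
  linarith

lemma isChainTable_iff {P : ℕ} {θ T : List ℕ} {g : ℕ → ℕ} : isChainTable P θ T g = true ↔
    (∀ n < 81, g (n + 1) ≤ g (n + 2)) ∧
    (∀ n < 82, ∀ u ∈ θ.zip T, tableEntry u.2 (n + 1) * 100 ≤ (100 - u.1) * g (n + 1)) ∧
    ∀ a < 82, ∀ m < max 1 (81 - a), ∀ u ∈ θ.zip T, ∃ v ∈ θ.zip T, 100 < v.1 * P ^ 2 ∧
      tableEntry u.2 (min (a + m + 2) 82) * (100 * (v.1 * P ^ 2 - u.1)) ≤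
        tableEntry v.2 (a + 1) * (100 * (v.1 * P ^ 2 - u.1)) +
          (100 - u.1) * (v.1 * P ^ 2 - 100) * g (m + 1) := by
  simp only [isChainTable, Bool.and_eq_true, List.all_eq_true, List.any_eq_true, List.mem_range,
    Nat.ble_eq, Nat.blt_eq, and_assoc]

/-- Passage from the integers without prime factors `≥ p` to those without prime factors `> p`, by
a table for some `P ≤ p`. -/
lemma IsGcdGram.boundsSmooth_succ_of_isChainTable (hφ : IsGcdGram φ) {ι : Type*} {p P : ℕ}
    (hp : p.Prime) (hP : 0 < P) (hPp : P ≤ p) {g : ℕ → ℕ} {θ T : List ℕ}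
    (hT : isChainTable P θ T g = true) (hg : BoundsSmooth φ ι p g) (hlen : θ.length = T.length)
    (hne : 0 < θ.length) (hθ0 : θ.getD 0 0 = 0) (hθ : ∀ u ∈ θ, u < 100) :
    BoundsSmooth φ ι (p + 1) (tableEntry (T.getD 0 0)) := by
  obtain ⟨hmono, h1, h2⟩ := isChainTable_iff.1 hT
  have hgm : ∀ a b, 0 < a → a ≤ b → b ≤ 82 → g a ≤ g b := by
    intro a b ha hab
    induction b, hab using Nat.le_induction with
    | base => intro _; exact le_rfl
    | succ b hab ih =>
      intro hb
      have := hmono (b - 1) (by omega)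
      rw [show b - 1 + 1 = b by omega, show b - 1 + 2 = b + 1 by omega] at this
      exact (ih (by omega)).trans this
  have hzip : ∀ t < θ.length, (θ.getD t 0, T.getD t 0) ∈ θ.zip T := by
    intro t ht
    have ht' : t < T.length := hlen ▸ ht
    rw [List.mem_iff_getElem]
    refine ⟨t, by simp [ht, ht'], ?_⟩
    simp [ht, ht']
  have hzip' : ∀ v ∈ θ.zip T, ∃ t < θ.length, v = (θ.getD t 0, T.getD t 0) := by
    intro v hv
    obtain ⟨t, ht, rfl⟩ := List.mem_iff_getElem.1 hv
    simp only [List.length_zip, lt_min_iff] at ht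
    refine ⟨t, ht.1, ?_⟩
    simp [ht.1, ht.2]
  have hθlt : ∀ t < θ.length, θ.getD t 0 < 100 := by
    intro t ht
    rw [List.getD_eq_getElem _ _ ht]
    exact hθ _ (List.getElem_mem ht)
  intro s w x hs hx hsne
  refine hφ.le_norm_sq_of_table hp (P := P) (by exact_mod_cast hP) (by exact_mod_cast hPp)
    (g := fun n => (g (min n 82) : ℝ) / 10000) (θ := fun t => (θ.getD t 0 : ℝ) / 100)
    (r := θ.length) (T := fun t n => (tableEntry (T.getD t 0) (min n 82) : ℝ) / 10000)
    (fun s w x hs hx hne => hg s w x hs hx hne) hne (by rw [hθ0]; simp) ?_ ?_ ?_ s w x hs hx hsne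
  · intro t ht
    have := hθlt t ht
    have h' : (θ.getD t 0 : ℝ) < 100 := by exact_mod_cast this
    constructor
    · positivity
    · linarith
  · intro n hn t ht
    have h := h1 (min n 82 - 1) (by omega) _ (hzip t ht)
    rw [show min n 82 - 1 + 1 = min n 82 by omega] at h
    have hlt := (hθlt t ht).le
    simp only at h
    have h' : (tableEntry (T.getD t 0) (min n 82) : ℝ) * 100 ≤
        (100 - (θ.getD t 0 : ℝ)) * g (min n 82) := by
      rw [show (100 : ℝ) - (θ.getD t 0 : ℝ) = ((100 - θ.getD t 0 : ℕ) : ℝ) by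
        rw [Nat.cast_sub hlt]; norm_num]
      exact_mod_cast h
    linarith
  · intro a m ha hm t ht
    -- reduction to the sizes covered by the check: shrink the new class until the cut-off is met
    obtain ⟨a', ha'⟩ : ∃ a', min a 82 = a' + 1 := ⟨min a 82 - 1, by omega⟩
    obtain ⟨m', hm', hm'm, hsum⟩ : ∃ m', m' < max 1 (81 - a') ∧ m' + 1 ≤ min m 82 ∧
        min (a' + m' + 2) 82 = min (a + m) 82 := by
      refine ⟨min (min m 82) (max 1 (81 - a')) - 1, ?_, ?_, ?_⟩ <;> omega
    obtain ⟨v, hv, hv1, hv2⟩ := h2 a' (by omega) m' hm' _ (hzip t ht)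
    obtain ⟨t', ht', rfl⟩ := hzip' v hv
    refine ⟨t', ht', ?_, ?_⟩
    · have : (100 : ℝ) < θ.getD t' 0 * P ^ 2 := by exact_mod_cast hv1
      linarith
    · simp only at hv1 hv2 ⊢
      rw [hsum, ← ha'] at hv2
      have hgm' : (g (m' + 1) : ℝ) ≤ g (min m 82) := by
        exact_mod_cast hgm _ _ (by omega) hm'm (min_le_right _ _)
      have hlt := (hθlt t ht).le
      have hlt2 : θ.getD t 0 ≤ θ.getD t' 0 * P ^ 2 := hlt.trans hv1.le
      generalize tableEntry (T.getD t 0) (min (a + m) 82) = X at *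
      generalize tableEntry (T.getD t' 0) (min a 82) = Y at *
      have c1 : ((θ.getD t' 0 * P ^ 2 - θ.getD t 0 : ℕ) : ℝ) =
          (θ.getD t' 0 : ℝ) * P ^ 2 - θ.getD t 0 := by rw [Nat.cast_sub hlt2]; push_cast; ring
      have c2 : ((100 - θ.getD t 0 : ℕ) : ℝ) = 100 - (θ.getD t 0 : ℝ) := by
        rw [Nat.cast_sub hlt]; norm_num
      have c3 : ((θ.getD t' 0 * P ^ 2 - 100 : ℕ) : ℝ) = (θ.getD t' 0 : ℝ) * P ^ 2 - 100 := by
        rw [Nat.cast_sub hv1.le]; push_cast; ring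
      have hv3 : (X : ℝ) * (100 * ((θ.getD t' 0 : ℝ) * P ^ 2 - θ.getD t 0)) ≤
          Y * (100 * ((θ.getD t' 0 : ℝ) * P ^ 2 - θ.getD t 0)) +
          (100 - (θ.getD t 0 : ℝ)) * ((θ.getD t' 0 : ℝ) * P ^ 2 - 100) * g (m' + 1) := by
        rw [← c1, ← c2, ← c3]; exact_mod_cast hv2
      have d1 : (θ.getD t 0 : ℝ) < 100 := by exact_mod_cast hθlt t ht
      have d2 : (100 : ℝ) < (θ.getD t' 0 : ℝ) * P ^ 2 := by exact_mod_cast hv1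
      generalize (θ.getD t 0 : ℝ) = u at *
      generalize (g (min m 82) : ℝ) = G at *
      generalize (g (m' + 1) : ℝ) = G' at *
      rw [chainCoeff]
      generalize (θ.getD t' 0 : ℝ) = v' at *
      rw [show v' / 100 * (P : ℝ) ^ 2 = v' * P ^ 2 / 100 by ring]
      generalize v' * (P : ℝ) ^ 2 = z at *
      have hz : 0 < z - u := by linarith
      have e : (1 - u / 100) * (z / 100 - 1) / (1 - u / 100 + (z / 100 - 1)) =
          (100 - u) * (z - 100) / (100 * (z - u)) := by
        have : 1 - u / 100 + (z / 100 - 1) = (z - u) / 100 := by ring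
        rw [this]; field_simp
      rw [e]
      have hGG : (100 - u) * (z - 100) * G' ≤ (100 - u) * (z - 100) * G :=
        mul_le_mul_of_nonneg_left hgm' (mul_nonneg (by linarith) (by linarith))
      have h100 : (0 : ℝ) < 100 * (z - u) := by linarith
      have : (X : ℝ) ≤ Y + (100 - u) * (z - 100) / (100 * (z - u)) * G := by
        rw [div_mul_eq_mul_div, ← sub_le_iff_le_add', le_div_iff₀ h100]
        linarith
      linarith

lemma BoundsSmooth.succ_of_not_prime {ι : Type*} {z : ℕ} (hz : ¬ z.Prime) {g : ℕ → ℕ}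
    (h : BoundsSmooth φ ι z g) : BoundsSmooth φ ι (z + 1) g := by
  rw [BoundsSmooth, Nat.smoothNumbers_succ hz]; exact h

/-- The lower bound for the squared norm of a signed family of `n` integers, in units of `10⁻⁴`,
that the tables yield. -/
def normBound : ℕ → ℕ := tableEntry (sevenTable.getD 0 0)

lemma IsGcdGram.boundsSmooth (hφ : IsGcdGram φ) (ι : Type*) (z : ℕ) :
    BoundsSmooth φ ι (z + 8) normBound := by
  have h3 := hφ.boundsSmooth_succ_of_isChainTable Nat.prime_two two_pos le_rfl
    isChainTable_two (hφ.boundsSmooth_two ι) rfl (by simp) rfl (by simp)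
  have h4 := hφ.boundsSmooth_succ_of_isChainTable Nat.prime_three three_pos le_rfl
    isChainTable_three h3 rfl (by simp) rfl (by simp)
  have h6 := hφ.boundsSmooth_succ_of_isChainTable Nat.prime_five (by norm_num) le_rfl
    isChainTable_five (h4.succ_of_not_prime (by norm_num)) rfl (by simp) rfl (by simp)
  have h8 := hφ.boundsSmooth_succ_of_isChainTable (by norm_num : Nat.Prime 7) (by norm_num) le_rfl
    isChainTable_seven (h6.succ_of_not_prime (by norm_num)) rfl (by simp) rfl (by simp)
  induction z with
  | zero => exact h8
  | succ z ih =>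
    rw [show z + 1 + 8 = z + 8 + 1 by ring]
    by_cases hz : (z + 8).Prime
    · have h11 : 11 ≤ z + 8 := by
        by_contra hlt
        have : z < 3 := by omega
        interval_cases z <;> norm_num at hz
      exact hφ.boundsSmooth_succ_of_isChainTable (T := elevenTable) hz (by norm_num) h11
        isChainTable_eleven ih rfl (by simp) rfl (by simp)
    · exact ih.succ_of_not_prime hz

/-- Every nonempty signed family of `n` positive integers has squared norm at least
`normBound (min n 82) / 10⁴`. -/
theorem IsGcdGram.normBound_le (hφ : IsGcdGram φ) {ι : Type*} {s : Finset ι} {w : ι → ℝ}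
    {x : ι → ℕ} (hs : IsSignedFamily s w x) (hx : ∀ i ∈ s, x i ≠ 0) (hne : s.Nonempty) :
    (normBound (min s.card 82) : ℝ) / 10000 ≤ ‖∑ i ∈ s, w i • φ (x i)‖ ^ 2 := by
  refine hφ.boundsSmooth ι (s.sup x) s w x hs (fun i hi => ?_) hne
  exact Nat.mem_smoothNumbers_of_lt (Nat.pos_of_ne_zero (hx i hi))
    (by have := Finset.le_sup (f := x) hi; omega)

lemma normBound_cutoff : 120000 < normBound 82 := by decide +kernel

lemma normBound_pos_size : ∀ n < 82, 10000 ≤ normBound (n + 1) := by decide +kernel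

lemma normBound_three_le : ∀ n < 80, 13000 ≤ normBound (n + 3) := by decide +kernel

set_option maxRecDepth 20000 in
/-- The bounds of two complementary parts of a family of at least `76` integers exceed `12` together,
with room for the interaction of the parts. -/
lemma normBound_add_normBound : ∀ a < 82, ∀ b < 82, 76 ≤ (a + 1) + (b + 1) →
    120100 < normBound (a + 1) + normBound (b + 1) := by decide +kernel

end Tables

/-! ### Sawtooth functions -/

section Sawtooth

open MeasureTheory

/-- The sawtooth function `1/2 - {t}`. -/
noncomputable def sawtooth (t : ℝ) : ℝ := 1 / 2 - Int.fract t

lemma abs_sawtooth_le (t : ℝ) : |sawtooth t| ≤ 1 / 2 := by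
  rw [sawtooth, abs_le]
  constructor <;> linarith [Int.fract_nonneg t, (Int.fract_lt_one t).le]

lemma measurable_sawtooth : Measurable sawtooth :=
  measurable_const.sub measurable_fract

lemma sawtooth_add_nat (t : ℝ) (n : ℕ) : sawtooth (t + n) = sawtooth t := by
  simp [sawtooth]

lemma Int.sum_range_add_div {b : ℕ} (hb : 0 < b) (N : ℤ) :
    ∑ j ∈ Finset.range b, (N + j) / (b : ℤ) = N := by
  have hb' : (b : ℤ) ≠ 0 := by exact_mod_cast hb.ne'
  have hstep : ∀ N : ℤ, ∑ j ∈ Finset.range b, (N + 1 + j) / (b : ℤ) =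
      ∑ j ∈ Finset.range b, (N + j) / (b : ℤ) + 1 := by
    intro N
    have h1 := Finset.sum_range_succ (fun j : ℕ => (N + j) / (b : ℤ)) b
    have h2 := Finset.sum_range_succ' (fun j : ℕ => (N + j) / (b : ℤ)) b
    rw [Int.add_ediv_of_dvd_right dvd_rfl, Int.ediv_self hb'] at h1
    have h3 : ∑ j ∈ Finset.range b, (N + 1 + j) / (b : ℤ) =
        ∑ j ∈ Finset.range b, (N + (j + 1 : ℕ)) / (b : ℤ) :=
      Finset.sum_congr rfl fun j _ => by push_cast; ring_nf
    rw [h3]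
    simp only [Nat.cast_zero, add_zero] at h2
    linarith
  induction N using Int.induction_on with
  | zero =>
    refine Finset.sum_eq_zero fun j hj => ?_
    rw [zero_add]
    exact Int.ediv_eq_zero_of_lt (by positivity) (by exact_mod_cast Finset.mem_range.1 hj)
  | succ n ih => rw [hstep, ih]
  | pred n ih =>
    have := hstep (-(n : ℤ) - 1)
    rw [sub_add_cancel, ih] at this
    linarith

/-- The distribution relation of the sawtooth function. -/
lemma sum_sawtooth_add_div {b : ℕ} (hb : 0 < b) (y : ℝ) :
    ∑ j ∈ Finset.range b, sawtooth (y + j / b) = sawtooth (b * y) := by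
  have hb0 : (b : ℝ) ≠ 0 := by exact_mod_cast hb.ne'
  have hfl : ∀ j : ℕ, ⌊y + j / b⌋ = (⌊(b : ℝ) * y⌋ + j) / (b : ℤ) := by
    intro j
    rw [← Int.floor_add_natCast, ← Int.floor_div_natCast]
    congr 1; field_simp
  have h1 : ∑ j ∈ Finset.range b, (⌊y + (j : ℝ) / b⌋ : ℝ) = ⌊(b : ℝ) * y⌋ := by
    rw [← Int.sum_range_add_div hb ⌊(b : ℝ) * y⌋]
    push_cast
    exact Finset.sum_congr rfl fun j _ => by rw [hfl]
  have h2 : ∑ j ∈ Finset.range b, (j : ℝ) = b * (b - 1) / 2 := by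
    have := Finset.sum_range_id_mul_two b
    have h3 : ((∑ j ∈ Finset.range b, j : ℕ) : ℝ) * 2 = b * (b - 1) := by
      rw [← Nat.cast_pred hb]; exact_mod_cast this
    push_cast at h3
    linarith
  simp only [sawtooth, Int.fract]
  rw [Finset.sum_sub_distrib, Finset.sum_sub_distrib, h1, Finset.sum_add_distrib,
    ← Finset.sum_div (Finset.range b) (fun j : ℕ => (j : ℝ)), h2]
  simp only [one_div, Finset.sum_const, Finset.card_range, nsmul_eq_mul]
  field_simp
  ring

lemma sum_sawtooth_add_mul_div {a b : ℕ} (hb : 0 < b) (hab : Nat.Coprime a b) (y : ℝ) :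
    ∑ j ∈ Finset.range b, sawtooth (y + a * j / b) = sawtooth (b * y) := by
  rw [← sum_sawtooth_add_div hb]
  have hb0 : (b : ℝ) ≠ 0 := by exact_mod_cast hb.ne'
  have hmaps : Set.MapsTo (fun j => a * j % b) (Finset.range b) (Finset.range b : Set ℕ) :=
    fun j _ => by simpa using Nat.mod_lt _ hb
  have hinj : Set.InjOn (fun j => a * j % b) (Finset.range b) := by
    intro i hi j hj hij
    have h : a * i ≡ a * j [MOD b] := hij
    have h2 := Nat.ModEq.cancel_left_of_coprime (by rwa [Nat.coprime_comm] at hab) h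
    simp only [Finset.coe_range, Set.mem_Iio] at hi hj
    exact Nat.ModEq.eq_of_lt_of_lt h2 hi hj
  refine Finset.sum_nbij (fun j => a * j % b) hmaps hinj
    (Finset.surjOn_of_injOn_of_card_le _ hmaps hinj le_rfl) fun j _ => ?_
  rw [← sawtooth_add_nat (y + ((a * j % b : ℕ) : ℝ) / b) (a * j / b)]
  congr 1
  have : (a : ℝ) * j = (a * j % b : ℕ) + b * (a * j / b : ℕ) := by
    exact_mod_cast (Nat.mod_add_div (a * j) b).symm
  rw [this]; field_simp; ring

lemma intervalIntegrable_sawtooth_mul (a b u v : ℝ) :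
    IntervalIntegrable (fun t => sawtooth (a * t) * sawtooth (b * t)) volume u v := by
  refine (intervalIntegrable_const (c := (1 : ℝ))).mono_fun ?_ (Filter.Eventually.of_forall ?_)
  · exact ((measurable_sawtooth.comp (measurable_const_mul a)).mul
      (measurable_sawtooth.comp (measurable_const_mul b))).aestronglyMeasurable
  · intro t
    simp only [norm_mul, Real.norm_eq_abs, norm_one]
    nlinarith [abs_sawtooth_le (a * t), abs_sawtooth_le (b * t), abs_nonneg (sawtooth (a * t)),
      abs_nonneg (sawtooth (b * t))]

lemma integral_comp_nat_mul_of_periodic {f : ℝ → ℝ} (hf : Function.Periodic f 1)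
    (hint : ∀ u v, IntervalIntegrable f volume u v) {n : ℕ} (hn : 0 < n) :
    ∫ t in (0 : ℝ)..1, f (n * t) = ∫ t in (0 : ℝ)..1, f t := by
  have hn0 : (n : ℝ) ≠ 0 := by exact_mod_cast hn.ne'
  have h := hf.intervalIntegral_add_zsmul_eq n 0 hint
  simp only [zero_add, zsmul_eq_mul, mul_one, Int.cast_natCast] at h
  rw [intervalIntegral.integral_comp_mul_left _ hn0, mul_zero, mul_one, h, smul_eq_mul]
  field_simp

lemma sawtooth_mul_periodic (a b : ℕ) :
    Function.Periodic (fun t => sawtooth (a * t) * sawtooth (b * t)) 1 := by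
  intro t
  simp only [mul_add, mul_one, sawtooth_add_nat]

/-- Averaging over the shifts by `j / b` replaces `a` by `a b` in the first factor, at the cost of
a factor `b`. -/
lemma nat_mul_integral_sawtooth {a b : ℕ} (hb : 0 < b) (hab : Nat.Coprime a b) :
    b * ∫ t in (0 : ℝ)..1, sawtooth (a * t) * sawtooth (b * t) =
      ∫ t in (0 : ℝ)..1, sawtooth (a * t) * sawtooth t := by
  have hb0 : (b : ℝ) ≠ 0 := by exact_mod_cast hb.ne'
  have hshift : ∀ j : ℕ, ∫ t in (0 : ℝ)..1, sawtooth (a * t + a * j / b) * sawtooth (b * t) =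
      ∫ t in (0 : ℝ)..1, sawtooth (a * t) * sawtooth (b * t) := by
    intro j
    have h1 := intervalIntegral.integral_comp_add_right (a := 0) (b := 1)
      (fun t => sawtooth (a * t) * sawtooth (b * t)) ((j : ℝ) / b)
    have h2 := (sawtooth_mul_periodic a b).intervalIntegral_add_eq (0 + (j : ℝ) / b) 0
    rw [zero_add 1, show 0 + (j : ℝ) / b + 1 = 1 + j / b by ring] at h2
    rw [← h2, ← h1]
    refine intervalIntegral.integral_congr fun t _ => ?_
    rw [show (b : ℝ) * (t + j / b) = b * t + j by field_simp, sawtooth_add_nat,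
      show (a : ℝ) * (t + j / b) = a * t + a * j / b by ring]
  have hint : ∀ j ∈ Finset.range b, IntervalIntegrable
      (fun t : ℝ => sawtooth (a * t + a * j / b) * sawtooth (b * t)) volume 0 1 := by
    intro j _
    refine (intervalIntegrable_const (c := (1 : ℝ))).mono_fun ?_ (Filter.Eventually.of_forall ?_)
    · exact ((measurable_sawtooth.comp ((measurable_const_mul _).add_const _)).mul
        (measurable_sawtooth.comp (measurable_const_mul _))).aestronglyMeasurable
    · intro t
      simp only [norm_mul, Real.norm_eq_abs, norm_one]
      nlinarith [abs_sawtooth_le (a * t + a * j / b), abs_sawtooth_le (b * t),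
        abs_nonneg (sawtooth (a * t + a * j / b)), abs_nonneg (sawtooth (b * t))]
  have hsum : ∫ t in (0 : ℝ)..1, ∑ j ∈ Finset.range b,
      sawtooth (a * t + a * j / b) * sawtooth (b * t) =
      b * ∫ t in (0 : ℝ)..1, sawtooth (a * t) * sawtooth (b * t) := by
    rw [intervalIntegral.integral_finsetSum hint, Finset.sum_congr rfl fun j _ => hshift j]
    simp
  rw [← hsum]
  have hfin : ∀ t : ℝ, ∑ j ∈ Finset.range b, sawtooth (a * t + a * j / b) * sawtooth (b * t) =
      sawtooth (a * (b * t)) * sawtooth (b * t) := by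
    intro t
    rw [← Finset.sum_mul, sum_sawtooth_add_mul_div hb hab]
    ring_nf
  simp only [hfin]
  have := integral_comp_nat_mul_of_periodic (f := fun t => sawtooth (a * t) * sawtooth t)
    (by simpa using sawtooth_mul_periodic a 1)
    (by simpa using fun u v => intervalIntegrable_sawtooth_mul a 1 u v) hb
  exact this

lemma integral_sawtooth_sq : ∫ t in (0 : ℝ)..1, sawtooth t * sawtooth t = 1 / 12 := by
  have h : ∫ t in (0 : ℝ)..1, sawtooth t * sawtooth t = ∫ t in (0 : ℝ)..1, (t - 1 / 2) ^ 2 := by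
    rw [intervalIntegral.integral_of_le zero_le_one, intervalIntegral.integral_of_le zero_le_one,
      integral_Ioc_eq_integral_Ioo, integral_Ioc_eq_integral_Ioo]
    refine setIntegral_congr_fun measurableSet_Ioo fun t ht => ?_
    simp only [sawtooth]
    rw [Int.fract_eq_self.2 ⟨ht.1.le, ht.2⟩]; ring
  rw [h, intervalIntegral.integral_comp_sub_right (fun t => t ^ 2), integral_pow]
  norm_num

/-- Applying `nat_mul_integral_sawtooth` to both factors reduces the integral for coprime `a` and
`b` to that of the square of the sawtooth function. -/
theorem integral_sawtooth_mul_sawtooth {a b : ℕ} (ha : a ≠ 0) (hb : b ≠ 0) :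
    ∫ t in (0 : ℝ)..1, sawtooth (a * t) * sawtooth (b * t) =
      (Nat.gcd a b : ℝ) ^ 2 / (12 * (a * b)) := by
  obtain ⟨g, a', b', hg, hco, rfl, rfl⟩ := Nat.exists_coprime' (m := a) (n := b)
    (Nat.gcd_pos_of_pos_left _ (Nat.pos_of_ne_zero ha))
  have ha' : 0 < a' := Nat.pos_of_ne_zero (left_ne_zero_of_mul ha)
  have hb' : 0 < b' := Nat.pos_of_ne_zero (left_ne_zero_of_mul hb)
  have h1 := integral_comp_nat_mul_of_periodic (sawtooth_mul_periodic a' b')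
    (fun u v => intervalIntegrable_sawtooth_mul a' b' u v) hg
  have h2 := nat_mul_integral_sawtooth hb' hco
  have h3 := nat_mul_integral_sawtooth ha' (Nat.coprime_one_left a')
  simp only [Nat.cast_one, one_mul] at h3
  rw [integral_sawtooth_sq] at h3
  simp only [mul_comm (sawtooth (_ : ℝ)) (sawtooth ((a' : ℝ) * _))] at h3
  have h4 : ∫ t in (0 : ℝ)..1, sawtooth ((a' * g : ℕ) * t) * sawtooth ((b' * g : ℕ) * t) =
      ∫ t in (0 : ℝ)..1, sawtooth (a' * t) * sawtooth (b' * t) := by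
    rw [← h1]
    refine intervalIntegral.integral_congr fun t _ => ?_
    push_cast
    rw [mul_assoc, mul_assoc]
  rw [h4, Nat.gcd_mul_right, hco.gcd_eq_one, one_mul]
  push_cast
  have e1 : (a' : ℝ) ≠ 0 := by exact_mod_cast ha'.ne'
  have e2 : (b' : ℝ) ≠ 0 := by exact_mod_cast hb'.ne'
  have e3 : (g : ℝ) ≠ 0 := by exact_mod_cast hg.ne'
  have : ∫ t in (0 : ℝ)..1, sawtooth (a' * t) * sawtooth (b' * t) = 1 / (12 * (a' * b')) := by
    have h5 : (a' : ℝ) * (b' * ∫ t in (0 : ℝ)..1, sawtooth (a' * t) * sawtooth (b' * t)) =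
        1 / 12 := by rw [h2, h3]
    field_simp at h5 ⊢
    linarith
  rw [this]; field_simp

lemma memLp_sawtooth_mul (a : ℝ) :
    MemLp (fun t => √12 * sawtooth (a * t)) 2 (volume.restrict (Set.Ioc (0 : ℝ) 1)) := by
  refine MemLp.of_bound (C := √12) ?_ (Filter.Eventually.of_forall fun t => ?_)
  · exact (measurable_const.mul
      (measurable_sawtooth.comp (measurable_const_mul a))).aestronglyMeasurable
  · rw [norm_mul, Real.norm_eq_abs, Real.norm_eq_abs, abs_of_nonneg (Real.sqrt_nonneg _)]
    exact mul_le_of_le_one_right (Real.sqrt_nonneg _) ((abs_sawtooth_le _).trans (by norm_num))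

/-- The function `t ↦ √12 (1/2 - {a t})` in `L²(0, 1)`. -/
noncomputable def sawtoothVec (a : ℕ) : Lp ℝ 2 (volume.restrict (Set.Ioc (0 : ℝ) 1)) :=
  (memLp_sawtooth_mul a).toLp _

lemma inner_sawtoothVec (a b : ℕ) : inner ℝ (sawtoothVec a) (sawtoothVec b) =
    12 * ∫ t in (0 : ℝ)..1, sawtooth (a * t) * sawtooth (b * t) := by
  rw [L2.inner_def, intervalIntegral.integral_of_le zero_le_one, ← integral_const_mul]
  refine integral_congr_ae ?_
  filter_upwards [(memLp_sawtooth_mul a).coeFn_toLp, (memLp_sawtooth_mul b).coeFn_toLp]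
    with t h1 h2
  rw [sawtoothVec, sawtoothVec, h1, h2]
  have : √(12 : ℝ) * √12 = 12 := Real.mul_self_sqrt (by norm_num)
  simp only [RCLike.inner_apply, conj_trivial]
  linear_combination (sawtooth (a * t) * sawtooth (b * t)) * this

theorem isGcdGram_sawtoothVec : IsGcdGram sawtoothVec := by
  intro a b ha hb
  rw [inner_sawtoothVec, integral_sawtooth_mul_sawtooth ha hb]
  field_simp

lemma norm_sq_sum_sawtoothVec {ι : Type*} (s : Finset ι) (w : ι → ℝ) (x : ι → ℕ) :
    ‖∑ i ∈ s, w i • sawtoothVec (x i)‖ ^ 2 =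
      12 * ∫ t in (0 : ℝ)..1, (∑ i ∈ s, w i * sawtooth (x i * t)) ^ 2 := by
  have h1 : ∀ t : ℝ, (∑ i ∈ s, w i * sawtooth (x i * t)) ^ 2 =
      ∑ i ∈ s, ∑ j ∈ s, (w i * w j) * (sawtooth (x i * t) * sawtooth (x j * t)) := by
    intro t
    rw [sq, Finset.sum_mul_sum]
    exact Finset.sum_congr rfl fun i _ => Finset.sum_congr rfl fun j _ => by ring
  have hint : ∀ i j, IntervalIntegrable
      (fun t => (w i * w j) * (sawtooth (x i * t) * sawtooth (x j * t))) volume 0 1 :=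
    fun i j => (intervalIntegrable_sawtooth_mul _ _ 0 1).const_mul _
  simp only [h1]
  rw [intervalIntegral.integral_finsetSum fun i _ => by
    have := IntervalIntegrable.sum s fun j _ => hint i j
    rwa [show (∑ j ∈ s, fun t => w i * w j * (sawtooth (x i * t) * sawtooth (x j * t))) = fun t =>
      ∑ j ∈ s, w i * w j * (sawtooth (x i * t) * sawtooth (x j * t)) from
      funext fun t => Finset.sum_apply _ _ _] at this]
  simp only [fun i => intervalIntegral.integral_finsetSum (s := s) (μ := volume) (a := 0) (b := 1)
    (f := fun j t => (w i * w j) * (sawtooth (x i * t) * sawtooth (x j * t)))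
    fun j _ => hint i j, intervalIntegral.integral_const_mul]
  rw [← real_inner_self_eq_norm_sq]
  simp only [sum_inner]
  simp only [inner_sum, real_inner_smul_left, real_inner_smul_right, inner_sawtoothVec,
    Finset.mul_sum]
  exact Finset.sum_congr rfl fun i _ => Finset.sum_congr rfl fun j _ => by ring

end Sawtooth

/-! ### Landau's criterion and the upper bound for the norm -/

section Landau

open MeasureTheory

/-- If `p` is a large prime and `N = ⌊t p⌋` then `⌊x N / p⌋ = ⌊x t⌋`. -/
lemma floor_mul_floor_div {t : ℝ} (ht : 0 ≤ t) {x p : ℕ} (hp : 0 < p)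
    (h : (x : ℝ) ≤ Int.fract (x * t) * p) : x * ⌊t * p⌋₊ / p = ⌊x * t⌋₊ := by
  have hp0 : (0 : ℝ) < p := by exact_mod_cast hp
  have h1 := Nat.floor_le (mul_nonneg ht hp0.le)
  have h2 := Nat.lt_floor_add_one (t * p)
  have hx : (0 : ℝ) ≤ x := Nat.cast_nonneg x
  rw [← Nat.floor_div_eq_div (K := ℝ)]
  have hfr : (⌊(x : ℝ) * t⌋₊ : ℝ) = x * t - Int.fract (x * t) := by
    rw [natCast_floor_eq_intCast_floor (by positivity), Int.self_sub_fract]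
  rw [Nat.floor_eq_iff (by positivity), hfr]
  push_cast
  constructor
  · rw [le_div_iff₀ hp0]
    nlinarith
  · rw [div_lt_iff₀ hp0]
    have := Nat.lt_floor_add_one ((x : ℝ) * t)
    rw [hfr] at this
    nlinarith

variable {K L : ℕ} {a : Fin K → ℕ} {b : Fin L → ℕ}

/-- Landau's criterion, in one direction: comparing the exponents of a large prime `p` in the
factorials for `n = ⌊t p⌋` shows that the step function `∑ ⌊aᵢ t⌋ - ∑ ⌊bⱼ t⌋` is nonnegative. -/
lemma IsIntegralFactorialRatio.sum_floor_le (h : IsIntegralFactorialRatio a b) {t : ℝ}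
    (ht : 0 < t) (ht1 : t < 1) (ha : ∀ i, 0 < Int.fract (a i * t))
    (hb : ∀ j, 0 < Int.fract (b j * t)) :
    ∑ j, ⌊(b j : ℝ) * t⌋₊ ≤ ∑ i, ⌊(a i : ℝ) * t⌋₊ := by
  -- all large primes `p` satisfy the conditions needed
  have hev : ∀ x : ℕ, 0 < Int.fract (x * t) → ∀ᶠ p : ℕ in Filter.atTop,
      x ≤ p ∧ (x : ℝ) ≤ Int.fract (x * t) * p := by
    intro x hx
    refine (Filter.eventually_ge_atTop x).and ?_
    exact ((tendsto_natCast_atTop_atTop (R := ℝ)).const_mul_atTop hx).eventually_ge_atTop _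
  have hall := (Filter.eventually_all.2 fun i => hev (a i) (ha i)).and
    (Filter.eventually_all.2 fun j => hev (b j) (hb j))
  obtain ⟨n₀, hn₀⟩ := Filter.eventually_atTop.1 hall
  obtain ⟨p, hpn, hp⟩ := Nat.exists_infinite_primes n₀
  obtain ⟨hpa, hpb⟩ := hn₀ p hpn
  have : Fact p.Prime := ⟨hp⟩
  have hp0 : (0 : ℝ) < p := by exact_mod_cast hp.pos
  set N := ⌊t * p⌋₊ with hN
  have hNp : N < p := by
    rw [hN, Nat.floor_lt (by positivity)]
    nlinarith
  have hval : ∀ x : ℕ, x ≤ p → (x : ℝ) ≤ Int.fract (x * t) * p →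
      padicValNat p (x * N).factorial = ⌊(x : ℝ) * t⌋₊ := by
    intro x hx hxf
    have hlt : x * N < p ^ 2 := by
      rw [sq]; exact Nat.mul_lt_mul_of_le_of_lt hx hNp hp.pos
    rw [padicValNat_factorial (b := 2) (Nat.log_lt_of_lt_pow' two_ne_zero hlt)]
    simpa using floor_mul_floor_div ht.le hp.pos hxf
  have hdvd := h.integral N
  have hne : ∀ {n : ℕ} (x : Fin n → ℕ), ∏ i, (x i * N).factorial ≠ 0 := fun x =>
    Finset.prod_ne_zero_iff.2 fun i _ => Nat.factorial_ne_zero _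
  have hle := (Nat.factorization_le_iff_dvd (hne b) (hne a)).2 hdvd p
  rw [Nat.factorization_prod_apply fun i _ => Nat.factorial_ne_zero _,
    Nat.factorization_prod_apply fun i _ => Nat.factorial_ne_zero _] at hle
  calc ∑ j, ⌊(b j : ℝ) * t⌋₊ = ∑ j, (b j * N).factorial.factorization p :=
        Finset.sum_congr rfl fun j _ => by
          rw [Nat.factorization_def _ hp, hval _ (hpb j).1 (hpb j).2]
      _ ≤ _ := hle
      _ = _ := Finset.sum_congr rfl fun i _ => by
          rw [Nat.factorization_def _ hp, hval _ (hpa i).1 (hpa i).2]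

/-- The signs `+1` for the numerator and `-1` for the denominator. -/
def ratioSign (K L : ℕ) : Fin K ⊕ Fin L → ℝ := Sum.elim (fun _ => 1) (fun _ => -1)

/-- The step function of an integral factorial ratio takes values in `[0, D]`, so that the sum of
sawtooth functions, which is the step function minus `D / 2`, is at most `D / 2` in size. -/
lemma IsIntegralFactorialRatio.abs_sum_sawtooth_le (h : IsIntegralFactorialRatio a b) {D : ℕ}
    (hL : L = K + D) {t : ℝ} (ht : 0 < t) (ht1 : t < 1) (ha : ∀ i, 0 < Int.fract (a i * t))
    (hb : ∀ j, 0 < Int.fract (b j * t)) :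
    |∑ i, ratioSign K L i * sawtooth (Sum.elim a b i * t)| ≤ D / 2 := by
  have hneg : ∀ x : ℕ, 0 < Int.fract (x * t) →
      0 < Int.fract (x * (1 - t)) ∧ (⌊(x : ℝ) * (1 - t)⌋₊ : ℝ) = x - 1 - ⌊(x : ℝ) * t⌋₊ := by
    intro x hx
    have hx0 : (0 : ℝ) ≤ x := Nat.cast_nonneg x
    have e : (x : ℝ) * (1 - t) = -(x * t) + x := by ring
    have hf : Int.fract ((x : ℝ) * (1 - t)) = 1 - Int.fract (x * t) := by
      rw [e, Int.fract_add_natCast, Int.fract_neg hx.ne']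
    refine ⟨by rw [hf]; linarith [Int.fract_lt_one ((x : ℝ) * t)], ?_⟩
    rw [natCast_floor_eq_intCast_floor (mul_nonneg hx0 (by linarith)),
      natCast_floor_eq_intCast_floor (by positivity), ← Int.self_sub_fract, hf,
      ← Int.self_sub_fract ((x : ℝ) * t)]
    ring
  have h1 : (∑ j, (⌊(b j : ℝ) * t⌋₊ : ℝ)) ≤ ∑ i, (⌊(a i : ℝ) * t⌋₊ : ℝ) := by
    exact_mod_cast h.sum_floor_le ht ht1 ha hb
  have h2 : (∑ j, (⌊(b j : ℝ) * (1 - t)⌋₊ : ℝ)) ≤ ∑ i, (⌊(a i : ℝ) * (1 - t)⌋₊ : ℝ) := by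
    exact_mod_cast h.sum_floor_le (by linarith) (by linarith) (fun i => (hneg _ (ha i)).1)
      (fun j => (hneg _ (hb j)).1)
  rw [Finset.sum_congr rfl fun j _ => (hneg _ (hb j)).2,
    Finset.sum_congr rfl fun i _ => (hneg _ (ha i)).2] at h2
  have hsum : (∑ i, (a i : ℝ)) = ∑ j, (b j : ℝ) := by exact_mod_cast h.sum_eq
  have hsaw : ∀ x : ℕ, sawtooth (x * t) = 1 / 2 - x * t + ⌊(x : ℝ) * t⌋₊ := by
    intro x
    rw [sawtooth, natCast_floor_eq_intCast_floor (by positivity), Int.fract]; ring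
  have hLr : (L : ℝ) = K + D := by exact_mod_cast hL
  simp only [Fintype.sum_sum_type, ratioSign, Sum.elim_inl, Sum.elim_inr, one_mul, neg_mul, hsaw,
    Finset.sum_neg_distrib]
  simp only [Finset.sum_sub_distrib, Finset.sum_add_distrib, Finset.sum_const, Finset.card_univ,
    Fintype.card_fin, nsmul_eq_mul, ← Finset.sum_mul] at h2 ⊢
  rw [abs_le]
  rw [hsum] at h2 ⊢
  constructor <;> linarith

/-- The squared norm attached to an integral factorial ratio is at most `3 D²`. -/
theorem IsIntegralFactorialRatio.norm_sq_le (h : IsIntegralFactorialRatio a b) {D : ℕ}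
    (hL : L = K + D) :
    ‖∑ i, ratioSign K L i • sawtoothVec (Sum.elim a b i)‖ ^ 2 ≤ 3 * D ^ 2 := by
  rw [norm_sq_sum_sawtoothVec]
  set F : ℝ → ℝ := fun t => ∑ i, ratioSign K L i * sawtooth (Sum.elim a b i * t) with hF
  have hgen : ∀ x : ℕ, 0 < x → ∀ᵐ t : ℝ, 0 < Int.fract (x * t) := by
    intro x hx
    have hx0 : (x : ℝ) ≠ 0 := by exact_mod_cast hx.ne'
    have hc : (Set.range fun m : ℤ => (m : ℝ) / x).Countable := Set.countable_range _
    filter_upwards [hc.ae_notMem volume] with t ht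
    refine (Int.fract_nonneg _).lt_of_ne' fun h0 => ht ?_
    refine ⟨⌊(x : ℝ) * t⌋, ?_⟩
    have := Int.self_sub_fract ((x : ℝ) * t)
    rw [h0, sub_zero] at this
    simp only
    rw [← this]; field_simp
  have hbound : ∀ᵐ t ∂volume.restrict (Set.Ioc (0 : ℝ) 1), F t ^ 2 ≤ (D / 2 : ℝ) ^ 2 := by
    rw [ae_restrict_iff' measurableSet_Ioc]
    have hne1 : ∀ᵐ t : ℝ, t ≠ 1 := Measure.ae_ne volume 1
    filter_upwards [ae_all_iff.2 fun i => hgen (a i) (h.num_pos i),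
      ae_all_iff.2 fun j => hgen (b j) (h.den_pos j), hne1] with t h1 h2 h3 ht
    rw [← sq_abs]
    exact pow_le_pow_left₀ (abs_nonneg _)
      (h.abs_sum_sawtooth_le hL ht.1 (lt_of_le_of_ne ht.2 h3) h1 h2) 2
  have hmeas : Measurable F := by
    refine Finset.measurable_sum _ fun i _ => ?_
    exact measurable_const.mul (measurable_sawtooth.comp (measurable_const_mul _))
  have hle : ∫ t in (0 : ℝ)..1, F t ^ 2 ≤ (D / 2 : ℝ) ^ 2 := by
    rw [intervalIntegral.integral_of_le zero_le_one]
    calc ∫ t in Set.Ioc (0 : ℝ) 1, F t ^ 2 ≤ ∫ t in Set.Ioc (0 : ℝ) 1, (D / 2 : ℝ) ^ 2 := by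
          refine integral_mono_ae ?_ (integrable_const _) hbound
          refine Integrable.mono' (integrable_const ((D / 2 : ℝ) ^ 2))
            (hmeas.pow_const 2).aestronglyMeasurable ?_
          filter_upwards [hbound] with t ht
          rwa [Real.norm_eq_abs, abs_of_nonneg (sq_nonneg _)]
      _ = _ := by simp
  linarith

lemma IsIntegralFactorialRatio.isSignedFamily (h : IsIntegralFactorialRatio a b) :
    IsSignedFamily Finset.univ (ratioSign K L) (Sum.elim a b) := by
  refine ⟨fun i _ => by cases i <;> simp [ratioSign], fun i _ j _ hij => ?_⟩
  rcases i with i | i <;> rcases j with j | j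
  · rfl
  · exact absurd hij (h.no_common i j)
  · exact absurd hij.symm (h.no_common j i)
  · rfl

lemma IsIntegralFactorialRatio.ne_zero (h : IsIntegralFactorialRatio a b) (i : Fin K ⊕ Fin L) :
    Sum.elim a b i ≠ 0 := by
  rcases i with i | i
  · exact (h.num_pos i).ne'
  · exact (h.den_pos i).ne'

end Landau

/-! ### Splitting a family into clusters of small height -/

section Clusters

variable {E : Type*} [NormedAddCommGroup E] [InnerProductSpace ℝ E] {φ : ℕ → E}
variable {ι : Type*}

/-- Two indices are joined if the fraction `x i / x j` in lowest terms has height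
`x i * x j / gcd ^ 2` at most `H`. -/
def heightGraph (x : ι → ℕ) (H : ℕ) : SimpleGraph ι where
  Adj i j := i ≠ j ∧ x i * x j ≤ H * Nat.gcd (x i) (x j) ^ 2
  symm := ⟨fun i j h => ⟨h.1.symm, by rw [mul_comm, Nat.gcd_comm]; exact h.2⟩⟩
  loopless := ⟨fun i h => h.1 rfl⟩

/-- Along a walk the heights of the ratios multiply. -/
lemma exists_mul_eq_mul_of_walk {x : ι → ℕ} {H : ℕ} (hx : ∀ i, x i ≠ 0) {i j : ι}
    (p : (heightGraph x H).Walk i j) :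
    ∃ u v : ℕ, 0 < u ∧ 0 < v ∧ u ≤ H ^ p.length ∧ v ≤ H ^ p.length ∧ x i * u = x j * v := by
  induction p with
  | nil => exact ⟨1, 1, by simp⟩
  | @cons i j k hij p ih =>
    obtain ⟨u, v, hu, hv, huH, hvH, huv⟩ := ih
    obtain ⟨g, a, b, hg, hco, hi, hj⟩ := Nat.exists_coprime' (m := x i) (n := x j)
      (Nat.gcd_pos_of_pos_left _ (Nat.pos_of_ne_zero (hx i)))
    have ha : 0 < a := Nat.pos_of_ne_zero fun h => hx i (by rw [hi, h, zero_mul])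
    have hb : 0 < b := Nat.pos_of_ne_zero fun h => hx j (by rw [hj, h, zero_mul])
    have h2 := hij.2
    rw [hi, hj, Nat.gcd_mul_right, hco.gcd_eq_one, one_mul] at h2
    have hab : a * b ≤ H := by
      refine Nat.le_of_mul_le_mul_right (c := g ^ 2) ?_ (by positivity)
      calc a * b * g ^ 2 = a * g * (b * g) := by ring
        _ ≤ _ := h2
    have haH : a ≤ H := (Nat.le_mul_of_pos_right a hb).trans hab
    have hbH : b ≤ H := (Nat.le_mul_of_pos_left b ha).trans hab
    refine ⟨b * u, a * v, by positivity, by positivity, ?_, ?_, ?_⟩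
    · rw [SimpleGraph.Walk.length_cons, pow_succ, mul_comm]; exact Nat.mul_le_mul huH hbH
    · rw [SimpleGraph.Walk.length_cons, pow_succ, mul_comm]; exact Nat.mul_le_mul hvH haH
    · rw [hi]
      calc a * g * (b * u) = a * (b * g * u) := by ring
        _ = a * (x k * v) := by rw [← hj, huv]
        _ = x k * (a * v) := by ring

lemma IsGcdGram.le_norm_sq_of_card (hφ : IsGcdGram φ) {s : Finset ι} {w : ι → ℝ} {x : ι → ℕ}
    (hs : IsSignedFamily s w x) (hx : ∀ i ∈ s, x i ≠ 0) (hne : s.Nonempty) {m c : ℕ}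
    (hm : m ≤ s.card) (hm82 : m ≤ 82)
    (hc : ∀ n < 83 - m, c ≤ normBound (n + m)) :
    (c : ℝ) / 10000 ≤ ‖∑ i ∈ s, w i • φ (x i)‖ ^ 2 := by
  refine le_trans ?_ (hφ.normBound_le hs hx hne)
  have h := hc (min s.card 82 - m) (by omega)
  rw [show min s.card 82 - m + m = min s.card 82 by omega] at h
  have h' : (c : ℝ) ≤ normBound (min s.card 82) := by exact_mod_cast h
  linarith

/-- One or two integers cannot have signed sum zero, as equal integers have equal signs. -/
lemma IsSignedFamily.three_le_card {s : Finset ι} {w : ι → ℝ} {x : ι → ℕ}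
    (hs : IsSignedFamily s w x) (hx : ∀ i ∈ s, x i ≠ 0) (hne : s.Nonempty)
    (h0 : ∑ i ∈ s, w i * x i = 0) : 3 ≤ s.card := by
  classical
  have hpos := hne.card_pos
  by_contra hlt
  have h12 : s.card = 1 ∨ s.card = 2 := by omega
  have hw : ∀ i ∈ s, w i = 1 ∨ w i = -1 := fun i hi => sq_eq_one_iff.1 (hs.1 i hi)
  rcases h12 with h | h
  · obtain ⟨i, rfl⟩ := Finset.card_eq_one.1 h
    rw [Finset.sum_singleton] at h0
    have hxi : (x i : ℝ) ≠ 0 := by exact_mod_cast hx i (by simp)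
    rcases hw i (by simp) with h | h <;> rw [h] at h0 <;> simp_all
  · obtain ⟨i, j, hij, rfl⟩ := Finset.card_eq_two.1 h
    rw [Finset.sum_pair hij] at h0
    have hxi : (0 : ℝ) < x i := by exact_mod_cast Nat.pos_of_ne_zero (hx i (by simp))
    have hxj : (0 : ℝ) < x j := by exact_mod_cast Nat.pos_of_ne_zero (hx j (by simp))
    have hne' : x i = x j → w i = w j := hs.2 i (by simp) j (by simp)
    rcases hw i (by simp) with h1 | h1 <;> rcases hw j (by simp) with h2 | h2 <;>
      rw [h1, h2] at h0
    · linarith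
    · have : x i = x j := by have : (x i : ℝ) = x j := by linarith
                             exact_mod_cast this
      have := hne' this
      rw [h1, h2] at this; norm_num at this
    · have : x i = x j := by have : (x i : ℝ) = x j := by linarith
                             exact_mod_cast this
      have := hne' this
      rw [h1, h2] at this; norm_num at this
    · linarith

variable [Fintype ι]

lemma exists_mul_eq_mul_of_reachable {x : ι → ℕ} {H : ℕ} (hH : 0 < H) (hx : ∀ i, x i ≠ 0) {i j : ι}
    (h : (heightGraph x H).Reachable i j) :
    ∃ u v : ℕ, 0 < u ∧ 0 < v ∧ u ≤ H ^ Fintype.card ι ∧ v ≤ H ^ Fintype.card ι ∧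
      x i * u = x j * v := by
  classical
  obtain ⟨p, hp⟩ := h.exists_isPath
  obtain ⟨u, v, hu, hv, huH, hvH, huv⟩ := exists_mul_eq_mul_of_walk hx p
  have := Nat.pow_le_pow_right hH hp.length_lt.le
  exact ⟨u, v, hu, hv, huH.trans this, hvH.trans this, huv⟩

/-- If the integers in distinct classes of a partition are pairwise of large height ratio, then
the squared norm is nearly the sum of the squared norms of the classes. -/
lemma IsGcdGram.sum_norm_sq_fiber_le (hφ : IsGcdGram φ) {κ : Type*} [Fintype κ] [DecidableEq κ]
    {w : ι → ℝ} {x : ι → ℕ} (hx : ∀ i, x i ≠ 0) (hw : ∀ i, w i ^ 2 = 1) {H : ℕ} (hH : 0 < H)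
    (f : ι → κ) (hf : ∀ i j, f i ≠ f j → ¬ (heightGraph x H).Adj i j) :
    ∑ k, ‖∑ i with f i = k, w i • φ (x i)‖ ^ 2 ≤
      ‖∑ i, w i • φ (x i)‖ ^ 2 + (Fintype.card ι : ℝ) ^ 2 / H := by
  have hH0 : (0 : ℝ) < H := by exact_mod_cast hH
  have h1 : ∑ k, ‖∑ i with f i = k, w i • φ (x i)‖ ^ 2 =
      ∑ i, ∑ j, if f i = f j then inner ℝ (w i • φ (x i)) (w j • φ (x j)) else 0 := by
    have : ∀ k, ‖∑ i with f i = k, w i • φ (x i)‖ ^ 2 = ∑ i, ∑ j,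
        if f i = k then (if f j = k then inner ℝ (w i • φ (x i)) (w j • φ (x j)) else 0) else 0 := by
      intro k
      rw [← real_inner_self_eq_norm_sq, sum_inner, Finset.sum_filter]
      refine Finset.sum_congr rfl fun i _ => ?_
      split_ifs with h
      · rw [inner_sum, Finset.sum_filter]
      · simp
    simp only [this]
    rw [Finset.sum_comm]
    refine Finset.sum_congr rfl fun i _ => ?_
    rw [Finset.sum_comm]
    refine Finset.sum_congr rfl fun j _ => ?_
    simp [eq_comm]
  have h2 : ‖∑ i, w i • φ (x i)‖ ^ 2 =
      ∑ i, ∑ j, inner ℝ (w i • φ (x i)) (w j • φ (x j)) := by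
    rw [← real_inner_self_eq_norm_sq, sum_inner]
    exact Finset.sum_congr rfl fun i _ => inner_sum _ _ _
  have h3 : (Fintype.card ι : ℝ) ^ 2 / H = ∑ i : ι, ∑ j : ι, (1 : ℝ) / H := by
    simp; ring
  rw [h1, h2, h3, ← Finset.sum_add_distrib]
  refine Finset.sum_le_sum fun i _ => ?_
  rw [← Finset.sum_add_distrib]
  refine Finset.sum_le_sum fun j _ => ?_
  split_ifs with h
  · have : (0 : ℝ) ≤ 1 / H := by positivity
    linarith
  · have hij : i ≠ j := fun hij => h (by rw [hij])
    have hadj : H * Nat.gcd (x i) (x j) ^ 2 < x i * x j := by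
      by_contra hcon
      exact hf i j h ⟨hij, not_lt.1 hcon⟩
    have hpos : (0 : ℝ) < x i * x j := by
      exact_mod_cast Nat.mul_pos (Nat.pos_of_ne_zero (hx i)) (Nat.pos_of_ne_zero (hx j))
    have hk : (Nat.gcd (x i) (x j) : ℝ) ^ 2 / (x i * x j) ≤ 1 / H := by
      rw [div_le_div_iff₀ hpos hH0, one_mul, mul_comm]
      exact_mod_cast hadj.le
    have hk0 : 0 ≤ (Nat.gcd (x i) (x j) : ℝ) ^ 2 / (x i * x j) := by positivity
    rw [real_inner_smul_left, real_inner_smul_right, hφ _ _ (hx i) (hx j)]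
    have hww : -1 ≤ w i * w j := by nlinarith [hw i, hw j, sq_nonneg (w i + w j)]
    nlinarith

end Clusters

/-! ### Subspaces of points with prescribed ratios -/

section Subspaces

variable {ι : Type*} [Fintype ι]

/-- The points whose coordinates have prescribed ratios `v i / u i` to the coordinate at a
representative `ρ i`, and whose coordinates, with signs `w`, sum to zero. -/
def ratioSubspace (w : ι → ℝ) (ρ : ι → ι) (u v : ι → ℕ) : Submodule ℝ (ι → ℝ) where
  carrier := {y | (∀ i, y i * u i = y (ρ i) * v i) ∧ ∑ i, w i * y i = 0}
  add_mem' := by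
    rintro y z ⟨h1, h2⟩ ⟨h3, h4⟩
    refine ⟨fun i => ?_, ?_⟩
    · simp only [Pi.add_apply, add_mul, h1, h3]
    · simp only [Pi.add_apply, mul_add, Finset.sum_add_distrib, h2, h4, add_zero]
  zero_mem' := by simp
  smul_mem' := by
    rintro c y ⟨h1, h2⟩
    refine ⟨fun i => ?_, ?_⟩
    · simp only [Pi.smul_apply, smul_eq_mul, mul_assoc, h1]
    · simp only [Pi.smul_apply, smul_eq_mul, mul_left_comm _ c, ← Finset.mul_sum, h2, mul_zero]

variable [DecidableEq ι] {w : ι → ℝ} {ρ : ι → ι} {u v : ι → ℕ}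

/-- Restriction of the points of `ratioSubspace` to the representatives. -/
def restrictRepresentatives (w : ι → ℝ) (ρ : ι → ι) (u v : ι → ℕ) :
    ratioSubspace w ρ u v →ₗ[ℝ] (Finset.univ.image ρ → ℝ) :=
  (LinearMap.funLeft ℝ ℝ ((↑) : Finset.univ.image ρ → ι)).comp (ratioSubspace w ρ u v).subtype

lemma restrictRepresentatives_injective (hu : ∀ i, u i ≠ 0) :
    Function.Injective (restrictRepresentatives w ρ u v) := by
  rw [← LinearMap.ker_eq_bot, LinearMap.ker_eq_bot']
  rintro ⟨y, h1, h2⟩ hy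
  have hr : ∀ r ∈ Finset.univ.image ρ, y r = 0 := fun r hr => congrFun hy ⟨r, hr⟩
  ext i
  have := h1 i
  rw [hr (ρ i) (Finset.mem_image_of_mem ρ (Finset.mem_univ i)), zero_mul] at this
  have hui : (u i : ℝ) ≠ 0 := by exact_mod_cast hu i
  simpa [hui] using this

lemma finrank_ratioSubspace_le (hu : ∀ i, u i ≠ 0) :
    Module.finrank ℝ (ratioSubspace w ρ u v) ≤ (Finset.univ.image ρ).card := by
  have := LinearMap.finrank_le_finrank_of_injective
    (restrictRepresentatives_injective (w := w) (ρ := ρ) (v := v) hu)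
  rwa [Module.finrank_fintype_fun_eq_card, Fintype.card_coe] at this

/-- If the signed sum of the ratios over some class is nonzero, the sum condition cuts down the
dimension. -/
lemma finrank_ratioSubspace_lt (hu : ∀ i, u i ≠ 0) {r : ι} (hr : r ∈ Finset.univ.image ρ)
    (hne : ∑ i with ρ i = r, w i * (v i / u i : ℝ) ≠ 0) :
    Module.finrank ℝ (ratioSubspace w ρ u v) < (Finset.univ.image ρ).card := by
  refine (finrank_ratioSubspace_le hu).lt_of_ne fun heq => hne ?_
  have hinj := restrictRepresentatives_injective (w := w) (ρ := ρ) (v := v) hu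
  have hsurj := (LinearMap.injective_iff_surjective_of_finrank_eq_finrank
    (f := restrictRepresentatives w ρ u v) (by
      rw [heq, Module.finrank_fintype_fun_eq_card, Fintype.card_coe])).1 hinj
  obtain ⟨⟨y, h1, h2⟩, hy⟩ := hsurj (Pi.single ⟨r, hr⟩ 1)
  have hyr : ∀ k (hk : k ∈ Finset.univ.image ρ), y k = if k = r then 1 else 0 := by
    intro k hk
    have := congrFun hy ⟨k, hk⟩
    change y k = _ at this
    rw [this, Pi.single_apply]
    simp
  rw [← h2, Finset.sum_filter]
  refine Finset.sum_congr rfl fun i _ => ?_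
  have hui : (u i : ℝ) ≠ 0 := by exact_mod_cast hu i
  have h3 := h1 i
  rw [hyr _ (Finset.mem_image_of_mem ρ (Finset.mem_univ i))] at h3
  split_ifs at h3 ⊢ with h
  · rw [one_mul] at h3; rw [← h3]; field_simp
  · rw [zero_mul] at h3
    rcases mul_eq_zero.1 h3 with h4 | h4
    · rw [h4, mul_zero]
    · exact absurd h4 hui

end Subspaces

/-! ### Subspaces containing the integral factorial ratios, and the case `D = 2` -/

section Consequences

variable {K L : ℕ} {a : Fin K → ℕ} {b : Fin L → ℕ}

lemma IsIntegralFactorialRatio.norm_sq_fiber_le (h : IsIntegralFactorialRatio a b) {D : ℕ}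
    (hL : L = K + D) {H : ℕ} (hH : 0 < H) {κ : Type*} [Fintype κ] [DecidableEq κ]
    (f : Fin K ⊕ Fin L → κ)
    (hf : ∀ i j, f i ≠ f j → ¬ (heightGraph (Sum.elim a b) H).Reachable i j) :
    ∑ k, ‖∑ i with f i = k, ratioSign K L i • sawtoothVec (Sum.elim a b i)‖ ^ 2 ≤
      3 * D ^ 2 + ((K + L : ℕ) : ℝ) ^ 2 / H := by
  have h1 := isGcdGram_sawtoothVec.sum_norm_sq_fiber_le h.ne_zero
    (fun i => h.isSignedFamily.1 i (Finset.mem_univ i)) hH f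
    (fun i j hij hadj => hf i j hij hadj.reachable)
  have h2 := h.norm_sq_le hL
  rw [Fintype.card_sum, Fintype.card_fin, Fintype.card_fin] at h1
  linarith

lemma IsIntegralFactorialRatio.sum_ratioSign_mul (h : IsIntegralFactorialRatio a b) :
    ∑ i, ratioSign K L i * ((Sum.elim a b i : ℕ) : ℝ) = 0 := by
  have hsum : (∑ i, (a i : ℝ)) = ∑ j, (b j : ℝ) := by exact_mod_cast h.sum_eq
  simp [Fintype.sum_sum_type, ratioSign, hsum]

/-- Every integral factorial ratio lies on a `ratioSubspace` of dimension at most `3 D² - 1` with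
ratios of bounded height. -/
lemma IsIntegralFactorialRatio.exists_ratioSubspace (h : IsIntegralFactorialRatio a b) {D : ℕ}
    (hD : 1 ≤ D) (hL : L = K + D) {H : ℕ} (hH : H = 2 * (K + L) ^ 2 + 2) :
    ∃ (ρ : Fin K ⊕ Fin L → Fin K ⊕ Fin L) (u v : Fin K ⊕ Fin L → ℕ),
      (∀ i, u i ≤ H ^ (K + L)) ∧ (∀ i, v i ≤ H ^ (K + L)) ∧
      Module.finrank ℝ (ratioSubspace (ratioSign K L) ρ u v) ≤ 3 * D ^ 2 - 1 ∧
      (fun i => ((Sum.elim a b i : ℕ) : ℝ)) ∈ ratioSubspace (ratioSign K L) ρ u v := by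
  classical
  set x := Sum.elim a b with hx
  set w := ratioSign K L with hw
  set G := heightGraph x H with hG
  have hH0 : 0 < H := by omega
  set ρ : Fin K ⊕ Fin L → Fin K ⊕ Fin L := fun i => (G.connectedComponentMk i).out with hρ
  have hρr : ∀ i, G.Reachable i (ρ i) := fun i =>
    (SimpleGraph.ConnectedComponent.exact (Quot.out_eq (G.connectedComponentMk i))).symm
  have hρne : ∀ i j, ρ i ≠ ρ j → ¬ G.Reachable i j := by
    intro i j hij hr
    exact hij (by simp only [hρ]; rw [SimpleGraph.ConnectedComponent.sound hr])
  have hcard : Fintype.card (Fin K ⊕ Fin L) = K + L := by simp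
  choose u v hu hv huH hvH huv using fun i => exists_mul_eq_mul_of_reachable hH0 h.ne_zero (hρr i)
  rw [hcard] at huH hvH
  refine ⟨ρ, u, v, huH, hvH, ?_, ?_⟩
  · have hu' : ∀ i, u i ≠ 0 := fun i => (hu i).ne'
    set k := (Finset.univ.image ρ).card with hk
    have hle := h.norm_sq_fiber_le hL hH0 ρ hρne
    have hgap : ((K + L : ℕ) : ℝ) ^ 2 / H ≤ 1 / 2 := by
      rw [div_le_iff₀ (by exact_mod_cast hH0), hH]
      push_cast; linarith
    have hsub : ∑ r ∈ Finset.univ.image ρ,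
        ‖∑ i with ρ i = r, w i • sawtoothVec (x i)‖ ^ 2 ≤ 3 * D ^ 2 + 1 / 2 :=
      (Finset.sum_le_univ_sum_of_nonneg fun r => sq_nonneg _).trans (by linarith)
    have hfam : ∀ r, IsSignedFamily (Finset.univ.filter fun i => ρ i = r) w x := fun r =>
      h.isSignedFamily.mono (Finset.filter_subset _ _)
    have hne : ∀ r ∈ Finset.univ.image ρ, (Finset.univ.filter fun i => ρ i = r).Nonempty := by
      intro r hr
      obtain ⟨i, -, rfl⟩ := Finset.mem_image.1 hr
      exact ⟨i, by simp⟩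
    have hone : ∀ r ∈ Finset.univ.image ρ,
        (1 : ℝ) ≤ ‖∑ i with ρ i = r, w i • sawtoothVec (x i)‖ ^ 2 := by
      intro r hr
      have := isGcdGram_sawtoothVec.le_norm_sq_of_card (hfam r) (fun i _ => h.ne_zero i) (hne r hr)
        (hne r hr).card_pos (by norm_num) normBound_pos_size
      norm_num at this ⊢
      exact this
    have hkle : k ≤ 3 * D ^ 2 := by
      have h1 := (Finset.card_nsmul_le_sum _ _ _ hone).trans hsub
      rw [nsmul_eq_mul, mul_one] at h1
      have h2 : (k : ℝ) < (3 * D ^ 2 + 1 : ℕ) := by push_cast; linarith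
      have h3 : k < 3 * D ^ 2 + 1 := by exact_mod_cast h2
      omega
    rcases hkle.lt_or_eq with hlt | heq
    · have := finrank_ratioSubspace_le (w := w) (ρ := ρ) (v := v) hu'
      omega
    · -- if all classes had signed sum zero, they would all have at least three elements
      have hex : ∃ r ∈ Finset.univ.image ρ, ∑ i with ρ i = r, w i * (x i : ℝ) ≠ 0 := by
        by_contra! hall
        have hthree : ∀ r ∈ Finset.univ.image ρ,
            (13 / 10 : ℝ) ≤ ‖∑ i with ρ i = r, w i • sawtoothVec (x i)‖ ^ 2 := by
          intro r hr
          have h3 := (hfam r).three_le_card (fun i _ => h.ne_zero i) (hne r hr) (hall r hr)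
          have := isGcdGram_sawtoothVec.le_norm_sq_of_card (hfam r) (fun i _ => h.ne_zero i)
            (hne r hr) h3 (by norm_num) normBound_three_le
          norm_num at this ⊢
          exact this
        have h1 := (Finset.card_nsmul_le_sum _ _ _ hthree).trans hsub
        rw [nsmul_eq_mul, ← hk, heq] at h1
        have h2 : (1 : ℝ) ≤ D := by exact_mod_cast hD
        push_cast at h1
        nlinarith
      obtain ⟨r, hr, hrne⟩ := hex
      have hxr : (x r : ℝ) ≠ 0 := by exact_mod_cast h.ne_zero r
      have := finrank_ratioSubspace_lt (w := w) (v := v) hu' hr (by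
        intro h0
        apply hrne
        have : ∑ i with ρ i = r, w i * (x i : ℝ) =
            x r * ∑ i with ρ i = r, w i * (v i / u i : ℝ) := by
          rw [Finset.mul_sum]
          refine Finset.sum_congr rfl fun i hi => ?_
          have hi' : ρ i = r := (Finset.mem_filter.1 hi).2
          have e := huv i
          rw [hi'] at e
          have e' : (x i : ℝ) * u i = x r * v i := by exact_mod_cast e
          have hui : (u i : ℝ) ≠ 0 := by exact_mod_cast hu' i
          field_simp
          linear_combination (w i) * e'
        rw [this, h0, mul_zero])
      omega
  · refine ⟨fun i => ?_, h.sum_ratioSign_mul⟩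
    simp only
    exact_mod_cast huv i

/-- The ratios of bounded height, and hence the subspaces, are finite in number. -/
theorem exists_finite_subspaces {D : ℕ} (hD : 1 ≤ D) (K L : ℕ) (hL : L = K + D) :
    ∃ S : Set (Submodule ℝ (Fin (K + L) → ℝ)), S.Finite ∧
      (∀ V ∈ S, Module.finrank ℝ V ≤ 3 * D ^ 2 - 1) ∧
      ∀ (a : Fin K → ℕ) (b : Fin L → ℕ), IsIntegralFactorialRatio a b →
        ∃ V ∈ S, tuplePoint a b ∈ V := by
  classical
  set H := 2 * (K + L) ^ 2 + 2 with hH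
  set e := LinearEquiv.funCongrLeft ℝ ℝ (finSumFinEquiv (m := K) (n := L)).symm with he
  let F : (Fin K ⊕ Fin L → Fin K ⊕ Fin L) × (Fin K ⊕ Fin L → Fin (H ^ (K + L) + 1)) ×
      (Fin K ⊕ Fin L → Fin (H ^ (K + L) + 1)) → Submodule ℝ (Fin (K + L) → ℝ) := fun t =>
    (ratioSubspace (ratioSign K L) t.1 (fun i => t.2.1 i) (fun i => t.2.2 i)).map e.toLinearMap
  refine ⟨{V | V ∈ Set.range F ∧ Module.finrank ℝ V ≤ 3 * D ^ 2 - 1},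
    (Set.finite_range F).subset fun V hV => hV.1, fun V hV => hV.2, fun a b hab => ?_⟩
  obtain ⟨ρ, u, v, hu, hv, hfin, hmem⟩ := hab.exists_ratioSubspace hD hL hH
  refine ⟨F ⟨ρ, fun i => ⟨u i, Nat.lt_succ_of_le (hu i)⟩, fun i => ⟨v i, Nat.lt_succ_of_le (hv i)⟩⟩,
    ⟨⟨_, rfl⟩, ?_⟩, ?_⟩
  · exact (LinearEquiv.finrank_map_eq e _).trans_le hfin
  · refine ⟨_, hmem, ?_⟩
    ext i
    obtain ⟨i, rfl⟩ := (finSumFinEquiv (m := K) (n := L)).surjective i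
    rcases i with i | i <;>
    simp [he, tuplePoint, LinearMap.funLeft_apply]

/-- The tables give a squared norm above `12 = 3 · 2²`. -/
theorem not_isIntegralFactorialRatio_of_le (hL : L = K + 2) (hn : 82 ≤ K + L) :
    ¬ IsIntegralFactorialRatio a b := by
  intro h
  have h1 := h.norm_sq_le hL
  have h2 := isGcdGram_sawtoothVec.normBound_le h.isSignedFamily (fun i _ => h.ne_zero i)
    (Finset.card_pos.1 (by simp; omega))
  rw [Finset.card_univ, Fintype.card_sum, Fintype.card_fin, Fintype.card_fin,
    min_eq_right hn] at h2
  have h3 : (120000 : ℝ) < normBound 82 := by exact_mod_cast normBound_cutoff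
  push_cast at h1
  linarith

/-- For at least `76` terms all ratios of entries have bounded height, since otherwise the norm
would split. -/
lemma IsIntegralFactorialRatio.reachable (h : IsIntegralFactorialRatio a b) (hL : L = K + 2)
    (hn : 76 ≤ K + L) (i j : Fin K ⊕ Fin L) :
    (heightGraph (Sum.elim a b) (10 ^ 6)).Reachable i j := by
  classical
  by_contra hij
  have hn82 : K + L < 82 := by
    by_contra hlt
    exact not_isIntegralFactorialRatio_of_le hL (not_lt.1 hlt) h
  set G := heightGraph (Sum.elim a b) (10 ^ 6) with hG
  set f : Fin K ⊕ Fin L → Bool := fun k => decide (G.Reachable i k) with hf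
  have hle := h.norm_sq_fiber_le hL (H := 10 ^ 6) (by norm_num) f (by
    intro k l hkl hr
    apply hkl
    simp only [hf, decide_eq_decide]
    exact ⟨fun h => h.trans hr, fun h => h.trans hr.symm⟩)
  rw [Fintype.sum_bool] at hle
  have hfam : ∀ c, IsSignedFamily (Finset.univ.filter fun k => f k = c) (ratioSign K L)
      (Sum.elim a b) := fun c => h.isSignedFamily.mono (Finset.filter_subset _ _)
  have hne1 : (Finset.univ.filter fun k => f k = true).Nonempty :=
    ⟨i, by simp [hf]⟩
  have hne2 : (Finset.univ.filter fun k => f k = false).Nonempty :=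
    ⟨j, by simpa [hf] using hij⟩
  have b1 := isGcdGram_sawtoothVec.normBound_le (hfam true) (fun i _ => h.ne_zero i) hne1
  have b2 := isGcdGram_sawtoothVec.normBound_le (hfam false) (fun i _ => h.ne_zero i) hne2
  have hcard : (Finset.univ.filter fun k => f k = true).card +
      (Finset.univ.filter fun k => f k = false).card = K + L := by
    have := Finset.card_filter_add_card_filter_not (s := Finset.univ) (fun k => f k = true)
    simpa using this
  have p1 := hne1.card_pos
  have p2 := hne2.card_pos
  generalize (Finset.univ.filter fun k => f k = true).card = m₁ at *
  generalize (Finset.univ.filter fun k => f k = false).card = m₂ at *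
  have hb := normBound_add_normBound (m₁ - 1) (by omega) (m₂ - 1) (by omega) (by omega)
  rw [Nat.sub_add_cancel p1, Nat.sub_add_cancel p2] at hb
  rw [min_eq_left (by omega)] at b1 b2
  have hb' : (120100 : ℝ) < normBound m₁ + normBound m₂ := by exact_mod_cast hb
  have hgap : ((K + L : ℕ) : ℝ) ^ 2 / (10 ^ 6 : ℕ) ≤ 1 / 100 := by
    have h82 : ((K + L : ℕ) : ℝ) ≤ 82 := by exact_mod_cast hn82.le
    rw [div_le_iff₀ (by norm_num)]
    have h0 : (0 : ℝ) ≤ ((K + L : ℕ) : ℝ) := Nat.cast_nonneg _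
    norm_num
    norm_num at h82 h0
    nlinarith
  norm_num at hle hgap
  linarith

/-- The entries of a primitive tuple whose ratios have bounded height are bounded. -/
lemma IsIntegralFactorialRatio.le_of_isPrimitiveTuple (h : IsIntegralFactorialRatio a b)
    (hprim : IsPrimitiveTuple a b) {H : ℕ} (hH : 0 < H)
    (hr : ∀ i j, (heightGraph (Sum.elim a b) H).Reachable i j) (i : Fin K ⊕ Fin L) :
    Sum.elim a b i ≤ (H ^ (K + L)).factorial := by
  set B := H ^ (K + L) with hB
  have hcard : Fintype.card (Fin K ⊕ Fin L) = K + L := by simp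
  have hdvd : ∀ k, Sum.elim a b i ∣ Sum.elim a b k * B.factorial := by
    intro k
    obtain ⟨u, v, hu, hv, huB, hvB, huv⟩ := exists_mul_eq_mul_of_reachable hH h.ne_zero (hr k i)
    rw [hcard] at huB
    exact (Dvd.intro _ huv.symm).trans
      (Nat.mul_dvd_mul_left _ (Nat.dvd_factorial hu huB))
  have h1 : Sum.elim a b i ∣ Finset.univ.gcd a * B.factorial := by
    have := Finset.dvd_gcd (s := Finset.univ) (f := fun k => a k * B.factorial)
      fun k _ => hdvd (Sum.inl k)
    rwa [Finset.gcd_mul_right, normalize_eq] at this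
  have h2 : Sum.elim a b i ∣ Finset.univ.gcd b * B.factorial := by
    have := Finset.dvd_gcd (s := Finset.univ) (f := fun k => b k * B.factorial)
      fun k _ => hdvd (Sum.inr k)
    rwa [Finset.gcd_mul_right, normalize_eq] at this
  have h3 := Nat.dvd_gcd h1 h2
  rw [Nat.gcd_mul_right, show Nat.gcd (Finset.univ.gcd a) (Finset.univ.gcd b) = 1 from hprim,
    one_mul] at h3
  exact Nat.le_of_dvd (Nat.factorial_pos _) h3

theorem finite_setOf_isPrimitiveTuple :
    {t : Σ K : ℕ, (Fin K → ℕ) × (Fin (K + 2) → ℕ) |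
      76 ≤ t.1 + (t.1 + 2) ∧ IsIntegralFactorialRatio t.2.1 t.2.2 ∧
        IsPrimitiveTuple t.2.1 t.2.2}.Finite := by
  have hfin : ∀ K M : ℕ, {y : (Fin K → ℕ) × (Fin (K + 2) → ℕ) |
      (∀ i, y.1 i ≤ M) ∧ ∀ j, y.2 j ≤ M}.Finite := by
    intro K M
    refine ((Set.finite_Icc (0 : Fin K → ℕ) fun _ => M).prod
      (Set.finite_Icc (0 : Fin (K + 2) → ℕ) fun _ => M)).subset fun y hy => ?_
    exact ⟨⟨fun i => Nat.zero_le _, hy.1⟩, ⟨fun i => Nat.zero_le _, hy.2⟩⟩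
  refine ((Set.finite_lt_nat 40).biUnion fun K _ =>
    (hfin K ((10 ^ 6) ^ (K + (K + 2))).factorial).image (Sigma.mk K)).subset ?_
  rintro ⟨K, a, b⟩ ⟨hn, h, hprim⟩
  change 76 ≤ K + (K + 2) at hn
  have hK : K < 40 := by
    by_contra hlt
    exact not_isIntegralFactorialRatio_of_le rfl (show 82 ≤ K + (K + 2) by omega) h
  refine Set.mem_biUnion (show K ∈ {i | i < 40} from hK) ⟨(a, b), ⟨fun i => ?_, fun j => ?_⟩, rfl⟩
  · exact h.le_of_isPrimitiveTuple hprim (by norm_num) (h.reachable rfl hn) (Sum.inl i)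
  · exact h.le_of_isPrimitiveTuple hprim (by norm_num) (h.reachable rfl hn) (Sum.inr j)

end Consequences

/-! ### A lower bound for the norm of a large family -/

section WeightedClasses

variable {E : Type*} [NormedAddCommGroup E] [InnerProductSpace ℝ E] {φ : ℕ → E} {ι : Type*}

/-- The squared norm of a family is bounded below by a weighted sum of the squared norms of its
classes for the prime `p`; the weights come from a sequence of parameters `θ`. -/
lemma IsGcdGram.sum_chainCoeff_le (hφ : IsGcdGram φ) {p : ℕ} (hp : p.Prime) (s : Finset ι)
    (w : ι → ℝ) (x : ι → ℕ) (hx : ∀ i ∈ s, x i ≠ 0) {θ : ℕ → ℝ} (hθ0 : ∀ k, 0 ≤ θ k)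
    (hθ1 : ∀ k, θ k < 1) (hθp : ∀ k, 1 < θ k * (p : ℝ) ^ 2) {m : ℕ}
    (hm : ∀ i ∈ s, (x i).factorization p < m) :
    ∑ k ∈ Finset.range m, chainCoeff p (θ k) (θ (k + 1)) *
      ‖∑ i ∈ s with (x i).factorization p = k, w i • φ (ordCompl[p] (x i))‖ ^ 2 ≤
        ‖∑ i ∈ s, w i • φ (x i)‖ ^ 2 := by
  obtain ⟨U, q, hU0, hq0, hUn, hq, hv1, -, hqV⟩ := hφ.exists_chain hp s w x hx
  have hp0 : (0 : ℝ) < p := by exact_mod_cast hp.pos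
  have key : ∀ n, ∑ k ∈ Finset.range n, chainCoeff p (θ k) (θ (k + 1)) *
      ‖∑ i ∈ s with (x i).factorization p = k, w i • φ (ordCompl[p] (x i))‖ ^ 2 ≤
        q n - θ n * U n ^ 2 := by
    intro n
    induction n with
    | zero => simp [hU0, hq0]
    | succ n ih =>
      rw [Finset.sum_range_succ]
      exact (add_le_add_left ih _).trans (chain_step hp0 le_rfl (hUn n) (norm_nonneg _)
        (hθ1 _) (hθp _) (hq n) (hv1 n))
  refine (key m).trans ?_
  rw [hqV, Finset.filter_true_of_mem hm]
  nlinarith [hθ0 m, sq_nonneg (U m), mul_nonneg (hθ0 m) (sq_nonneg (U m))]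

/-- The weight of a class is at least `1 - θ - δ` if the parameter `θ'` before it is not too small.
-/
lemma one_sub_sub_le_chainCoeff {P θ θ' δ : ℝ} (hθ0 : 0 ≤ θ) (hθ : θ < 1)
    (hδ : 0 < δ) (hθ' : 1 / δ ≤ θ' * P ^ 2 - 1) : 1 - θ - δ ≤ chainCoeff P θ' θ := by
  rw [chainCoeff]
  set α := 1 - θ
  set β := θ' * P ^ 2 - 1
  have hα : 0 < α := by simp only [α]; linarith
  have hα1 : α ≤ 1 := by simp only [α]; linarith
  have hβ : 1 ≤ δ * β := by
    rw [div_le_iff₀ hδ] at hθ'; linarith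
  have hβ0 : 0 < β := by by_contra h; nlinarith
  rw [le_div_iff₀ (by linarith)]
  nlinarith

/-- For `θ = 1 / p` all classes get the weight `(p - 1) / (p + 1)`. -/
lemma IsGcdGram.sum_norm_sq_class_le (hφ : IsGcdGram φ) {p : ℕ} (hp : p.Prime) (s : Finset ι)
    (w : ι → ℝ) (x : ι → ℕ) (hx : ∀ i ∈ s, x i ≠ 0) {m : ℕ}
    (hm : ∀ i ∈ s, (x i).factorization p < m) :
    ((p : ℝ) - 1) / (p + 1) * ∑ k ∈ Finset.range m,
      ‖∑ i ∈ s with (x i).factorization p = k, w i • φ (ordCompl[p] (x i))‖ ^ 2 ≤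
        ‖∑ i ∈ s, w i • φ (x i)‖ ^ 2 := by
  have hp1 : (1 : ℝ) < p := by exact_mod_cast hp.one_lt
  have hp0 : (0 : ℝ) < p := by linarith
  have e : (1 / p : ℝ) * p ^ 2 = p := by field_simp
  have h := hφ.sum_chainCoeff_le hp s w x hx (θ := fun _ => 1 / p) (fun _ => by positivity)
    (fun _ => by rw [div_lt_one hp0]; exact hp1) (fun _ => by rw [e]; exact hp1) hm
  have hc : chainCoeff p (1 / p) (1 / p) = ((p : ℝ) - 1) / (p + 1) := by
    rw [chainCoeff, e, div_eq_div_iff]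
    · field_simp; ring
    · have : (1 : ℝ) / p < 1 := by rw [div_lt_one hp0]; exact hp1
      linarith
    · linarith
  rw [Finset.mul_sum]
  simpa only [hc] using h

/-- For a large prime, one class `j` can be given a weight very close to `1` if the others get the
weight `1 - 2 ε`. This is achieved by lowering `θ` right after the class `j`. -/
lemma IsGcdGram.norm_sq_distinguished_class_le (hφ : IsGcdGram φ) {p : ℕ} (hp : p.Prime)
    (s : Finset ι) (w : ι → ℝ) (x : ι → ℕ) (hx : ∀ i ∈ s, x i ≠ 0) {ε : ℝ} (hε : 0 < ε)
    (hε1 : ε ≤ 1 / 2) (hεp : 2 ≤ ε ^ 2 * (p : ℝ) ^ 2) {m : ℕ}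
    (hm : ∀ i ∈ s, (x i).factorization p < m) (j : ℕ) :
    ∑ k ∈ Finset.range m, (if k = j then 1 - 4 / (ε * (p : ℝ) ^ 2) else 1 - 2 * ε) *
      ‖∑ i ∈ s with (x i).factorization p = k, w i • φ (ordCompl[p] (x i))‖ ^ 2 ≤
        ‖∑ i ∈ s, w i • φ (x i)‖ ^ 2 := by
  have hp0 : (0 : ℝ) < p := by exact_mod_cast hp.pos
  set P2 : ℝ := (p : ℝ) ^ 2 with hP2
  have hP2pos : 0 < P2 := by positivity
  have hεP : 2 / ε ≤ ε * P2 := by rw [div_le_iff₀ hε]; nlinarith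
  have h4 : 4 ≤ 2 / ε := by rw [le_div_iff₀ hε]; linarith
  set b : ℝ := (1 + 1 / ε) / P2 with hb
  have hbP : b * P2 = 1 + 1 / ε := by rw [hb]; field_simp
  have hb2 : b ≤ 2 / (ε * P2) := by
    rw [hb, div_le_div_iff₀ hP2pos (by positivity)]
    have : (1 + 1 / ε) * (ε * P2) = (ε + 1) * P2 := by field_simp
    rw [this]; nlinarith
  have hq : 2 / (ε * P2) ≤ ε := by
    rw [div_le_iff₀ (by positivity)]; nlinarith
  have hb0 : 0 < b := by positivity
  have hbε : b ≤ ε := hb2.trans hq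
  refine le_trans ?_ (hφ.sum_chainCoeff_le hp s w x hx
    (θ := fun k => if k = j + 1 then b else ε) (fun k => ?_) (fun k => ?_) (fun k => ?_) hm)
  · refine Finset.sum_le_sum fun k _ => mul_le_mul_of_nonneg_right ?_ (sq_nonneg _)
    have hδ : 1 / (2 / (ε * P2)) ≤ ε * P2 - 1 := by
      rw [one_div_div]; linarith
    have hδ0 : 0 < 2 / (ε * P2) := by positivity
    rcases eq_or_ne k j with rfl | hkj
    · have := one_sub_sub_le_chainCoeff (P := p) (θ := b) (θ' := ε) hb0.le (by linarith) hδ0 hδ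
      simp only [if_true, show k ≠ k + 1 by omega, if_false]
      refine le_trans ?_ this
      have : 4 / (ε * P2) = 2 / (ε * P2) + 2 / (ε * P2) := by ring
      linarith
    · rw [if_neg hkj, if_neg (show k + 1 ≠ j + 1 by omega)]
      rcases eq_or_ne k (j + 1) with rfl | hkj'
      · rw [if_pos rfl]
        have := one_sub_sub_le_chainCoeff (P := p) (θ := ε) (θ' := b) (δ := ε) hε.le
          (by linarith) hε (by rw [hbP]; linarith)
        linarith
      · rw [if_neg hkj']
        have := one_sub_sub_le_chainCoeff (P := p) (θ := ε) (θ' := ε) hε.le (by linarith) hδ0 hδ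
        linarith
  · split_ifs <;> positivity
  · split_ifs <;> linarith
  · have : 0 < 1 / ε := by positivity
    split_ifs
    · rw [hbP]; linarith
    · linarith

/-- The loss at the prime `p` in the lower bound for the norm: the spectral bound
`(p - 1) / (p + 1)` for `p < y`, and `1 - 4 / (ε p²)` for the large primes, where the largest class
is distinguished. -/
noncomputable def primeLoss (y : ℕ) (ε : ℝ) (p : ℕ) : ℝ :=
  if p < y then ((p : ℝ) - 1) / (p + 1) else 1 - 4 / (ε * (p : ℝ) ^ 2)

lemma sum_card_filter_factorization (s : Finset ι) (x : ι → ℕ) (p : ℕ) {m : ℕ}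
    (hm : ∀ i ∈ s, (x i).factorization p < m) :
    ∑ k ∈ Finset.range m, ((s.filter fun i => (x i).factorization p = k).card : ℝ) = s.card := by
  rw [Finset.card_eq_sum_card_fiberwise (f := fun i => (x i).factorization p)
    (t := Finset.range m) (fun i hi => by simpa using hm i hi)]
  push_cast
  rfl

/-- All classes of a large prime but the largest have at most half of the elements, so that every
element suffers the loss `1 - 2 ε` at most `log₂` of the size times. -/
lemma IsGcdGram.card_mul_le_norm_sq_of_smooth (hφ : IsGcdGram φ) {y : ℕ} {ε : ℝ} (hε : 0 < ε)
    (hε1 : ε ≤ 1 / 4) (hy : 2 ≤ ε * y) (z : ℕ) (s : Finset ι) (w : ι → ℝ) (x : ι → ℕ)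
    (hs : IsSignedFamily s w x) (hx : ∀ i ∈ s, x i ∈ Nat.smoothNumbers z) :
    (∏ p ∈ Nat.primesBelow z, primeLoss y ε p) * (1 - 2 * ε) ^ Nat.log 2 s.card * s.card ≤
      ‖∑ i ∈ s, w i • φ (x i)‖ ^ 2 := by
  have hloss : ∀ p : ℕ, p.Prime → 0 ≤ primeLoss y ε p ∧ primeLoss y ε p ≤ 1 := by
    intro p hp
    have hp1 : (1 : ℝ) < p := by exact_mod_cast hp.one_lt
    rw [primeLoss]
    split_ifs with h
    · exact ⟨div_nonneg (by linarith) (by linarith), by rw [div_le_one (by linarith)]; linarith⟩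
    · have hyp : (y : ℝ) ≤ p := by exact_mod_cast not_lt.1 h
      have : 2 ≤ ε * p := hy.trans (by gcongr)
      have h2 : 0 ≤ 4 / (ε * (p : ℝ) ^ 2) := by positivity
      have h3 : 4 / (ε * (p : ℝ) ^ 2) ≤ 1 := by
        rw [div_le_one (by positivity)]
        nlinarith
      constructor <;> linarith
  have hW : ∀ z, 0 ≤ ∏ p ∈ Nat.primesBelow z, primeLoss y ε p := fun z =>
    Finset.prod_nonneg fun p hp => (hloss p (Nat.prime_of_mem_primesBelow hp)).1
  have hr0 : 0 ≤ 1 - 2 * ε := by linarith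
  have hr1 : 1 - 2 * ε ≤ 1 := by linarith
  induction z generalizing s x with
  | zero =>
    have hx1 : ∀ i ∈ s, x i = 1 := by
      intro i hi
      have := hx i hi
      rwa [Nat.smoothNumbers_zero] at this
    rw [hφ.norm_sq_sum_of_forall_eq_one hs hx1]
    have hc : (s.card : ℝ) ≤ (s.card : ℝ) ^ 2 := by exact_mod_cast Nat.le_self_pow two_ne_zero _
    have h1 := pow_le_one₀ hr0 hr1 (n := Nat.log 2 s.card)
    simp only [show Nat.primesBelow 0 = ∅ from rfl, Finset.prod_empty, one_mul]
    exact (mul_le_of_le_one_left (Nat.cast_nonneg _) h1).trans hc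
  | succ p ih =>
    by_cases hp : p.Prime
    · rw [Nat.primesBelow_succ, if_pos hp, Finset.prod_insert (by simp [Nat.primesBelow])]
      have hx0 : ∀ i ∈ s, x i ≠ 0 := fun i hi => Nat.ne_zero_of_mem_smoothNumbers (hx i hi)
      obtain ⟨m, hm⟩ : ∃ m, ∀ i ∈ s, (x i).factorization p < m :=
        ⟨s.sup (fun i => (x i).factorization p) + 1, fun i hi =>
          Nat.lt_succ_of_le (Finset.le_sup (f := fun i => (x i).factorization p) hi)⟩
      set c : ℕ → ℕ := fun k => (s.filter fun i => (x i).factorization p = k).card with hc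
      have hcs : ∀ k, c k ≤ s.card := fun k => Finset.card_filter_le _ _
      have hsumc : ∑ k ∈ Finset.range m, (c k : ℝ) = s.card :=
        sum_card_filter_factorization s x p hm
      set A : ℝ := ∏ p ∈ Nat.primesBelow p, primeLoss y ε p with hA
      have hA0 : 0 ≤ A := hW p
      set Q : ℕ → ℝ := fun k =>
        ‖∑ i ∈ s with (x i).factorization p = k, w i • φ (ordCompl[p] (x i))‖ ^ 2 with hQ
      have hQk : ∀ k, A * (1 - 2 * ε) ^ Nat.log 2 (c k) * c k ≤ Q k := fun k =>
        ih _ _ (hs.ordCompl p k) fun i hi =>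
          ordCompl_mem_smoothNumbers hp (hx i (Finset.mem_of_mem_filter i hi))
      have hmono : ∀ {a b : ℕ}, a ≤ b → (1 - 2 * ε) ^ b ≤ (1 - 2 * ε) ^ a := fun h =>
        pow_le_pow_of_le_one hr0 hr1 h
      set l := Nat.log 2 s.card with hl
      by_cases hpy : p < y
      · have h := hφ.sum_norm_sq_class_le hp s w x hx0 hm
        refine le_trans ?_ h
        rw [primeLoss, if_pos hpy, mul_assoc, mul_assoc]
        refine mul_le_mul_of_nonneg_left ?_ ?_
        · rw [← hsumc, Finset.mul_sum, Finset.mul_sum]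
          refine Finset.sum_le_sum fun k _ => le_trans ?_ (hQk k)
          rw [← mul_assoc]
          have := hmono (Nat.log_mono_right (b := 2) (hcs k))
          gcongr
        · have hp1 : (1 : ℝ) < p := by exact_mod_cast hp.one_lt
          exact div_nonneg (by linarith) (by linarith)
      · -- distinguish the largest class
        obtain ⟨j, hj⟩ : ∃ j, ∀ k ∈ Finset.range m, c k ≤ c j := by
          rcases (Finset.range m).eq_empty_or_nonempty with he | hne
          · exact ⟨0, by simp [he]⟩
          · obtain ⟨j, -, hj⟩ := Finset.exists_max_image (Finset.range m) c hne
            exact ⟨j, hj⟩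
        have hyp : (y : ℝ) ≤ p := by exact_mod_cast not_lt.1 hpy
        have h2 : 2 ≤ ε * p := hy.trans (by gcongr)
        have h := hφ.norm_sq_distinguished_class_le hp s w x hx0 hε (by linarith)
          (by nlinarith) hm j
        refine le_trans ?_ h
        have hlp := hloss p hp
        rw [mul_assoc, mul_assoc, ← hsumc, Finset.mul_sum, Finset.mul_sum, Finset.mul_sum]
        refine Finset.sum_le_sum fun k hk => ?_
        have hd : primeLoss y ε p = 1 - 4 / (ε * (p : ℝ) ^ 2) := by rw [primeLoss, if_neg hpy]
        have hck : (0 : ℝ) ≤ c k := Nat.cast_nonneg _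
        rcases eq_or_ne k j with rfl | hkj
        · rw [if_pos rfl, ← hd]
          refine mul_le_mul_of_nonneg_left (le_trans ?_ (hQk k)) hlp.1
          rw [← mul_assoc]
          have := hmono (Nat.log_mono_right (b := 2) (hcs k))
          gcongr
        · rw [if_neg hkj]
          rcases Nat.eq_zero_or_pos (c k) with h0 | h0
          · rw [h0]
            simp only [Nat.cast_zero, mul_zero]
            exact mul_nonneg hr0 (sq_nonneg _)
          · have hhalf : 2 * c k ≤ s.card := by
              have hdisj : Disjoint (s.filter fun i => (x i).factorization p = k)
                  (s.filter fun i => (x i).factorization p = j) := by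
                rw [Finset.disjoint_filter]; intro i _ h1 h2; exact hkj (h1.symm.trans h2)
              classical
              have := Finset.card_union_of_disjoint hdisj
              have h3 := Finset.card_le_card (Finset.union_subset
                (Finset.filter_subset (fun i => (x i).factorization p = k) s)
                (Finset.filter_subset (fun i => (x i).factorization p = j) s))
              have h4 := hj k hk
              simp only [hc] at h4 ⊢
              omega
            have hlog : Nat.log 2 (c k) + 1 ≤ l := by
              rw [hl, ← Nat.log_mul_base one_lt_two h0.ne']
              exact Nat.log_mono_right (by omega)
            have h5 := hmono hlog
            calc primeLoss y ε p * (A * ((1 - 2 * ε) ^ l * c k))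
                ≤ 1 * (A * ((1 - 2 * ε) ^ l * c k)) := by
                  refine mul_le_mul_of_nonneg_right hlp.2 ?_
                  have := pow_nonneg hr0 l
                  positivity
              _ ≤ 1 * (A * ((1 - 2 * ε) ^ (Nat.log 2 (c k) + 1) * c k)) := by gcongr
              _ = (1 - 2 * ε) * (A * (1 - 2 * ε) ^ Nat.log 2 (c k) * c k) := by ring
              _ ≤ _ := mul_le_mul_of_nonneg_left (hQk k) hr0
    · rw [Nat.primesBelow_succ, if_neg hp]
      rw [Nat.smoothNumbers_succ hp] at hx
      exact ih s x hs hx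

lemma one_sub_sum_le_prod_one_sub {κ : Type*} (s : Finset κ) (f : κ → ℝ) (h0 : ∀ i ∈ s, 0 ≤ f i)
    (h1 : ∀ i ∈ s, f i ≤ 1) : 1 - ∑ i ∈ s, f i ≤ ∏ i ∈ s, (1 - f i) := by
  classical
  induction s using Finset.induction_on with
  | empty => simp
  | insert a s ha ih =>
    rw [Finset.sum_insert ha, Finset.prod_insert ha]
    have h2 := ih (fun i hi => h0 i (Finset.mem_insert_of_mem hi))
      fun i hi => h1 i (Finset.mem_insert_of_mem hi)
    have h3 := h0 a (Finset.mem_insert_self a s)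
    have h4 := h1 a (Finset.mem_insert_self a s)
    have h5 : 0 ≤ ∑ i ∈ s, f i := Finset.sum_nonneg fun i hi => h0 i (Finset.mem_insert_of_mem hi)
    nlinarith [mul_le_mul_of_nonneg_left h2 (sub_nonneg.2 h4), mul_nonneg h3 h5]

/-- The lower bound for the squared norm of a signed family of `n` integers, with a cut-off `y` for
the primes that are treated by the spectral bound. -/
theorem IsGcdGram.card_mul_prod_le_norm_sq (hφ : IsGcdGram φ) {y : ℕ} {ε : ℝ} (hε : 0 < ε)
    (hε1 : ε ≤ 1 / 4) (hy : 8 ≤ ε * y) {s : Finset ι} {w : ι → ℝ} {x : ι → ℕ}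
    (hs : IsSignedFamily s w x) (hx : ∀ i ∈ s, x i ≠ 0) (hlog : 2 * ε * Nat.log 2 s.card ≤ 1) :
    s.card * (∏ p ∈ Nat.primesBelow y, ((p : ℝ) - 1) / (p + 1)) *
      ((1 - 8 / (ε * y)) * (1 - 2 * ε * Nat.log 2 s.card)) ≤ ‖∑ i ∈ s, w i • φ (x i)‖ ^ 2 := by
  have hy0 : (0 : ℝ) < y := by by_contra h; nlinarith
  have hy1 : 0 < y := by exact_mod_cast hy0
  set z := max y (s.sup x + 1) with hz
  have hsm : ∀ i ∈ s, x i ∈ Nat.smoothNumbers z := fun i hi =>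
    Nat.mem_smoothNumbers_of_lt (Nat.pos_of_ne_zero (hx i hi))
      (lt_of_lt_of_le (Nat.lt_succ_of_le (Finset.le_sup (f := x) hi)) (le_max_right _ _))
  refine le_trans ?_ (hφ.card_mul_le_norm_sq_of_smooth (y := y) hε hε1 (by linarith) z s w x hs hsm)
  have hsplit : ∏ p ∈ Nat.primesBelow z, primeLoss y ε p =
      (∏ p ∈ Nat.primesBelow y, ((p : ℝ) - 1) / (p + 1)) *
        ∏ p ∈ (Nat.primesBelow z).filter (fun p => ¬ p < y), (1 - 4 / (ε * (p : ℝ) ^ 2)) := by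
    rw [← Finset.prod_filter_mul_prod_filter_not (Nat.primesBelow z) (fun p => p < y)]
    congr 1
    · refine Finset.prod_congr ?_ fun p hp => ?_
      · ext p
        simp only [Nat.primesBelow, Finset.mem_filter, Finset.mem_range, hz]
        constructor
        · rintro ⟨⟨-, h1⟩, h2⟩; exact ⟨h2, h1⟩
        · rintro ⟨h1, h2⟩; exact ⟨⟨lt_of_lt_of_le h1 (le_max_left _ _), h2⟩, h1⟩
      · rw [primeLoss, if_pos]
        simp only [Nat.primesBelow, Finset.mem_filter, Finset.mem_range] at hp
        exact hp.1
    · exact Finset.prod_congr rfl fun p hp => by rw [primeLoss, if_neg (Finset.mem_filter.1 hp).2]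
  have htail : 1 - 8 / (ε * y) ≤
      ∏ p ∈ (Nat.primesBelow z).filter (fun p => ¬ p < y), (1 - 4 / (ε * (p : ℝ) ^ 2)) := by
    refine le_trans ?_ (one_sub_sum_le_prod_one_sub _ _ (fun p _ => by positivity) fun p hp => ?_)
    · refine sub_le_sub_left ?_ 1
      have hsub : (Nat.primesBelow z).filter (fun p => ¬ p < y) ⊆ Finset.Ioo (y - 1) z := by
        intro p hp
        simp only [Nat.primesBelow, Finset.mem_filter, Finset.mem_range, Finset.mem_Ioo] at hp ⊢
        omega
      calc ∑ p ∈ (Nat.primesBelow z).filter (fun p => ¬ p < y), 4 / (ε * (p : ℝ) ^ 2)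
          ≤ ∑ p ∈ Finset.Ioo (y - 1) z, 4 / (ε * (p : ℝ) ^ 2) :=
            Finset.sum_le_sum_of_subset_of_nonneg hsub fun p _ _ => by positivity
        _ = 4 / ε * ∑ p ∈ Finset.Ioo (y - 1) z, ((p : ℝ) ^ 2)⁻¹ := by
            rw [Finset.mul_sum]
            exact Finset.sum_congr rfl fun p _ => by rw [div_mul_eq_div_div, div_eq_mul_inv]
        _ ≤ 4 / ε * (2 / ((y - 1 : ℕ) + 1)) := by
            gcongr
            exact sum_Ioo_inv_sq_le (y - 1) z
        _ = 8 / (ε * y) := by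
            rw [Nat.cast_sub hy1]; push_cast; rw [sub_add_cancel]; field_simp; norm_num
    · have hp' : (y : ℝ) ≤ p := by exact_mod_cast not_lt.1 (Finset.mem_filter.1 hp).2
      rw [div_le_one (by have : (0 : ℝ) < p := by linarith
                         positivity)]
      have : 8 ≤ ε * p := hy.trans (by gcongr)
      have h1 : (1 : ℝ) ≤ p := le_trans (by exact_mod_cast hy1) hp'
      nlinarith
  have hpow : 1 - 2 * ε * Nat.log 2 s.card ≤ (1 - 2 * ε) ^ Nat.log 2 s.card := by
    have := one_add_mul_le_pow (a := -(2 * ε)) (by linarith) (Nat.log 2 s.card)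
    rw [← sub_eq_add_neg] at this
    linarith
  have hA : 0 ≤ ∏ p ∈ Nat.primesBelow y, ((p : ℝ) - 1) / (p + 1) := by
    refine Finset.prod_nonneg fun p hp => ?_
    have hp1 : (1 : ℝ) < p := by exact_mod_cast (Nat.prime_of_mem_primesBelow hp).one_lt
    exact div_nonneg (by linarith) (by linarith)
  have h8 : 0 ≤ 1 - 8 / (ε * y) := by
    rw [sub_nonneg, div_le_one (by positivity)]; exact hy
  rw [hsplit]
  calc s.card * (∏ p ∈ Nat.primesBelow y, ((p : ℝ) - 1) / (p + 1)) *
      ((1 - 8 / (ε * y)) * (1 - 2 * ε * Nat.log 2 s.card))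
      ≤ s.card * (∏ p ∈ Nat.primesBelow y, ((p : ℝ) - 1) / (p + 1)) *
        ((∏ p ∈ (Nat.primesBelow z).filter (fun p => ¬ p < y), (1 - 4 / (ε * (p : ℝ) ^ 2))) *
          (1 - 2 * ε) ^ Nat.log 2 s.card) := by
        refine mul_le_mul_of_nonneg_left ?_ (mul_nonneg (Nat.cast_nonneg _) hA)
        exact mul_le_mul htail hpow (by linarith) (h8.trans htail)
    _ = _ := by ring

end WeightedClasses

/-! ### Mertens' theorems -/

section Mertens

open ArithmeticFunction Filter Topology

/-- Legendre's formula for `N!`, in terms of the von Mangoldt function. -/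
lemma sum_vonMangoldt_mul_div_eq_log_factorial (N : ℕ) :
    ∑ n ∈ Finset.Ioc 0 N, Λ n * ((N / n : ℕ) : ℝ) = Real.log (N.factorial) := by
  have h := sum_Ioc_mul_zeta_eq_sum (R := ℝ) Λ N
  rw [vonMangoldt_mul_zeta] at h
  rw [← h]
  simp only [log_apply]
  induction N with
  | zero => simp
  | succ n ih =>
    rw [← Finset.insert_Ioc_right_eq_Ioc_add_one (Nat.zero_le n), Finset.sum_insert (by simp),
      Nat.factorial_succ, Nat.cast_mul, Real.log_mul (by positivity) (by positivity),
      ih (by rw [← sum_Ioc_mul_zeta_eq_sum, vonMangoldt_mul_zeta])]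

/-- Mertens' first theorem. -/
lemma abs_sum_vonMangoldt_div_sub_log_le {N : ℕ} (hN : N ≠ 0) :
    |∑ n ∈ Finset.Ioc 0 N, Λ n / n - Real.log N| ≤ Real.log 4 + 4 := by
  have hN0 : (0 : ℝ) < N := by exact_mod_cast Nat.pos_of_ne_zero hN
  have hlog4 : 0 ≤ Real.log 4 := Real.log_nonneg (by norm_num)
  have hS : N * ∑ n ∈ Finset.Ioc 0 N, Λ n / n = ∑ n ∈ Finset.Ioc 0 N, Λ n * ((N : ℝ) / n) := by
    rw [Finset.mul_sum]
    exact Finset.sum_congr rfl fun n _ => by ring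
  have hpsi : ∑ n ∈ Finset.Ioc 0 N, Λ n ≤ (Real.log 4 + 4) * N := by
    simpa [Chebyshev.psi] using Chebyshev.psi_le_const_mul_self hN0.le
  have hfac := sum_vonMangoldt_mul_div_eq_log_factorial N
  have hup : ∑ n ∈ Finset.Ioc 0 N, Λ n * ((N : ℝ) / n) ≤
      Real.log N.factorial + (Real.log 4 + 4) * N := by
    rw [← hfac]
    refine le_trans ?_ (add_le_add_right hpsi _)
    rw [← Finset.sum_add_distrib]
    refine Finset.sum_le_sum fun n hn => ?_
    rw [← mul_add_one]
    refine mul_le_mul_of_nonneg_left ?_ vonMangoldt_nonneg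
    rw [← Nat.floor_div_eq_div (K := ℝ)]
    exact (Nat.lt_floor_add_one _).le
  have hlow : Real.log N.factorial ≤ ∑ n ∈ Finset.Ioc 0 N, Λ n * ((N : ℝ) / n) := by
    rw [← hfac]
    exact Finset.sum_le_sum fun n _ =>
      mul_le_mul_of_nonneg_left Nat.cast_div_le vonMangoldt_nonneg
  have h1 : Real.log N.factorial ≤ N * Real.log N := by
    rw [← Real.log_pow]
    exact Real.log_le_log (by positivity) (by exact_mod_cast Nat.factorial_le_pow N)
  have h2 : N * Real.log N - N ≤ Real.log N.factorial := by
    have h := Stirling.le_log_factorial_stirling hN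
    have h3 : 0 ≤ Real.log N := Real.log_natCast_nonneg N
    have h4 : 0 ≤ Real.log (2 * Real.pi) :=
      Real.log_nonneg (by linarith [Real.pi_gt_three])
    linarith
  rw [← hS] at hup hlow
  rw [abs_le]
  constructor
  · refine le_of_mul_le_mul_left ?_ hN0
    nlinarith
  · refine le_of_mul_le_mul_left ?_ hN0
    nlinarith

lemma sum_range_sum_Ico_two_pow (f : ℕ → ℝ) (K : ℕ) :
    ∑ k ∈ Finset.range K, ∑ n ∈ Finset.Ico (2 ^ k) (2 ^ (k + 1)), f n =
      ∑ n ∈ Finset.Ico 1 (2 ^ K), f n := by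
  induction K with
  | zero => simp
  | succ K ih =>
    rw [Finset.sum_range_succ, ih, Finset.sum_Ico_consecutive _ Nat.one_le_two_pow
      (Nat.pow_le_pow_right two_pos K.le_succ)]

lemma abs_sum_vonMangoldt_div_sub_mul_log_two_le (K : ℕ) :
    |∑ n ∈ Finset.Ico 1 (2 ^ K), Λ n / n - K * Real.log 2| ≤ Real.log 4 + 4 + Real.log 2 := by
  have hlog4 : 0 ≤ Real.log 4 := Real.log_nonneg (by norm_num)
  have hlog2 : 0 ≤ Real.log 2 := Real.log_nonneg (by norm_num)
  rcases K.eq_zero_or_pos with rfl | hK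
  · simp only [pow_zero, Finset.Ico_self, Finset.sum_empty, Nat.cast_zero, zero_mul, sub_zero,
      abs_zero]
    linarith
  · have h2K : 2 ≤ 2 ^ K := by simpa using Nat.pow_le_pow_right two_pos hK
    have h := abs_sum_vonMangoldt_div_sub_log_le (N := 2 ^ K - 1) (by omega)
    have hI : Finset.Ioc 0 (2 ^ K - 1) = Finset.Ico 1 (2 ^ K) := by
      ext n; simp only [Finset.mem_Ioc, Finset.mem_Ico]; omega
    rw [hI] at h
    have h1 : Real.log ((2 ^ K - 1 : ℕ) : ℝ) ≤ K * Real.log 2 := by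
      rw [← Real.log_pow]
      refine Real.log_le_log (by exact_mod_cast (by omega : 0 < 2 ^ K - 1)) ?_
      exact_mod_cast Nat.sub_le _ _
    have h2 : K * Real.log 2 ≤ Real.log ((2 ^ K - 1 : ℕ) : ℝ) + Real.log 2 := by
      rw [← Real.log_pow, ← Real.log_mul (by exact_mod_cast (by omega : 2 ^ K - 1 ≠ 0))
        two_ne_zero]
      refine Real.log_le_log (by positivity) ?_
      exact_mod_cast (by omega : 2 ^ K ≤ (2 ^ K - 1) * 2)
    rw [abs_le] at h ⊢
    constructor <;> linarith [h.1, h.2]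

/-- The contribution of the dyadic block `[2 ^ k, 2 ^ (k + 1))` to the Dirichlet series of
`log ζ` at `1`. -/
noncomputable def dyadicLogZeta (k : ℕ) : ℝ :=
  ∑ n ∈ Finset.Ico (2 ^ k) (2 ^ (k + 1)), Λ n / (n * Real.log n)

lemma log_mem_of_mem_Ico_two_pow {k n : ℕ} (hn : n ∈ Finset.Ico (2 ^ k) (2 ^ (k + 1))) :
    k * Real.log 2 ≤ Real.log n ∧ Real.log n ≤ (k + 1 : ℕ) * Real.log 2 := by
  rw [Finset.mem_Ico] at hn
  have h0 : 0 < n := lt_of_lt_of_le (by positivity) hn.1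
  rw [← Real.log_pow, ← Real.log_pow]
  exact ⟨Real.log_le_log (by positivity) (by exact_mod_cast hn.1),
    Real.log_le_log (by positivity) (by exact_mod_cast hn.2.le)⟩

/-- Mertens' second theorem in dyadic form, without the value of the constant: the dyadic pieces
of `∑ Λ n / (n log n)` are so close to `1 / (k + 1)` that the differences have a convergent sum. -/
lemma exists_tendsto_sum_dyadicLogZeta_sub :
    ∃ l, Tendsto (fun K => ∑ k ∈ Finset.range K, (dyadicLogZeta k - 1 / ((k : ℝ) + 1))) atTop
      (𝓝 l) := by
  have hlog2 : 0 < Real.log 2 := Real.log_pos (by norm_num)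
  set B := Real.log 4 + 4 + Real.log 2 with hB
  set m : ℕ → ℝ := fun k => ∑ n ∈ Finset.Ico (2 ^ k) (2 ^ (k + 1)), Λ n / n with hm
  have hmB : ∀ K : ℕ, |∑ k ∈ Finset.range K, m k - K * Real.log 2| ≤ B := fun K => by
    rw [hm, sum_range_sum_Ico_two_pow (fun n => Λ n / n)]
    exact abs_sum_vonMangoldt_div_sub_mul_log_two_le K
  have hm0 : ∀ k, 0 ≤ m k := fun k =>
    Finset.sum_nonneg fun n _ => div_nonneg vonMangoldt_nonneg (Nat.cast_nonneg n)
  have hmle : ∀ k, m k ≤ 2 * B + Real.log 2 := fun k => by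
    have h1 := (abs_le.1 (hmB k)).1
    have h2 := (abs_le.1 (hmB (k + 1))).2
    rw [Finset.sum_range_succ] at h2
    push_cast at h2
    linarith
  have hanti : Antitone fun k : ℕ => 1 / ((k : ℝ) + 1) := fun a b hab => by
    dsimp only; gcongr
  -- Dirichlet's test: the partial sums of `m k / log 2 - 1` are bounded by Mertens' first theorem
  have hcauchy := hanti.cauchySeq_series_mul_of_tendsto_zero_of_bounded
    tendsto_one_div_add_atTop_nhds_zero_nat (z := fun k => m k / Real.log 2 - 1)
    (b := B / Real.log 2) fun K => by
      rw [Finset.sum_sub_distrib, ← Finset.sum_div]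
      simp only [Finset.sum_const, Finset.card_range, nsmul_eq_mul, mul_one]
      rw [Real.norm_eq_abs, div_sub' hlog2.ne', abs_div, abs_of_pos hlog2, mul_comm (Real.log 2)]
      gcongr
      exact hmB K
  obtain ⟨l₁, hl₁⟩ := cauchySeq_tendsto_of_complete hcauchy
  -- replacing `log n` by `(k + 1) log 2` on the `k`-th block costs `O(1 / (k + 1) ^ 2)`
  have hr : ∀ k, 0 ≤ dyadicLogZeta k - m k / ((k + 1) * Real.log 2) ∧
      dyadicLogZeta k - m k / ((k + 1) * Real.log 2) ≤
        2 * (2 * B + Real.log 2) / Real.log 2 * (1 / ((k + 1 : ℕ) : ℝ) ^ 2) := fun k => by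
    rcases k.eq_zero_or_pos with rfl | hk
    · have : 0 ≤ B := (abs_nonneg _).trans (hmB 0)
      simp only [dyadicLogZeta, hm, zero_add, pow_zero, pow_one, Nat.Ico_succ_singleton,
        Finset.sum_singleton, vonMangoldt_apply_one, zero_div, sub_zero, le_refl, true_and]
      positivity
    have hk0 : (0 : ℝ) < k := by exact_mod_cast hk
    have hd : dyadicLogZeta k - m k / ((k + 1) * Real.log 2) =
        ∑ n ∈ Finset.Ico (2 ^ k) (2 ^ (k + 1)),
          Λ n / n * (1 / Real.log n - 1 / ((k + 1) * Real.log 2)) := by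
      rw [dyadicLogZeta, hm, Finset.sum_div, ← Finset.sum_sub_distrib]
      refine Finset.sum_congr rfl fun n _ => ?_
      rw [mul_sub, div_mul_div_comm, mul_one, div_mul_div_comm, mul_one, div_div]
    rw [hd]
    constructor
    · refine Finset.sum_nonneg fun n hn => mul_nonneg
        (div_nonneg vonMangoldt_nonneg (Nat.cast_nonneg n)) (sub_nonneg.2 ?_)
      have h := log_mem_of_mem_Ico_two_pow hn
      push_cast at h
      exact one_div_le_one_div_of_le (lt_of_lt_of_le (by positivity) h.1) h.2
    · calc _ ≤ ∑ n ∈ Finset.Ico (2 ^ k) (2 ^ (k + 1)),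
          Λ n / n * (2 / Real.log 2 * (1 / ((k + 1 : ℕ) : ℝ) ^ 2)) := by
            refine Finset.sum_le_sum fun n hn => mul_le_mul_of_nonneg_left ?_
              (div_nonneg vonMangoldt_nonneg (Nat.cast_nonneg n))
            have h := (log_mem_of_mem_Ico_two_pow hn).1
            have h1 : 1 / Real.log n ≤ 1 / (k * Real.log 2) :=
              one_div_le_one_div_of_le (by positivity) h
            have h2 : 1 / (k * Real.log 2) - 1 / ((k + 1) * Real.log 2) ≤
                2 / Real.log 2 * (1 / ((k + 1 : ℕ) : ℝ) ^ 2) := by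
              push_cast
              have h3 : 1 / (k * Real.log 2) - 1 / ((k + 1) * Real.log 2) =
                1 / (k * (k + 1) * Real.log 2) := by field_simp; ring
              rw [h3, div_mul_div_comm, div_le_div_iff₀ (by positivity) (by positivity)]
              have h4 : (1 : ℝ) ≤ k := by exact_mod_cast hk
              have h5 : ((k : ℝ) + 1) ^ 2 ≤ 2 * (k * (k + 1)) := by nlinarith
              nlinarith
            linarith
        _ = m k * (2 / Real.log 2 * (1 / ((k + 1 : ℕ) : ℝ) ^ 2)) := by rw [← Finset.sum_mul]
        _ ≤ (2 * B + Real.log 2) * (2 / Real.log 2 * (1 / ((k + 1 : ℕ) : ℝ) ^ 2)) := by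
            gcongr
            exact hmle k
        _ = _ := by ring
  have hsum : Summable fun k => dyadicLogZeta k - m k / ((k + 1) * Real.log 2) :=
    Summable.of_nonneg_of_le (fun k => (hr k).1) (fun k => (hr k).2)
      (((summable_nat_add_iff 1).2 (Real.summable_one_div_nat_pow.2 one_lt_two)).mul_left _)
  refine ⟨_, (hl₁.add hsum.hasSum.tendsto_sum_nat).congr fun K => ?_⟩
  rw [← Finset.sum_add_distrib]
  refine Finset.sum_congr rfl fun k _ => ?_
  have : (k : ℝ) + 1 ≠ 0 := by positivity
  rw [smul_eq_mul]
  field_simp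
  ring

end Mertens

/-! ### The constant in Mertens' theorem -/

section MertensConstant

open ArithmeticFunction Filter Topology

lemma eventually_sum_le_log_riemannZeta : ∀ᶠ s : ℝ in 𝓝[>] 1, ∀ t : Finset ℕ,
    ∑ n ∈ t, Λ n / (n ^ s * Real.log n) ≤ Real.log (riemannZeta (s : ℂ)).re := by
  have hz := log_riemannZeta_add_log_sub_isLittleO_ofReal
  rw [Asymptotics.isLittleO_one_iff] at hz
  have h1 : ∀ᶠ s : ℝ in 𝓝[>] 1, s - 1 < Real.exp (-1) :=
    nhdsWithin_le_nhds (((continuous_id.sub continuous_const).tendsto (1 : ℝ)).eventually_lt_const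
      (by simpa using Real.exp_pos _))
  filter_upwards [self_mem_nhdsWithin, hz.eventually_const_lt (show (-1 : ℝ) < 0 by norm_num), h1]
    with s hs hs1 hs2 t
  have hs' : 0 < s - 1 := sub_pos.2 hs
  have hlog : Real.log (s - 1) < -1 := by
    rw [Real.log_lt_iff_lt_exp hs']; exact hs2
  -- the logarithm of `ζ` is positive near `1`, so the series for it is not a junk value
  have hpos : 0 < Real.log (riemannZeta (s : ℂ)).re := by linarith
  rw [log_riemannZeta_eq hs] at hpos ⊢
  have hsum : Summable fun n : ℕ => Λ n / ((n : ℝ) ^ s * Real.log n) := by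
    by_contra h
    rw [tsum_eq_zero_of_not_summable h] at hpos
    exact lt_irrefl _ hpos
  exact hsum.sum_le_tsum t fun n _ => div_nonneg vonMangoldt_nonneg
    (mul_nonneg (by positivity) (Real.log_natCast_nonneg n))

/-- For `z = 2 ^ (1 - s)` the power series with coefficients `dyadicLogZeta` minorizes `log ζ(s)`. -/
lemma sum_dyadicLogZeta_mul_pow_le {s : ℝ} (hs : 1 < s) (K : ℕ) :
    ∑ k ∈ Finset.range K, dyadicLogZeta k * ((2 : ℝ) ^ (1 - s)) ^ (k + 1) ≤
      ∑ n ∈ Finset.Ico 1 (2 ^ K), Λ n / (n ^ s * Real.log n) := by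
  rw [← sum_range_sum_Ico_two_pow]
  refine Finset.sum_le_sum fun k _ => ?_
  rw [dyadicLogZeta, Finset.sum_mul]
  refine Finset.sum_le_sum fun n hn => ?_
  rw [Finset.mem_Ico] at hn
  have hn0 : (0 : ℝ) < n := by exact_mod_cast lt_of_lt_of_le (by positivity : 0 < 2 ^ k) hn.1
  have h1 : ((2 : ℝ) ^ (1 - s)) ^ (k + 1) ≤ (n : ℝ) ^ (1 - s) := by
    rw [Real.rpow_pow_comm zero_le_two]
    exact Real.rpow_le_rpow_of_nonpos hn0 (by exact_mod_cast hn.2.le) (by linarith)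
  calc _ ≤ Λ n / (n * Real.log n) * (n : ℝ) ^ (1 - s) :=
        mul_le_mul_of_nonneg_left h1 (div_nonneg vonMangoldt_nonneg
          (mul_nonneg hn0.le (Real.log_natCast_nonneg n)))
    _ = _ := by
      rw [Real.rpow_sub hn0, Real.rpow_one]
      field_simp

lemma tendsto_log_div_sub_one : Tendsto (fun z : ℝ => Real.log z / (z - 1)) (𝓝[<] 1) (𝓝 1) := by
  have h := (Real.hasDerivAt_log one_ne_zero).tendsto_slope
  simp only [inv_one, slope_fun_def_field, Real.log_one, sub_zero] at h
  exact h.mono_left (nhdsWithin_mono _ fun x hx => ne_of_lt hx)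

/-- The constant in the dyadic form of Mertens' second theorem is at most the one read off from
the pole of `ζ`: by Abel's limit theorem it is the limit, as `z` tends to `1`, of a power series in
`z = 2 ^ (1 - s)` that is at most `log ζ(s) + log (1 - z)`. -/
lemma le_log_log_two_of_tendsto {l : ℝ}
    (hl : Tendsto (fun K => ∑ k ∈ Finset.range K, (dyadicLogZeta k - 1 / ((k : ℝ) + 1))) atTop
      (𝓝 l)) : l ≤ Real.log (Real.log 2) := by
  have hlog2 : 0 < Real.log 2 := Real.log_pos (by norm_num)
  have habel := Real.tendsto_tsum_powerSeries_nhdsWithin_lt hl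
  have hid : Tendsto (fun z : ℝ => z) (𝓝[<] 1) (𝓝 1) := tendsto_id.mono_left nhdsWithin_le_nhds
  have hz01 : ∀ᶠ z : ℝ in 𝓝[<] 1, 0 < z ∧ z < 1 :=
    (hid.eventually_const_lt zero_lt_one).and self_mem_nhdsWithin
  -- `s` is the exponent for which `2 ^ (1 - s) = z`
  set s : ℝ → ℝ := fun z => 1 - Real.log z / Real.log 2 with hs
  have hs1 : ∀ z, 0 < z → z < 1 → 1 < s z := fun z h0 h1 => by
    have := div_neg_of_neg_of_pos (Real.log_neg h0 h1) hlog2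
    simp only [hs]; linarith
  have hst : Tendsto s (𝓝[<] 1) (𝓝[>] 1) := by
    refine tendsto_nhdsWithin_iff.2 ⟨?_, hz01.mono fun z hz => hs1 z hz.1 hz.2⟩
    have := ((Real.continuousAt_log one_ne_zero).tendsto.comp hid).div_const (Real.log 2)
    simpa [hs, Function.comp_def] using this.const_sub 1
  have hzeta := log_riemannZeta_add_log_sub_isLittleO_ofReal
  rw [Asymptotics.isLittleO_one_iff] at hzeta
  have hlim : Tendsto (fun z : ℝ => (Real.log (riemannZeta (s z : ℂ)).re + Real.log (s z - 1)) +
      (Real.log (Real.log 2) - Real.log (Real.log z / (z - 1)))) (𝓝[<] 1)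
      (𝓝 (0 + (Real.log (Real.log 2) - Real.log 1))) :=
    (hzeta.comp hst).add (((Real.continuousAt_log one_ne_zero).tendsto.comp
      tendsto_log_div_sub_one).const_sub _)
  have hlhs : Tendsto (fun z : ℝ => z * ∑' k : ℕ, (dyadicLogZeta k - 1 / ((k : ℝ) + 1)) * z ^ k)
      (𝓝[<] 1) (𝓝 (1 * l)) := hid.mul habel
  rw [Real.log_one, sub_zero, zero_add] at hlim
  rw [one_mul] at hlhs
  refine le_of_tendsto_of_tendsto hlhs hlim ?_
  filter_upwards [hz01, hst.eventually eventually_sum_le_log_riemannZeta] with z ⟨h0, h1⟩ hz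
  have hpow : (2 : ℝ) ^ (1 - s z) = z := by
    rw [Real.rpow_def_of_pos two_pos]
    simp only [hs, sub_sub_cancel]
    rw [mul_div_cancel₀ _ hlog2.ne', Real.exp_log h0]
  have hsub : Real.log (s z - 1) + (Real.log (Real.log 2) - Real.log (Real.log z / (z - 1))) =
      Real.log (1 - z) := by
    have hlz := Real.log_neg h0 h1
    have e1 : s z - 1 = -Real.log z / Real.log 2 := by simp only [hs]; ring
    have e2 : Real.log z / (z - 1) = -Real.log z / (1 - z) := by
      rw [← neg_sub 1 z, div_neg, neg_div]
    rw [e1, e2, Real.log_div (by linarith) hlog2.ne', Real.log_div (by linarith) (by linarith)]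
    ring
  rw [add_assoc, hsub]
  obtain ⟨C, hC⟩ : ∃ C, ∀ k : ℕ, |dyadicLogZeta k - 1 / ((k : ℝ) + 1)| ≤ C := by
    have h := (hl.comp (tendsto_add_atTop_nat 1)).sub hl
    simp only [Function.comp_def, Finset.sum_range_succ, add_sub_cancel_left, sub_self] at h
    obtain ⟨C, hC⟩ := h.abs.bddAbove_range
    exact ⟨C, fun k => hC ⟨k, rfl⟩⟩
  have hsum : Summable fun k : ℕ => (dyadicLogZeta k - 1 / ((k : ℝ) + 1)) * z ^ k := by
    refine Summable.of_norm_bounded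
      ((summable_geometric_of_lt_one h0.le h1).mul_left C) fun k => ?_
    rw [norm_mul, Real.norm_eq_abs, norm_pow, Real.norm_of_nonneg h0.le]
    gcongr
    exact hC k
  have hser := Real.hasSum_pow_div_log_of_abs_lt_one (x := z) (by rwa [abs_of_pos h0])
  have htend := (hsum.hasSum.tendsto_sum_nat.const_mul z).add hser.tendsto_sum_nat
  rw [← sub_neg_eq_add, le_sub_iff_add_le]
  refine le_of_tendsto' htend fun K => ?_
  have h := (sum_dyadicLogZeta_mul_pow_le (hs1 z h0 h1) K).trans (hz _)
  rw [hpow] at h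
  refine le_trans (le_of_eq ?_) h
  rw [Finset.mul_sum, ← Finset.sum_add_distrib]
  refine Finset.sum_congr rfl fun k _ => ?_
  ring

/-- An upper bound in Mertens' second theorem for prime powers, with the sharp constant. -/
lemma exists_sum_vonMangoldt_div_log_eq : ∃ x : ℕ → ℝ, ∃ l,
    l ≤ Real.log (Real.log 2) + Real.eulerMascheroniConstant ∧ Tendsto x atTop (𝓝 l) ∧
      ∀ K : ℕ, ∑ n ∈ Finset.Ico 1 (2 ^ K), Λ n / (n * Real.log n) = Real.log K + x K := by
  obtain ⟨l, hl⟩ := exists_tendsto_sum_dyadicLogZeta_sub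
  refine ⟨fun K => ∑ n ∈ Finset.Ico 1 (2 ^ K), Λ n / (n * Real.log n) - Real.log K,
    l + Real.eulerMascheroniConstant, by gcongr; exact le_log_log_two_of_tendsto hl, ?_,
    fun K => by ring⟩
  refine (hl.add Real.tendsto_harmonic_sub_log).congr fun K => ?_
  rw [← sum_range_sum_Ico_two_pow, Finset.sum_sub_distrib, harmonic]
  simp only [dyadicLogZeta]
  push_cast
  simp only [one_div]
  ring

end MertensConstant

/-! ### The product of `(p - 1) / (p + 1)` over small primes -/

section MertensProduct

open ArithmeticFunction Filter Topology

lemma sum_primesBelow_sum_pow_div_le (N : ℕ) :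
    ∑ p ∈ Nat.primesBelow N, ∑ i ∈ Finset.range (Nat.log p (N - 1)),
      ((p : ℝ)⁻¹) ^ (i + 1) / ((i : ℝ) + 1) ≤ ∑ n ∈ Finset.Ico 1 N, Λ n / (n * Real.log n) := by
  rw [Finset.sum_sigma']
  have hinj : Set.InjOn (fun x : (_ : ℕ) × ℕ => x.1 ^ (x.2 + 1))
      ((Nat.primesBelow N).sigma fun p => Finset.range (Nat.log p (N - 1)) :
        Finset ((_ : ℕ) × ℕ)) := by
    rintro ⟨p, i⟩ hp ⟨q, j⟩ hq h
    simp only [Finset.coe_sigma, Set.mem_sigma_iff, Finset.mem_coe] at hp hq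
    obtain ⟨rfl, rfl⟩ := Nat.Prime.pow_inj (Nat.prime_of_mem_primesBelow hp.1)
      (Nat.prime_of_mem_primesBelow hq.1) h
    rfl
  calc _ = ∑ x ∈ (Nat.primesBelow N).sigma fun p => Finset.range (Nat.log p (N - 1)),
        (fun n : ℕ => Λ n / (n * Real.log n)) (x.1 ^ (x.2 + 1)) := by
        refine Finset.sum_congr rfl fun x hx => ?_
        obtain ⟨hp, hi⟩ := Finset.mem_sigma.1 hx
        have hp' := Nat.prime_of_mem_primesBelow hp
        have h0 : Real.log x.1 ≠ 0 := (Real.log_pos (by exact_mod_cast hp'.one_lt)).ne'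
        have h1 : (x.1 : ℝ) ≠ 0 := by exact_mod_cast hp'.ne_zero
        have h2 : (x.2 : ℝ) + 1 ≠ 0 := by positivity
        dsimp only
        rw [vonMangoldt_apply_pow (Nat.succ_ne_zero _), vonMangoldt_apply_prime hp']
        push_cast
        rw [Real.log_pow, inv_pow]
        push_cast
        field_simp
    _ = ∑ n ∈ ((Nat.primesBelow N).sigma fun p => Finset.range (Nat.log p (N - 1))).image
        (fun x : (_ : ℕ) × ℕ => x.1 ^ (x.2 + 1)), Λ n / (n * Real.log n) :=
        (Finset.sum_image (f := fun n : ℕ => Λ n / (n * Real.log n)) hinj).symm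
    _ ≤ _ := by
        refine Finset.sum_le_sum_of_subset_of_nonneg ?_ fun n _ _ =>
          div_nonneg vonMangoldt_nonneg (mul_nonneg (Nat.cast_nonneg _)
            (Real.log_natCast_nonneg n))
        intro n hn
        obtain ⟨x, hx, rfl⟩ := Finset.mem_image.1 hn
        obtain ⟨hp, hi⟩ := Finset.mem_sigma.1 hx
        have hp' := Nat.prime_of_mem_primesBelow hp
        have hpN := Nat.lt_of_mem_primesBelow hp
        have h : x.1 ^ (x.2 + 1) ≤ N - 1 :=
          Nat.pow_le_of_le_log (by have := hp'.two_le; omega) (Finset.mem_range.1 hi)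
        have := pow_pos hp'.pos (x.2 + 1)
        rw [Finset.mem_Ico]
        omega

/-- Replacing the prime powers below `N` by all powers of the primes below `N` costs little. -/
lemma sum_neg_log_one_sub_inv_le (N : ℕ) :
    ∑ p ∈ Nat.primesBelow N, -Real.log (1 - (p : ℝ)⁻¹) ≤
      ∑ n ∈ Finset.Ico 1 N, Λ n / (n * Real.log n) +
        2 * (∑' n : ℕ, 1 / (n : ℝ) ^ (3 / 2 : ℝ)) / (N : ℝ) ^ (1 / 4 : ℝ) := by
  have hsum : Summable fun n : ℕ => 1 / (n : ℝ) ^ (3 / 2 : ℝ) :=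
    Real.summable_one_div_nat_rpow.2 (by norm_num)
  have hterm : ∀ p ∈ Nat.primesBelow N, -Real.log (1 - (p : ℝ)⁻¹) ≤
      ∑ i ∈ Finset.range (Nat.log p (N - 1)), ((p : ℝ)⁻¹) ^ (i + 1) / ((i : ℝ) + 1) +
        2 / (N : ℝ) ^ (1 / 4 : ℝ) * (1 / (p : ℝ) ^ (3 / 2 : ℝ)) := fun p hp => by
    have hp' := Nat.prime_of_mem_primesBelow hp
    have hpN := Nat.lt_of_mem_primesBelow hp
    have h2 : (2 : ℝ) ≤ p := by exact_mod_cast hp'.two_le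
    have hinv : (p : ℝ)⁻¹ ≤ 1 / 2 := by
      rw [one_div]; exact inv_anti₀ two_pos h2
    have hinv0 : 0 < (p : ℝ)⁻¹ := by positivity
    have habs : |(p : ℝ)⁻¹| = (p : ℝ)⁻¹ := abs_of_pos hinv0
    set J := Nat.log p (N - 1) with hJ
    have h := (abs_le.1 (Real.abs_log_sub_add_sum_range_le (x := (p : ℝ)⁻¹)
      (by rw [habs]; linarith) J)).1
    rw [habs] at h
    have htail : ((p : ℝ)⁻¹) ^ (J + 1) / (1 - (p : ℝ)⁻¹) ≤ 2 * ((p : ℝ)⁻¹) ^ (J + 1) := by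
      rw [div_le_iff₀ (by linarith)]
      nlinarith [pow_pos hinv0 (J + 1)]
    have hJ1 : 1 ≤ J := Nat.log_pos hp'.one_lt (by omega)
    have hX : (N : ℝ) ≤ (p : ℝ) ^ (J + 1) := by
      have : N - 1 < p ^ (J + 1) := Nat.lt_pow_succ_log_self hp'.one_lt (N - 1)
      exact_mod_cast (by omega : N ≤ p ^ (J + 1))
    have hX2 : (p : ℝ) ^ 2 ≤ (p : ℝ) ^ (J + 1) := pow_le_pow_right₀ (by linarith) (by omega)
    have hp0 : (0 : ℝ) < p := by linarith
    have hN0 : (0 : ℝ) < N := by exact_mod_cast (by omega : 0 < N)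
    -- the tail is bounded by `p ^ (-(J + 1))`, which is small in terms of `N` and summable over `p`
    have hsplit : (N : ℝ) ^ (1 / 4 : ℝ) * (p : ℝ) ^ (3 / 2 : ℝ) ≤ (p : ℝ) ^ (J + 1) := by
      have e1 : (p : ℝ) ^ (3 / 2 : ℝ) = ((p : ℝ) ^ 2) ^ (3 / 4 : ℝ) := by
        rw [← Real.rpow_natCast, ← Real.rpow_mul hp0.le]; norm_num
      have e2 : (p : ℝ) ^ (J + 1) =
          ((p : ℝ) ^ (J + 1)) ^ (1 / 4 : ℝ) * ((p : ℝ) ^ (J + 1)) ^ (3 / 4 : ℝ) := by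
        rw [← Real.rpow_add (by positivity)]; norm_num
      rw [e1, e2]
      gcongr
    have hlast : 2 * ((p : ℝ)⁻¹) ^ (J + 1) ≤
        2 / (N : ℝ) ^ (1 / 4 : ℝ) * (1 / (p : ℝ) ^ (3 / 2 : ℝ)) := by
      rw [div_mul_div_comm, mul_one, inv_pow, ← div_eq_mul_inv]
      gcongr
    linarith
  refine (Finset.sum_le_sum hterm).trans ?_
  rw [Finset.sum_add_distrib, ← Finset.mul_sum]
  refine add_le_add (sum_primesBelow_sum_pow_div_le N) ?_
  rw [mul_div_right_comm]
  gcongr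
  exact hsum.sum_le_tsum _ fun n _ => by positivity

lemma tendsto_prod_one_sub_inv_sq :
    Tendsto (fun N : ℕ => ∏ p ∈ Nat.primesBelow N, (1 - ((p : ℝ) ^ 2)⁻¹)⁻¹) atTop
      (𝓝 (Real.pi ^ 2 / 6)) := by
  have h := riemannZeta_eulerProduct (s := 2) (by norm_num)
  rw [riemannZeta_two] at h
  have h2 := (Complex.continuous_re.tendsto _).comp h
  have e : ((Real.pi : ℂ) ^ 2 / 6).re = Real.pi ^ 2 / 6 := by
    rw [show ((Real.pi : ℂ) ^ 2 / 6) = ((Real.pi ^ 2 / 6 : ℝ) : ℂ) by push_cast; rfl,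
      Complex.ofReal_re]
  rw [e] at h2
  refine h2.congr fun N => ?_
  have : ∏ p ∈ Nat.primesBelow N, (1 - (p : ℂ) ^ (-2 : ℂ))⁻¹ =
      ((∏ p ∈ Nat.primesBelow N, (1 - ((p : ℝ) ^ 2)⁻¹)⁻¹ : ℝ) : ℂ) := by
    push_cast
    refine Finset.prod_congr rfl fun p _ => ?_
    rw [Complex.cpow_neg]
    norm_cast
  rw [Function.comp_apply, this, Complex.ofReal_re]

/-- A sharp lower bound for `∏ p < 2 ^ K, (p - 1) / (p + 1)`, a consequence of the upper bound in
Mertens' third theorem and of `ζ 2 = π ^ 2 / 6`. -/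
lemma exists_le_sq_mul_prod_primesBelow : ∃ c : ℕ → ℝ, ∃ C,
    Real.pi ^ 2 / (6 * Real.exp (2 * Real.eulerMascheroniConstant) * Real.log 2 ^ 2) ≤ C ∧
      Tendsto c atTop (𝓝 C) ∧ ∀ K : ℕ, K ≠ 0 →
        c K ≤ K ^ 2 * ∏ p ∈ Nat.primesBelow (2 ^ K), ((p : ℝ) - 1) / (p + 1) := by
  obtain ⟨x, l, hl, hx, hxK⟩ := exists_sum_vonMangoldt_div_log_eq
  have hlog2 : 0 < Real.log 2 := Real.log_pos (by norm_num)
  set T := 2 * ∑' n : ℕ, 1 / (n : ℝ) ^ (3 / 2 : ℝ) with hT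
  have hpow : Tendsto (fun K : ℕ => 2 ^ K) atTop atTop :=
    tendsto_pow_atTop_atTop_of_one_lt one_lt_two
  have htail : Tendsto (fun K : ℕ => T / (((2 ^ K : ℕ) : ℝ)) ^ (1 / 4 : ℝ)) atTop (𝓝 0) :=
    ((tendsto_rpow_atTop (by norm_num)).comp
      (tendsto_natCast_atTop_atTop.comp hpow)).const_div_atTop T
  refine ⟨fun K => (∏ p ∈ Nat.primesBelow (2 ^ K), (1 - ((p : ℝ) ^ 2)⁻¹)⁻¹) *
    Real.exp (-2 * (x K + T / (((2 ^ K : ℕ) : ℝ)) ^ (1 / 4 : ℝ))),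
    Real.pi ^ 2 / 6 * Real.exp (-2 * (l + 0)), ?_,
    (tendsto_prod_one_sub_inv_sq.comp hpow).mul
      ((Real.continuous_exp.tendsto _).comp ((hx.add htail).const_mul (-2))), fun K hK => ?_⟩
  · have h : Real.exp (2 * Real.eulerMascheroniConstant) * Real.log 2 ^ 2 =
        Real.exp (2 * (Real.log (Real.log 2) + Real.eulerMascheroniConstant)) := by
      rw [mul_add, Real.exp_add, mul_comm, two_mul (Real.log _), Real.exp_add,
        Real.exp_log hlog2, sq]
    rw [mul_assoc, h, ← div_div, div_eq_mul_inv _ (Real.exp _), ← Real.exp_neg]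
    gcongr
    linarith
  · have hK0 : (0 : ℝ) < K := by exact_mod_cast Nat.pos_of_ne_zero hK
    have hfac : ∏ p ∈ Nat.primesBelow (2 ^ K), ((p : ℝ) - 1) / (p + 1) =
        (∏ p ∈ Nat.primesBelow (2 ^ K), (1 - ((p : ℝ) ^ 2)⁻¹)⁻¹) *
          Real.exp (-2 * ∑ p ∈ Nat.primesBelow (2 ^ K), -Real.log (1 - (p : ℝ)⁻¹)) := by
      rw [Finset.mul_sum, Real.exp_sum, ← Finset.prod_mul_distrib]
      refine Finset.prod_congr rfl fun p hp => ?_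
      have h1 : (1 : ℝ) < p := by exact_mod_cast (Nat.prime_of_mem_primesBelow hp).one_lt
      have h0 : (0 : ℝ) < 1 - (p : ℝ)⁻¹ := sub_pos.2 (inv_lt_one_of_one_lt₀ h1)
      have h2 : (p : ℝ) - 1 ≠ 0 := by linarith
      have h3 : (p : ℝ) + 1 ≠ 0 := by linarith
      have h4 : (p : ℝ) ^ 2 - 1 ≠ 0 := by
        rw [show (p : ℝ) ^ 2 - 1 = (p - 1) * (p + 1) by ring]; positivity
      rw [neg_mul_neg, two_mul, Real.exp_add, Real.exp_log h0]
      field_simp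
      ring
    have hU := (sum_neg_log_one_sub_inv_le (2 ^ K)).trans_eq (by rw [hxK K])
    rw [hfac, mul_left_comm]
    refine mul_le_mul_of_nonneg_left ?_ (Finset.prod_nonneg fun p hp => ?_)
    · have hKe : (K : ℝ) ^ 2 = Real.exp (2 * Real.log K) := by
        rw [two_mul, Real.exp_add, Real.exp_log hK0, sq]
      rw [hKe, ← Real.exp_add]
      refine Real.exp_le_exp.2 ?_
      linarith
    · have h1 : (1 : ℝ) < p := by exact_mod_cast (Nat.prime_of_mem_primesBelow hp).one_lt
      exact inv_nonneg.2 (sub_nonneg.2 (inv_le_one_of_one_le₀ (by nlinarith)))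

end MertensProduct

/-! ### The asymptotic bound for the length -/

section Asymptotics

open Filter Topology

/-- The exponent `k` such that the cutoff `2 ^ k` between small and large primes is used for tuples
whose length has a binary logarithm with `j` binary digits. -/
def cutoffExponent (j : ℕ) : ℕ := j + 5 + 2 * Nat.log 2 j

lemma sq_mul_le_two_pow_cutoffExponent {m j : ℕ} (hm : m < 2 ^ j) :
    8 * m * j ^ 2 ≤ 2 ^ cutoffExponent j := by
  have h : j ≤ 2 ^ (Nat.log 2 j + 1) := (Nat.lt_pow_succ_log_self one_lt_two j).le
  calc 8 * m * j ^ 2 ≤ 8 * 2 ^ j * (2 ^ (Nat.log 2 j + 1)) ^ 2 := by gcongr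
    _ = 2 ^ cutoffExponent j := by rw [cutoffExponent]; ring

variable {K L D : ℕ} {a : Fin K → ℕ} {b : Fin L → ℕ}

/-- The lower bound for the norm with `m = log₂ n`, `ε = 1 / (m j)` and `y = 2 ^ k ≥ 8 m j²`, where
`j` is about `log₂ m`: the error terms `8 / (ε y)` and `2 ε m` are `O(1 / j)`, and still `k` is
asymptotic to `j`. -/
lemma IsIntegralFactorialRatio.length_mul_le (h : IsIntegralFactorialRatio a b) (hL : L = K + D)
    {c : ℕ → ℝ} (hc : ∀ k : ℕ, k ≠ 0 →
      c k ≤ k ^ 2 * ∏ p ∈ Nat.primesBelow (2 ^ k), ((p : ℝ) - 1) / (p + 1))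
    {j : ℕ} (hj : j = Nat.log 2 (Nat.log 2 (K + L)) + 1) (hj3 : 3 ≤ j) :
    ((K + L : ℕ) : ℝ) * (c (cutoffExponent j) * ((1 - 1 / (j : ℝ)) * (1 - 2 / (j : ℝ)))) ≤
      3 * (D : ℝ) ^ 2 * (cutoffExponent j : ℝ) ^ 2 := by
  set m := Nat.log 2 (K + L) with hm
  have hm0 : m ≠ 0 := fun h0 => by rw [h0, Nat.log_zero_right] at hj; omega
  have hmj : m < 2 ^ j := hj ▸ Nat.lt_pow_succ_log_self one_lt_two m
  have hm4 : 4 ≤ m := by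
    calc 4 = 2 ^ 2 := rfl
      _ ≤ 2 ^ Nat.log 2 m := Nat.pow_le_pow_right two_pos (by omega)
      _ ≤ m := Nat.pow_log_le_self 2 hm0
  have hm4' : (4 : ℝ) ≤ m := by exact_mod_cast hm4
  have hj3' : (3 : ℝ) ≤ j := by exact_mod_cast hj3
  have hmjpos : (0 : ℝ) < m * j := by positivity
  set k := cutoffExponent j with hk
  have hy : 8 * (m : ℝ) * (j : ℝ) ^ 2 ≤ ((2 ^ k : ℕ) : ℝ) := by
    exact_mod_cast sq_mul_le_two_pow_cutoffExponent hmj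
  have hεy : 8 * (j : ℝ) ≤ 1 / ((m : ℝ) * j) * ((2 ^ k : ℕ) : ℝ) := by
    rw [one_div_mul_eq_div, le_div_iff₀ hmjpos]
    linarith
  have hεm : 2 * (1 / ((m : ℝ) * j)) * m = 2 / j := by field_simp
  have hj2 : 2 / (j : ℝ) ≤ 1 := by rw [div_le_one (by linarith)]; linarith
  have key := isGcdGram_sawtoothVec.card_mul_prod_le_norm_sq (y := 2 ^ k)
    (ε := 1 / ((m : ℝ) * j)) (by positivity)
    (one_div_le_one_div_of_le (by norm_num) (by nlinarith)) (by linarith) h.isSignedFamily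
    (fun i _ => h.ne_zero i) (by
      rw [Finset.card_univ, Fintype.card_sum, Fintype.card_fin, Fintype.card_fin, ← hm, hεm]
      exact hj2)
  rw [Finset.card_univ, Fintype.card_sum, Fintype.card_fin, Fintype.card_fin, ← hm, hεm] at key
  have hfin := key.trans (h.norm_sq_le hL)
  have hfac : 1 - 1 / (j : ℝ) ≤ 1 - 8 / (1 / ((m : ℝ) * j) * ((2 ^ k : ℕ) : ℝ)) := by
    refine sub_le_sub_left ?_ 1
    rw [div_le_div_iff₀ (by linarith) (by linarith), one_mul]
    exact hεy
  have hj1 : 0 ≤ 1 - 1 / (j : ℝ) := by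
    rw [sub_nonneg, div_le_one (by linarith)]; linarith
  have hj2' : 0 ≤ 1 - 2 / (j : ℝ) := sub_nonneg.2 hj2
  have hP : 0 ≤ ∏ p ∈ Nat.primesBelow (2 ^ k), ((p : ℝ) - 1) / (p + 1) :=
    Finset.prod_nonneg fun p hp => by
      have : (1 : ℝ) < p := by exact_mod_cast (Nat.prime_of_mem_primesBelow hp).one_lt
      exact div_nonneg (by linarith) (by linarith)
  calc ((K + L : ℕ) : ℝ) * (c k * ((1 - 1 / (j : ℝ)) * (1 - 2 / (j : ℝ))))
      ≤ ((K + L : ℕ) : ℝ) * ((k ^ 2 * ∏ p ∈ Nat.primesBelow (2 ^ k), ((p : ℝ) - 1) / (p + 1)) *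
        ((1 - 8 / (1 / ((m : ℝ) * j) * ((2 ^ k : ℕ) : ℝ))) * (1 - 2 / (j : ℝ)))) := by
        have := hc k (by rw [hk, cutoffExponent]; omega)
        gcongr
    _ = k ^ 2 * (((K + L : ℕ) : ℝ) *
        (∏ p ∈ Nat.primesBelow (2 ^ k), ((p : ℝ) - 1) / (p + 1)) *
        ((1 - 8 / (1 / ((m : ℝ) * j) * ((2 ^ k : ℕ) : ℝ))) * (1 - 2 / (j : ℝ)))) := by ring
    _ ≤ k ^ 2 * (3 * (D : ℝ) ^ 2) := by gcongr
    _ = _ := by ring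

lemma tendsto_natLog_div_atTop : Tendsto (fun j : ℕ => (Nat.log 2 j : ℝ) / j) atTop (𝓝 0) := by
  have h := (Real.isLittleO_log_id_atTop.tendsto_div_nhds_zero.comp
    tendsto_natCast_atTop_atTop).div_const (Real.log 2)
  rw [zero_div] at h
  refine squeeze_zero (fun j => by positivity) (fun j => ?_) h
  have := Real.natLog_le_logb j 2
  rw [Real.logb] at this
  simp only [Function.comp_apply, id_eq]
  rw [div_right_comm]
  gcongr
  exact_mod_cast this

lemma tendsto_cutoffExponent_div_atTop :
    Tendsto (fun j : ℕ => (cutoffExponent j : ℝ) / j) atTop (𝓝 1) := by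
  have h := ((tendsto_const_div_atTop_nhds_zero_nat (5 : ℝ)).const_add 1).add
    (tendsto_natLog_div_atTop.const_mul 2)
  rw [add_zero, mul_zero, add_zero] at h
  refine h.congr' ?_
  filter_upwards [eventually_ne_atTop 0] with j hj
  have : (j : ℝ) ≠ 0 := by exact_mod_cast hj
  rw [cutoffExponent]
  push_cast
  field_simp

/-- The bound in terms of the length `n = K + L` alone: up to lower order terms, `n` is at most
`(18 e ^ (2 γ) / π ^ 2) D ^ 2 (log log n) ^ 2`. -/
lemma exists_length_le_mul_log_log_sq {τ : ℝ} (hτ : 0 < τ) : ∃ n₀ : ℕ, ∀ (D K L : ℕ),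
    L = K + D → n₀ ≤ K + L → ∀ (a : Fin K → ℕ) (b : Fin L → ℕ), IsIntegralFactorialRatio a b →
      ((K + L : ℕ) : ℝ) ≤ (1 + τ) * (18 * Real.exp (2 * Real.eulerMascheroniConstant) /
        Real.pi ^ 2) * (D : ℝ) ^ 2 * Real.log (Real.log (K + L : ℕ)) ^ 2 := by
  obtain ⟨c, C, hC, hcC, hc⟩ := exists_le_sq_mul_prod_primesBelow
  have hlog2 : 0 < Real.log 2 := Real.log_pos (by norm_num)
  set C₀ := 18 * Real.exp (2 * Real.eulerMascheroniConstant) / Real.pi ^ 2 with hC₀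
  have hC₀pos : 0 < C₀ := by positivity
  have hCC₀ : 3 / (C * Real.log 2 ^ 2) ≤ C₀ := by
    have hpos : 0 < Real.pi ^ 2 /
      (6 * Real.exp (2 * Real.eulerMascheroniConstant) * Real.log 2 ^ 2) := by positivity
    have e : C₀ = 3 / (Real.pi ^ 2 /
        (6 * Real.exp (2 * Real.eulerMascheroniConstant) * Real.log 2 ^ 2) *
          Real.log 2 ^ 2) := by
      rw [hC₀]; field_simp; norm_num
    rw [e]
    gcongr
  have hCpos : 0 < C := lt_of_lt_of_le (by positivity) hC
  have hk : Tendsto cutoffExponent atTop atTop :=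
    tendsto_atTop_mono (fun j => by rw [cutoffExponent, id]; omega) tendsto_id
  have hden : Tendsto (fun j : ℕ => c (cutoffExponent j) * ((1 - 1 / (j : ℝ)) * (1 - 2 / (j : ℝ))))
      atTop (𝓝 (C * ((1 - 0) * (1 - 0)))) :=
    (hcC.comp hk).mul (((tendsto_const_div_atTop_nhds_zero_nat 1).const_sub 1).mul
      ((tendsto_const_div_atTop_nhds_zero_nat 2).const_sub 1))
  have hll : Tendsto (fun j : ℕ => Real.log 2 + (Real.log (Real.log 2) - Real.log 2) / (j : ℝ))
      atTop (𝓝 (Real.log 2 + 0)) := (tendsto_const_div_atTop_nhds_zero_nat _).const_add _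
  have hlim : Tendsto (fun j : ℕ => 3 * ((cutoffExponent j : ℝ) / j) ^ 2 /
      (c (cutoffExponent j) * ((1 - 1 / (j : ℝ)) * (1 - 2 / (j : ℝ))) *
        (Real.log 2 + (Real.log (Real.log 2) - Real.log 2) / (j : ℝ)) ^ 2)) atTop
      (𝓝 (3 * 1 ^ 2 / (C * ((1 - 0) * (1 - 0)) * (Real.log 2 + 0) ^ 2))) :=
    ((tendsto_cutoffExponent_div_atTop.pow 2).const_mul 3).div (hden.mul (hll.pow 2))
      (by simp only [sub_zero, mul_one, add_zero]; positivity)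
  simp only [sub_zero, mul_one, add_zero, one_pow] at hlim hden hll
  have hev : ∀ᶠ j : ℕ in atTop, 3 ≤ j ∧
      0 < c (cutoffExponent j) * ((1 - 1 / (j : ℝ)) * (1 - 2 / (j : ℝ))) ∧
      0 < Real.log 2 + (Real.log (Real.log 2) - Real.log 2) / (j : ℝ) ∧
      3 * ((cutoffExponent j : ℝ) / j) ^ 2 /
        (c (cutoffExponent j) * ((1 - 1 / (j : ℝ)) * (1 - 2 / (j : ℝ))) *
          (Real.log 2 + (Real.log (Real.log 2) - Real.log 2) / (j : ℝ)) ^ 2) < (1 + τ) * C₀ := by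
    refine (eventually_ge_atTop 3).and ((hden.eventually_const_lt hCpos).and
      ((hll.eventually_const_lt hlog2).and (hlim.eventually_lt_const ?_)))
    exact hCC₀.trans_lt (by nlinarith)
  obtain ⟨j₀, hj₀⟩ := eventually_atTop.1 hev
  refine ⟨2 ^ 2 ^ j₀, fun D K L hL hn a b h => ?_⟩
  set m := Nat.log 2 (K + L) with hm
  set j := Nat.log 2 m + 1 with hj
  have hm2 : 2 ^ j₀ ≤ m := Nat.le_log_of_pow_le one_lt_two hn
  have hjj₀ : j₀ ≤ j := (Nat.le_log_of_pow_le one_lt_two hm2).trans (Nat.le_succ _)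
  obtain ⟨hj3, hden0, hll0, hlt⟩ := hj₀ j hjj₀
  have hmain := h.length_mul_le hL hc hj hj3
  have hj0 : (0 : ℝ) < j := by positivity
  set d := c (cutoffExponent j) * ((1 - 1 / (j : ℝ)) * (1 - 2 / (j : ℝ))) with hd
  set u := Real.log 2 + (Real.log (Real.log 2) - Real.log 2) / (j : ℝ) with hu
  have hloglog : u * j ≤ Real.log (Real.log (K + L : ℕ)) := by
    have hm0 : 0 < m := lt_of_lt_of_le (by positivity) hm2
    have hn0 : 0 < K + L := lt_of_lt_of_le (by positivity) hn
    have h1 : (m : ℝ) * Real.log 2 ≤ Real.log (K + L : ℕ) := by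
      rw [← Real.log_pow]
      exact Real.log_le_log (by positivity)
        (by exact_mod_cast Nat.pow_log_le_self 2 hn0.ne')
    have h2 : ((j : ℝ) - 1) * Real.log 2 ≤ Real.log m := by
      rw [hj]; push_cast
      rw [add_sub_cancel_right, ← Real.log_pow]
      exact Real.log_le_log (by positivity)
        (by exact_mod_cast Nat.pow_log_le_self 2 hm0.ne')
    have h3 : Real.log m + Real.log (Real.log 2) ≤ Real.log (Real.log (K + L : ℕ)) := by
      rw [← Real.log_mul (by positivity) hlog2.ne']
      exact Real.log_le_log (by positivity) h1
    have h4 : u * j = (j - 1) * Real.log 2 + Real.log (Real.log 2) := by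
      rw [hu]; field_simp; ring
    linarith
  have hnd : ((K + L : ℕ) : ℝ) ≤ 3 * (D : ℝ) ^ 2 * (cutoffExponent j : ℝ) ^ 2 / d := by
    rw [le_div_iff₀ hden0]; exact hmain
  calc ((K + L : ℕ) : ℝ) ≤ 3 * (D : ℝ) ^ 2 * (cutoffExponent j : ℝ) ^ 2 / d := hnd
    _ = 3 * ((cutoffExponent j : ℝ) / j) ^ 2 / (d * u ^ 2) * ((D : ℝ) ^ 2 * (u * j) ^ 2) := by
      field_simp
    _ ≤ (1 + τ) * C₀ * ((D : ℝ) ^ 2 * Real.log (Real.log (K + L : ℕ)) ^ 2) := by gcongr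
    _ = _ := by ring

/-- A crude polynomial bound for the length. -/
lemma exists_length_le_max : ∃ n₀ : ℕ, ∀ (D K L : ℕ), L = K + D →
    ∀ (a : Fin K → ℕ) (b : Fin L → ℕ), IsIntegralFactorialRatio a b →
      K + L ≤ max n₀ (D ^ 4) := by
  obtain ⟨n₁, hn₁⟩ := exists_length_le_mul_log_log_sq one_pos
  set C₀ := 18 * Real.exp (2 * Real.eulerMascheroniConstant) / Real.pi ^ 2 with hC₀
  have hC₀pos : 0 < C₀ := by positivity
  have hlog : ∀ᶠ x : ℝ in atTop, (1 + 1) * C₀ * Real.log (Real.log x) ^ 2 ≤ x ^ (1 / 2 : ℝ) := by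
    have h1 : Tendsto (fun x : ℝ => Real.log x ^ 2 / x ^ (1 / 2 : ℝ)) atTop (𝓝 0) := by
      have := isLittleO_log_rpow_rpow_atTop (s := 1 / 2) 2 (by norm_num)
      simpa using this.tendsto_div_nhds_zero
    filter_upwards [(h1.const_mul ((1 + 1) * C₀)).eventually_lt_const
      (show (1 + 1) * C₀ * 0 < 1 by simp), eventually_ge_atTop (Real.exp 1)] with x hx hxe
    have hx0 : 0 < x := (Real.exp_pos 1).trans_le hxe
    have hlx : 1 ≤ Real.log x := by rwa [Real.le_log_iff_exp_le hx0]
    have hll0 : 0 ≤ Real.log (Real.log x) := Real.log_nonneg hlx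
    have hll : Real.log (Real.log x) ≤ Real.log x :=
      (Real.log_le_sub_one_of_pos (by linarith)).trans (by linarith)
    have hxp : 0 < x ^ (1 / 2 : ℝ) := Real.rpow_pos_of_pos hx0 _
    rw [← mul_div_assoc, div_lt_one hxp] at hx
    refine le_trans ?_ hx.le
    gcongr
  obtain ⟨n₂, hn₂⟩ := eventually_atTop.1 (tendsto_natCast_atTop_atTop.eventually hlog)
  refine ⟨max n₁ n₂, fun D K L hL a b h => ?_⟩
  by_contra! hlt
  have h1 := hn₁ D K L hL (by omega) a b h
  have h2 := hn₂ (K + L) (by omega)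
  set n := K + L
  have hn0 : (0 : ℝ) < n := by exact_mod_cast (by omega : 0 < n)
  have h3 : (n : ℝ) ≤ D ^ 2 * (n : ℝ) ^ (1 / 2 : ℝ) := by
    calc (n : ℝ) ≤ (1 + 1) * C₀ * (D : ℝ) ^ 2 * Real.log (Real.log n) ^ 2 := h1
      _ = D ^ 2 * ((1 + 1) * C₀ * Real.log (Real.log n) ^ 2) := by ring
      _ ≤ _ := by gcongr
  rw [← Real.sqrt_eq_rpow] at h3
  have h4 : Real.sqrt n ≤ D ^ 2 := by
    refine le_of_mul_le_mul_right ?_ (Real.sqrt_pos.2 hn0)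
    rwa [Real.mul_self_sqrt hn0.le]
  have h5 : (n : ℝ) ≤ (D : ℝ) ^ 4 := by
    rw [Real.sqrt_le_left (by positivity)] at h4
    calc (n : ℝ) ≤ ((D : ℝ) ^ 2) ^ 2 := h4
      _ = _ := by ring
  have h6 : n ≤ D ^ 4 := by exact_mod_cast h5
  omega

/-- By the crude bound, `log log n` may be replaced by `log log (D + 2)`. -/
lemma eventually_length_le {τ : ℝ} (hτ : 0 < τ) : ∀ᶠ D : ℕ in atTop, ∀ (K L : ℕ), L = K + D →
    ∀ (a : Fin K → ℕ) (b : Fin L → ℕ), IsIntegralFactorialRatio a b →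
      ((K + L : ℕ) : ℝ) ≤ (1 + τ) * ((18 * Real.exp (2 * Real.eulerMascheroniConstant) /
        Real.pi ^ 2) * (D : ℝ) ^ 2 * Real.log (Real.log ((D : ℝ) + 2)) ^ 2) := by
  have hσ1 : 1 < Real.sqrt (1 + τ) := by
    rw [Real.lt_sqrt one_pos.le]; linarith
  have hσ2 : Real.sqrt (1 + τ) * Real.sqrt (1 + τ) = 1 + τ := Real.mul_self_sqrt (by linarith)
  set σ := Real.sqrt (1 + τ) with hσ
  obtain ⟨n₁, hn₁⟩ := exists_length_le_mul_log_log_sq (sub_pos.2 hσ1)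
  obtain ⟨n₀, hn₀⟩ := exists_length_le_max
  set C₀ := 18 * Real.exp (2 * Real.eulerMascheroniConstant) / Real.pi ^ 2 with hC₀
  have hC₀pos : 0 < C₀ := by positivity
  have hD : Tendsto (fun D : ℕ => (D : ℝ) + 2) atTop atTop :=
    tendsto_atTop_add_const_right _ _ tendsto_natCast_atTop_atTop
  have hll : Tendsto (fun D : ℕ => Real.log (Real.log ((D : ℝ) + 2))) atTop atTop :=
    Real.tendsto_log_atTop.comp (Real.tendsto_log_atTop.comp hD)
  have hratio : ∀ᶠ D : ℕ in atTop, (Real.log 4 + Real.log (Real.log ((D : ℝ) + 2))) ^ 2 ≤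
      σ * Real.log (Real.log ((D : ℝ) + 2)) ^ 2 := by
    have h := ((hll.const_div_atTop (Real.log 4)).add_const 1).pow 2
    rw [zero_add, one_pow] at h
    filter_upwards [h.eventually_lt_const hσ1, hll.eventually_gt_atTop 0] with D hD1 hD2
    rw [div_add_one hD2.ne', div_pow, div_lt_iff₀ (by positivity)] at hD1
    exact hD1.le
  filter_upwards [hratio, hll.eventually_ge_atTop 1, eventually_ge_atTop 2,
    eventually_ge_atTop n₀, tendsto_natCast_atTop_atTop.eventually_ge_atTop (((n₁ : ℝ) + 3) / C₀)]
    with D h1 h2 hD2 hD3 hD4 K L hL a b h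
  set n := K + L with hn
  set l := Real.log (Real.log ((D : ℝ) + 2)) with hl
  have hD1 : (1 : ℝ) ≤ D := by exact_mod_cast (by omega : 1 ≤ D)
  rw [div_le_iff₀ hC₀pos] at hD4
  rcases le_or_gt (max n₁ 3) n with hlarge | hsmall
  · have hb := hn₁ D K L hL (by omega) a b h
    rw [← hn, add_sub_cancel] at hb
    have hnD : n ≤ D ^ 4 := by
      have h4 : D ≤ D ^ 4 := Nat.le_self_pow (by norm_num) D
      have := hn₀ D K L hL a b h
      omega
    have hn3 : (3 : ℝ) ≤ n := by exact_mod_cast (le_max_right _ _).trans hlarge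
    have hlogn : 1 ≤ Real.log n := by
      rw [Real.le_log_iff_exp_le (by linarith)]
      linarith [Real.exp_one_lt_d9]
    have hlogD : Real.log n ≤ 4 * Real.log ((D : ℝ) + 2) := by
      calc Real.log n ≤ Real.log (((D : ℝ) + 2) ^ 4) := by
            refine Real.log_le_log (by linarith) (le_trans (b := (D : ℝ) ^ 4) ?_ ?_)
            · exact_mod_cast hnD
            · gcongr; linarith
        _ = 4 * Real.log ((D : ℝ) + 2) := by rw [Real.log_pow]; norm_num
    have hlogD0 : 0 < Real.log ((D : ℝ) + 2) := Real.log_pos (by linarith)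
    have hllD : Real.log (Real.log n) ≤ Real.log 4 + l := by
      rw [hl, ← Real.log_mul (by norm_num) hlogD0.ne']
      exact Real.log_le_log (by linarith) hlogD
    have hlln0 : 0 ≤ Real.log (Real.log n) := Real.log_nonneg hlogn
    calc (n : ℝ) ≤ σ * C₀ * (D : ℝ) ^ 2 * Real.log (Real.log n) ^ 2 := hb
      _ ≤ σ * C₀ * (D : ℝ) ^ 2 * (Real.log 4 + l) ^ 2 := by gcongr
      _ ≤ σ * C₀ * (D : ℝ) ^ 2 * (σ * l ^ 2) := by gcongr
      _ = σ * σ * (C₀ * (D : ℝ) ^ 2 * l ^ 2) := by ring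
      _ = _ := by rw [hσ2]
  · have hsmall' : (n : ℝ) ≤ n₁ + 3 := by exact_mod_cast (by omega : n ≤ n₁ + 3)
    have hDD : (D : ℝ) ≤ (D : ℝ) ^ 2 := by nlinarith
    calc (n : ℝ) ≤ D * C₀ := hsmall'.trans hD4
      _ ≤ (D : ℝ) ^ 2 * C₀ := by gcongr
      _ = 1 * (C₀ * (D : ℝ) ^ 2 * 1 ^ 2) := by ring
      _ ≤ (1 + τ) * (C₀ * (D : ℝ) ^ 2 * l ^ 2) := by gcongr; linarith

/-- The asymptotic bound for the length of an integral factorial ratio. -/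
theorem exists_tendsto_zero_length_le : ∃ ε : ℕ → ℝ, Tendsto ε atTop (𝓝 0) ∧
    ∀ D : ℕ, 1 ≤ D → ∀ (K L : ℕ), L = K + D → ∀ (a : Fin K → ℕ) (b : Fin L → ℕ),
      IsIntegralFactorialRatio a b →
        (K : ℝ) + (L : ℝ) ≤
          (1 + ε D) * (18 * Real.exp (2 * Real.eulerMascheroniConstant) / Real.pi ^ 2)
            * (D : ℝ) ^ 2 * Real.log (Real.log ((D : ℝ) + 2)) ^ 2 := by
  set R : ℕ → ℝ := fun D => (18 * Real.exp (2 * Real.eulerMascheroniConstant) / Real.pi ^ 2) *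
    (D : ℝ) ^ 2 * Real.log (Real.log ((D : ℝ) + 2)) ^ 2 with hR
  have hR0 : ∀ D, 1 ≤ D → 0 < R D := fun D hD => by
    have hD1 : (1 : ℝ) ≤ D := by exact_mod_cast hD
    have h1 : 1 < Real.log ((D : ℝ) + 2) := by
      rw [Real.lt_log_iff_exp_lt (by linarith)]
      linarith [Real.exp_one_lt_d9]
    have h2 : 0 < Real.log (Real.log ((D : ℝ) + 2)) := Real.log_pos h1
    simp only [hR]
    positivity
  -- the lengths that occur for a given `D`
  set T : ℕ → Set ℕ := fun D => {n | ∃ K L, L = K + D ∧ K + L = n ∧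
    ∃ (a : Fin K → ℕ) (b : Fin L → ℕ), IsIntegralFactorialRatio a b} with hT
  obtain ⟨n₀, hn₀⟩ := exists_length_le_max
  have hbdd : ∀ D, BddAbove (T D) := fun D => ⟨max n₀ (D ^ 4), by
    rintro n ⟨K, L, hL, rfl, a, b, h⟩
    exact hn₀ D K L hL a b h⟩
  refine ⟨fun D => max 0 ((sSup (T D) : ℕ) / R D - 1), ?_, fun D hD K L hL a b h => ?_⟩
  · rw [Metric.tendsto_atTop]
    intro τ hτ
    obtain ⟨D₀, hD₀⟩ := eventually_atTop.1
      ((eventually_length_le (half_pos hτ)).and (eventually_ge_atTop 1))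
    refine ⟨D₀, fun D hD => ?_⟩
    obtain ⟨h1, h2⟩ := hD₀ D hD
    have hsup : ((sSup (T D) : ℕ) : ℝ) ≤ (1 + τ / 2) * R D := by
      rcases (T D).eq_empty_or_nonempty with he | hne
      · rw [he, csSup_empty]
        simpa using mul_nonneg (by linarith) (hR0 D h2).le
      · obtain ⟨K, L, hL, hn, a, b, h⟩ := Nat.sSup_mem hne (hbdd D)
        rw [← hn]
        exact h1 K L hL a b h
    rw [dist_zero_right, Real.norm_of_nonneg (le_max_left _ _)]
    refine max_lt hτ ?_
    rw [sub_lt_iff_lt_add, div_lt_iff₀ (hR0 D h2)]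
    nlinarith [hR0 D h2]
  · have hle : ((K + L : ℕ) : ℝ) ≤ (sSup (T D) : ℕ) := by
      exact_mod_cast le_csSup (hbdd D) ⟨K, L, hL, rfl, a, b, h⟩
    have hε : ((sSup (T D) : ℕ) : ℝ) / R D ≤ 1 + max 0 ((sSup (T D) : ℕ) / R D - 1) := by
      linarith [le_max_right 0 (((sSup (T D) : ℕ) : ℝ) / R D - 1)]
    rw [div_le_iff₀ (hR0 D hD)] at hε
    rw [← Nat.cast_add, mul_assoc, mul_assoc, ← mul_assoc (_ / _)]
    exact hle.trans hε

end Asymptotics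

/-! ### Length, subspaces and finiteness -/

theorem theorem1p2 :
    (∃ ε : ℕ → ℝ, Filter.Tendsto ε Filter.atTop (nhds 0) ∧
      ∀ D : ℕ, 1 ≤ D → ∀ (K L : ℕ), L = K + D → ∀ (a : Fin K → ℕ) (b : Fin L → ℕ),
        IsIntegralFactorialRatio a b →
        (K : ℝ) + (L : ℝ) ≤
          (1 + ε D) * (18 * Real.exp (2 * Real.eulerMascheroniConstant) / Real.pi ^ 2)
            * (D : ℝ) ^ 2 * Real.log (Real.log ((D : ℝ) + 2)) ^ 2) ∧
    (∀ D : ℕ, 1 ≤ D → ∀ (K L : ℕ), L = K + D →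
      ∃ S : Set (Submodule ℝ (Fin (K + L) → ℝ)), S.Finite ∧
        (∀ V ∈ S, Module.finrank ℝ V ≤ 3 * D ^ 2 - 1) ∧
        ∀ (a : Fin K → ℕ) (b : Fin L → ℕ), IsIntegralFactorialRatio a b →
          ∃ V ∈ S, tuplePoint a b ∈ V) ∧
    ((∀ (K L : ℕ), L = K + 2 → 82 ≤ K + L →
        ∀ (a : Fin K → ℕ) (b : Fin L → ℕ), ¬ IsIntegralFactorialRatio a b) ∧
      {t : Σ K : ℕ, (Fin K → ℕ) × (Fin (K + 2) → ℕ) |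
        76 ≤ t.1 + (t.1 + 2) ∧ IsIntegralFactorialRatio t.2.1 t.2.2 ∧
          IsPrimitiveTuple t.2.1 t.2.2}.Finite) :=
  ⟨exists_tendsto_zero_length_le, fun _ hD K L hL => exists_finite_subspaces hD K L hL,
    fun _ _ hL hn _ _ => not_isIntegralFactorialRatio_of_le hL hn,
    finite_setOf_isPrimitiveTuple⟩
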